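/- Let $M$ be a smooth manifold. A Lie pre-crossed module $(\partial\colon E\to G,\triangleright)$ is a smooth homomorphism $\partial\colon E\to G$ of Lie groups with a smooth left action $\triangleright$ of $G$ on $E$ by automorphisms such that $\partial(g\triangleright e)=g\,\partial(e)\,g^{-1}$; it is a crossed module if $efe^{-1}(\partial(e)\triangleright f^{-1})=1$ for all $e,f\in E$. Write $\mathfrak g,\mathfrak e$ for the Lie algebras of $G,E$, and $\partial\colon\mathfrak e\to\mathfrak g$ and $\triangleright\colon G\times\mathfrak e\to\mathfrak e$ for the induced maps. An $n$-path is a smooth map $\alpha\colon[0,1]^n\to M$ that, for some $\epsilon>0$, does not depend on $x_i$ for $x_i\in[0,\epsilon]$ and for $x_i\in[1-\epsilon,1]$ (each $i$), and that is constant on each of the faces $x_1=0$ and $x_1=1$. A rank-1 homotopy from a 1-path $\gamma$ to a 1-path $\gamma'$ is a 2-path $H$ with $H(t,0)=\gamma(t)$, $H(t,1)=\gamma'(t)$ and $\operatorname{rank}\mathcal D H\le1$ everywhere. Two 2-paths $\Gamma,\Gamma'$ are strong rank-2 homotopic if there is a 3-path $J(t,s,x)$ with $J(t,s,0)=\Gamma(t,s)$,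 $J(t,s,1)=\Gamma'(t,s)$, with $\operatorname{rank}\mathcal DJ\le2$ everywhere, and such that for $c=0$ and $c=1$ the map $(t,x)\mapsto J(t,c,x)$ is a rank-1 homotopy from $\Gamma(\cdot,c)$ to $\Gamma'(\cdot,c)$. They are laminated rank-2 homotopic if moreover $J$ can be chosen so that for Lebesgue-almost every $(s,x)\in(0,1)^2$ at least one of the following holds: (a) for $\zeta=s$ or for $\zeta=x$, $\operatorname{rank}\mathcal D_{(t,\zeta)}J(t,s,x)\le1$ for all $t\in[0,1]$; (b) there are non-zero constants $a,b$ with $a\,\partial_sJ(t,s,x)+b\,\partial_xJ(t,s,x)=0$ for all $t\in[0,1]$. Let $\omega$ be a smooth $\mathfrak g$-valued 1-form and $m$ a smooth $\mathfrak e$-valued 2-form on $M$ with $\partial(m)=\Omega$, where $\Omega(u,v)=d\omega(u,v)+[\omega(u),\omega(v)]$ is the curvature of $\omega$. For a smooth curve $\gamma\colon[0,1]\to M$ let $g^\omega_\gamma(a,\cdot)\colon[0,1]\to G$ be the solution of $\frac{\partial}{\partial t}g^\omega_\gamma(a,t)=g^\omega_\gamma(a,t)\,\omega(\dot\gamma(t))$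 with $g^\omega_\gamma(a,a)=1$. For a 2-path $\Gamma$, with $\gamma_s(t)=\Gamma(t,s)$, let $e_\Gamma^{(\omega,m)}(a,\cdot)\colon[0,1]\to E$ be the solution of $$\frac{d}{ds}e_\Gamma^{(\omega,m)}(a,s)=e_\Gamma^{(\omega,m)}(a,s)\int_0^1 g^\omega_{\gamma_s}(0,t)\triangleright m\Big(\frac{\partial}{\partial t}\gamma_s(t),\frac{\partial}{\partial s}\gamma_s(t)\Big)dt,\qquad e_\Gamma^{(\omega,m)}(a,a)=1.$$ Then, for every 2-path $\Gamma$, $e_\Gamma^{(\omega,m)}(0,\cdot)$ is well defined (the integrals converge, and the differential equations for $g^\omega_{\gamma_s}(0,\cdot)$ and $e_\Gamma^{(\omega,m)}(0,\cdot)$ have unique solutions on $[0,1]$), and: 1. if the 2-paths $\Gamma,\Gamma'$ are laminated rank-2 homotopic, then $e_\Gamma^{(\omega,m)}(0,1)=e_{\Gamma'}^{(\omega,m)}(0,1)$; 2. if $(\partial\colon E\to G,\triangleright)$ is a crossed module and the 2-paths $\Gamma,\Gamma'$ are strong rank-2 homotopic, then $e_\Gamma^{(\omega,m)}(0,1)=e_{\Gamma'}^{(\omega,m)}(0,1)$.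 -/

import Mathlib

open scoped Manifold ContDiff

namespace LieHolonomy

noncomputable section

/-! ### Lie pre-crossed modules -/

section PreCrossed

variable {VE : Type*} [NormedAddCommGroup VE] [NormedSpace ℝ VE]
  {HE : Type*} [TopologicalSpace HE] (IE : ModelWithCorners ℝ VE HE)
  (E : Type*) [TopologicalSpace E] [ChartedSpace HE E] [Group E]
  {VG : Type*} [NormedAddCommGroup VG] [NormedSpace ℝ VG]
  {HG : Type*} [TopologicalSpace HG] (IG : ModelWithCorners ℝ VG HG)
  (G : Type*) [TopologicalSpace G] [ChartedSpace HG G] [Group G]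

/-- A Lie pre-crossed module `(∂ : E → G, ▷)`: a smooth homomorphism `∂` and a smooth left action
of `G` on `E` by automorphisms with `∂ (g ▷ e) = g ∂(e) g⁻¹`. -/
structure LiePreCrossedModule where
  /-- the boundary map `∂` -/
  bd : E →* G
  contMDiff_bd : ContMDiff IE IG ∞ bd
  /-- the action `▷` -/
  act : G →* MulAut E
  contMDiff_act : ContMDiff (IG.prod IE) IE ∞ (fun p : G × E => act p.1 p.2)
  bd_act : ∀ (g : G) (e : E), bd (act g e) = g * bd e * g⁻¹

namespace LiePreCrossedModule

variable {IE E IG G} (X : LiePreCrossedModule IE E IG G)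

/-- The Peiffer commutator `⟨e, f⟩ = e f e⁻¹ (∂(e) ▷ f⁻¹)`. -/
def peiffer (e f : E) : E := e * f * e⁻¹ * X.act (X.bd e) f⁻¹

/-- A pre-crossed module is a crossed module if all its Peiffer commutators are trivial. -/
def IsCrossedModule : Prop := ∀ e f : E, X.peiffer e f = 1

/- In Mathlib the Lie algebra of a Lie group `G` is `GroupLieAlgebra IG G`, the tangent space of `G`
at `1`, which is by definition the model vector space `VG`.  Since `X.bd 1 = 1` and
`X.act g 1 = 1`, the differentials below are maps between tangent spaces at the identity. -/

/-- The differential `∂ : 𝔢 → 𝔤` of `∂ : E → G` at the identity. -/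
def bdLie : VE →L[ℝ] VG := mfderiv IE IG X.bd (1 : E)

/-- The action of `g : G` on `𝔢`: the differential at the identity of `e ↦ g ▷ e`. -/
def actLie (g : G) : VE →L[ℝ] VE := mfderiv IE IE (X.act g) (1 : E)

end LiePreCrossedModule

end PreCrossed

/-! ### Differential forms -/

section Forms

variable {VM : Type*} [NormedAddCommGroup VM] [NormedSpace ℝ VM]
  {HM : Type*} [TopologicalSpace HM] (IM : ModelWithCorners ℝ VM HM)
  (M : Type*) [TopologicalSpace M] [ChartedSpace HM M]
  (n : ℕ) (W : Type*) [NormedAddCommGroup W] [NormedSpace ℝ W]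

/-- (Not necessarily smooth) `W`-valued differential `n`-forms on `M`. -/
abbrev DiffForm : Type _ := ∀ x : M, (TangentSpace IM x) [⋀^Fin n]→L[ℝ] W

variable {IM M n W}

/-- The pull-back of `α` along the inverse of the chart at `x₀`, a form on (an open subset of) the
model vector space. -/
def DiffForm.inChart (α : DiffForm IM M n W) (x₀ : M) : VM → VM [⋀^Fin n]→L[ℝ] W := fun y =>
  (α ((extChartAt IM x₀).symm y)).compContinuousLinearMap
    (mfderiv 𝓘(ℝ, VM) IM (extChartAt IM x₀).symm y)

/-- A form is smooth if it is smooth in every chart. -/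
def DiffForm.IsSmooth (α : DiffForm IM M n W) : Prop :=
  ∀ x₀ : M, ContDiffOn ℝ ∞ (α.inChart x₀) (extChartAt IM x₀).target

/-- The exterior derivative, computed at each point `x` in the chart at `x`. -/
def DiffForm.d (α : DiffForm IM M n W) : DiffForm IM M (n + 1) W := fun x =>
  (extDeriv (α.inChart x) (extChartAt IM x x)).compContinuousLinearMap
    (mfderiv IM 𝓘(ℝ, VM) (extChartAt IM x) x)

variable {VG : Type*} [NormedAddCommGroup VG] [NormedSpace ℝ VG]
  {HG : Type*} [TopologicalSpace HG] (IG : ModelWithCorners ℝ VG HG)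
  (G : Type*) [TopologicalSpace G] [ChartedSpace HG G] [Group G]

/-- The Lie bracket of `𝔤`, on the underlying vector space `VG`. -/
def lieBracketOf (u v : GroupLieAlgebra IG G) : VG := (⁅u, v⁆ : GroupLieAlgebra IG G)

/-- The curvature `Ω(u, v) = dw(u, v) + [w(u), w(v)]` of a `𝔤`-valued `1`-form `w`. -/
def curvature (w : DiffForm IM M 1 VG) (x : M) (u v : TangentSpace IM x) : VG :=
  w.d x ![u, v] + lieBracketOf IG G (w x ![u]) (w x ![v])

end Forms

/-! ### Cubical paths and homotopies -/

section Paths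

/-- The unit cube `[0,1]ⁿ`. -/
def cube (n : ℕ) : Set (Fin n → ℝ) := Set.Icc 0 1

variable {VM : Type*} [NormedAddCommGroup VM] [NormedSpace ℝ VM]
  {HM : Type*} [TopologicalSpace HM] (IM : ModelWithCorners ℝ VM HM)
  {M : Type*} [TopologicalSpace M] [ChartedSpace HM M]

/- A map from `[0,1]ⁿ` to `M` is represented by a function on `ℝⁿ`, of which only the
restriction to the cube is ever used. -/

/-- An `n`-path in `M`: a smooth map on the cube with a product structure close to the boundary,
which is constant on each of the two faces where the first coordinate is `0` or `1`. -/
structure IsNPath {n : ℕ} [NeZero n] (α : (Fin n → ℝ) → M) : Prop where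
  smooth : ContMDiffOn 𝓘(ℝ, Fin n → ℝ) IM ∞ α (cube n)
  product : ∃ ε : ℝ, 0 < ε ∧ ∀ x ∈ cube n, ∀ i : Fin n,
    (x i ≤ ε → α x = α (Function.update x i 0)) ∧
    (1 - ε ≤ x i → α x = α (Function.update x i 1))
  source : ∀ x ∈ cube n, ∀ y ∈ cube n, x 0 = 0 → y 0 = 0 → α x = α y
  target : ∀ x ∈ cube n, ∀ y ∈ cube n, x 0 = 1 → y 0 = 1 → α x = α y

/-- The restriction of `α` to the face where coordinate `i` is `c`. -/
def face {n : ℕ} (i : Fin (n + 1)) (c : ℝ) (α : (Fin (n + 1) → ℝ) → M) : (Fin n → ℝ) → M :=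
  fun y => α (Fin.insertNth i c y)

/-- The rank of the derivative of `α : [0,1]ⁿ → M` at `v`. -/
def rankAt {n : ℕ} (α : (Fin n → ℝ) → M) (v : Fin n → ℝ) : ℕ :=
  Module.finrank ℝ
    (LinearMap.range (mfderivWithin 𝓘(ℝ, Fin n → ℝ) IM α (cube n) v).toLinearMap)

/-- The partial derivative of `α : [0,1]ⁿ → M` in the `i`-th coordinate. -/
def partialDeriv {n : ℕ} (i : Fin n) (α : (Fin n → ℝ) → M) (v : Fin n → ℝ) :
    TangentSpace IM (α v) :=
  mfderivWithin 𝓘(ℝ, Fin n → ℝ) IM α (cube n) v (Pi.single i (1 : ℝ) : Fin n → ℝ)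

/-- `H` is a rank-1 homotopy from the 1-path `γ` to the 1-path `γ'`. -/
structure IsRankOneHomotopy (H : (Fin 2 → ℝ) → M) (γ γ' : (Fin 1 → ℝ) → M) : Prop where
  isNPath : IsNPath IM H
  source : Set.EqOn (face 1 0 H) γ (cube 1)
  target : Set.EqOn (face 1 1 H) γ' (cube 1)
  rank_le : ∀ v ∈ cube 2, rankAt IM H v ≤ 1

/-- `J`, with coordinates `(t, s, x)`, is a strong rank-2 homotopy from `Γ` to `Γ'`. -/
structure IsStrongRankTwoHomotopy (J : (Fin 3 → ℝ) → M) (Γ Γ' : (Fin 2 → ℝ) → M) : Prop where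
  isNPath : IsNPath IM J
  source : Set.EqOn (face 2 0 J) Γ (cube 2)
  target : Set.EqOn (face 2 1 J) Γ' (cube 2)
  bottom : IsRankOneHomotopy IM (face 1 0 J) (face 1 0 Γ) (face 1 0 Γ')
  top : IsRankOneHomotopy IM (face 1 1 J) (face 1 1 Γ) (face 1 1 Γ')
  rank_le : ∀ v ∈ cube 3, rankAt IM J v ≤ 2

/-- Laminatedness at `(s, x)`: for `ζ = s` or for `ζ = x`, the derivative of `J` in the two
variables `(t, ζ)` has rank at most one, for all `t`. -/
def LaminatedAt (J : (Fin 3 → ℝ) → M) (s x : ℝ) : Prop :=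
  ∃ ζ : Fin 3, (ζ = 1 ∨ ζ = 2) ∧ ∀ t ∈ Set.Icc (0 : ℝ) 1,
    Module.finrank ℝ (Submodule.span ℝ
      {partialDeriv IM 0 J ![t, s, x], partialDeriv IM ζ J ![t, s, x]}) ≤ 1

/-- Path space thinness at `(s, x)`: `a ∂J/∂s + b ∂J/∂x = 0` for all `t`, for some non-zero
constants `a` and `b`. -/
def PathSpaceThinAt (J : (Fin 3 → ℝ) → M) (s x : ℝ) : Prop :=
  ∃ a b : ℝ, a ≠ 0 ∧ b ≠ 0 ∧ ∀ t ∈ Set.Icc (0 : ℝ) 1,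
    a • partialDeriv IM 1 J ![t, s, x] + b • partialDeriv IM 2 J ![t, s, x] = 0

/-- `J` is a laminated rank-2 homotopy from `Γ` to `Γ'`: a rank-2 homotopy which at (Lebesgue)
almost every `(s, x) ∈ (0,1)²` is laminated or path space thin. -/
structure IsLaminatedRankTwoHomotopy (J : (Fin 3 → ℝ) → M) (Γ Γ' : (Fin 2 → ℝ) → M) : Prop where
  isStrong : IsStrongRankTwoHomotopy IM J Γ Γ'
  laminated : ∀ᵐ p : ℝ × ℝ, p.1 ∈ Set.Ioo (0 : ℝ) 1 → p.2 ∈ Set.Ioo (0 : ℝ) 1 →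
    LaminatedAt IM J p.1 p.2 ∨ PathSpaceThinAt IM J p.1 p.2

/-- The strong rank-2 homotopy relation. -/
def StrongRankTwoHomotopic (Γ Γ' : (Fin 2 → ℝ) → M) : Prop :=
  ∃ J : (Fin 3 → ℝ) → M, IsStrongRankTwoHomotopy IM J Γ Γ'

/-- The laminated rank-2 homotopy relation. -/
def LaminatedRankTwoHomotopic (Γ Γ' : (Fin 2 → ℝ) → M) : Prop :=
  ∃ J : (Fin 3 → ℝ) → M, IsLaminatedRankTwoHomotopy IM J Γ Γ'

end Paths

/-! ### Holonomy -/

section LieODE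

variable {VG : Type*} [NormedAddCommGroup VG] [NormedSpace ℝ VG]
  {HG : Type*} [TopologicalSpace HG] (IG : ModelWithCorners ℝ VG HG)
  {G : Type*} [TopologicalSpace G] [ChartedSpace HG G] [Group G]

/-- `F` solves `F'(t) = F(t) A(t)` on `[0,1]` with `F(a) = 1`, for a curve `A` in the Lie algebra
of `G`.  Here `F(t) A(t)` is the value at `F(t)` of the left-invariant vector field of `A(t)`. -/
def SolvesLieODE (A : ℝ → VG) (a : ℝ) (F : ℝ → G) : Prop :=
  F a = 1 ∧ ∀ t ∈ Set.Icc (0 : ℝ) 1,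
    HasMFDerivWithinAt 𝓘(ℝ, ℝ) IG F (Set.Icc 0 1) t
      ((1 : ℝ →L[ℝ] ℝ).smulRight
        (mulInvariantVectorField (I := IG) (A t : GroupLieAlgebra IG G) (F t)))

/-- The value at `b` of the solution of `F'(t) = F(t) A(t)`, `F(a) = 1` on `[0,1]`. -/
def lieODE (A : ℝ → VG) (a b : ℝ) : G :=
  Classical.epsilon fun h : G => ∃ F : ℝ → G, SolvesLieODE IG A a F ∧ F b = h

/-- The equation `F'(t) = F(t) A(t)`, `F(a) = 1` has exactly one solution on `[0,1]`, and
`lieODE IG A a` is that solution. -/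
def LieODEWellPosed (G : Type*) [TopologicalSpace G] [ChartedSpace HG G] [Group G]
    (A : ℝ → VG) (a : ℝ) : Prop :=
  SolvesLieODE (G := G) IG A a (lieODE IG A a) ∧
    ∀ F : ℝ → G, SolvesLieODE IG A a F → Set.EqOn F (lieODE IG A a) (Set.Icc 0 1)

end LieODE

section Holonomy

variable {VM : Type*} [NormedAddCommGroup VM] [NormedSpace ℝ VM]
  {HM : Type*} [TopologicalSpace HM] {IM : ModelWithCorners ℝ VM HM}
  {M : Type*} [TopologicalSpace M] [ChartedSpace HM M]
  {VE : Type*} [NormedAddCommGroup VE] [NormedSpace ℝ VE]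
  {HE : Type*} [TopologicalSpace HE] {IE : ModelWithCorners ℝ VE HE}
  {E : Type*} [TopologicalSpace E] [ChartedSpace HE E] [Group E]
  {VG : Type*} [NormedAddCommGroup VG] [NormedSpace ℝ VG]
  {HG : Type*} [TopologicalSpace HG] {IG : ModelWithCorners ℝ VG HG}
  {G : Type*} [TopologicalSpace G] [ChartedSpace HG G] [Group G]

/-- The curve `t ↦ w(γ'(t))` in `𝔤`. -/
def oneIntegrand (w : DiffForm IM M 1 VG) (γ : ℝ → M) (t : ℝ) : VG :=
  w (γ t) ![(mfderivWithin 𝓘(ℝ, ℝ) IM γ (Set.Icc 0 1) t (1 : ℝ) : TangentSpace IM (γ t))]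

variable (IG) in
/-- The one-dimensional holonomy `g_γ^w(a, b) ∈ G` of a curve `γ : [0,1] → M`. -/
def oneHolonomy (w : DiffForm IM M 1 VG) (γ : ℝ → M) (a b : ℝ) : G :=
  lieODE IG (oneIntegrand w γ) a b

/-- The curve `γ_s(t) = Γ(t, s)`. -/
def slice (Γ : (Fin 2 → ℝ) → M) (s : ℝ) : ℝ → M := fun t => Γ ![t, s]

/-- The element `g_{γ_s}^w(0, t) ▷ m(∂γ_s(t)/∂t, ∂γ_s(t)/∂s)` of `𝔢`. -/
def twoIntegrand (X : LiePreCrossedModule IE E IG G) (w : DiffForm IM M 1 VG)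
    (m : DiffForm IM M 2 VE) (Γ : (Fin 2 → ℝ) → M) (s t : ℝ) : VE :=
  X.actLie (oneHolonomy IG w (slice Γ s) 0 t)
    (m (Γ ![t, s]) ![partialDeriv IM 0 Γ ![t, s], partialDeriv IM 1 Γ ![t, s]])

/-- The two-dimensional holonomy `e_Γ^{(w,m)}(a, b) ∈ E`: the value at `b` of the solution of
`e'(s) = e(s) ∫₀¹ g_{γ_s}^w(0, t) ▷ m(∂γ_s(t)/∂t, ∂γ_s(t)/∂s) dt` with `e(a) = 1`. -/
def twoHolonomy (X : LiePreCrossedModule IE E IG G) (w : DiffForm IM M 1 VG)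
    (m : DiffForm IM M 2 VE) (Γ : (Fin 2 → ℝ) → M) (a b : ℝ) : E :=
  lieODE IE (fun s => ∫ t in (0 : ℝ)..1, twoIntegrand X w m Γ s t) a b

/-- Everything that enters the definition of `e_Γ^{(w,m)}(0, ·)` exists: the differential
equations for `g_{γ_s}^w(0, ·)` and `e_Γ^{(w,m)}(0, ·)` have unique solutions on `[0,1]`, and the
integrals converge. -/
structure TwoHolonomyWellDefined (X : LiePreCrossedModule IE E IG G) (w : DiffForm IM M 1 VG)
    (m : DiffForm IM M 2 VE) (Γ : (Fin 2 → ℝ) → M) : Prop where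
  one : ∀ s ∈ Set.Icc (0 : ℝ) 1, LieODEWellPosed IG G (oneIntegrand w (slice Γ s)) 0
  integrable : ∀ s ∈ Set.Icc (0 : ℝ) 1,
    IntervalIntegrable (twoIntegrand X w m Γ s) MeasureTheory.volume 0 1
  two : LieODEWellPosed IE E (fun s => ∫ t in (0 : ℝ)..1, twoIntegrand X w m Γ s t) 0

end Holonomy

end

end LieHolonomy

/-!
Let `J` be a rank-2 homotopy with coordinates `(t, s, x)`. Since a cubical path has a product
structure near the boundary of the cube, `J` extends to a smooth map `K : ℝ³ → M` by projecting
each coordinate to `[0,1]` (`IsNPath.contMDiff_cubeExtend`). All the information about `w` and `m`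
that is needed is in the components `ηᵢ` and `μᵢⱼ` of their pull-backs along `K`
(`isFlatFamily_pull`): the curvature of `η` is `∂(μ)`, and the covariant exterior derivative
`dμ + η ∧ μ` vanishes on the cube. The latter is not a Bianchi identity, as `∂ : 𝔢 → 𝔤` need not be
injective; it holds because a `3`-form vanishes on the image of a linear map of rank at most two
(`covariant_closed`).

Let `P(t, s, x)` be the action on `𝔢` of the parallel transport along the segment from `(0, s, x)`
to `(t, s, x)`, and put `A = ∫₀¹ P μ₀₁ dt` and `B = ∫₀¹ P μ₀₂ dt`, as functions of `(s, x)`. The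
holonomy of the slice of `J` at `x` is the endpoint of the solution of `e' = e A(·, x)`. It does
not depend on `x` if `A ds + B dx` is a flat connection on the square, that is
`∂A/∂x - ∂B/∂s = [A, B]`, with `B = 0` for `s = 0` and for `s = 1` (`lieODE_endpoint_eq`).
The second condition holds because the two sides of a rank-2 homotopy are rank-1 homotopies.

For the first one, Duhamel's formula and the curvature identity give the derivatives of `P` in `s`
and `x` (`hasDerivAt_transport_param`). With closedness they yield
`∂A/∂x - ∂B/∂s = ∫₀¹ (∂(a) ▷ b' - ∂(b) ▷ a') dt` (`IsFlatFamily.integral_integrandDeriv`), where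
`a(t) = ∫₀ᵗ P μ₀₁` and `b(t) = ∫₀ᵗ P μ₀₂`.
* In a crossed module `∂(u) ▷ v = [u, v]`
  (`LiePreCrossedModule.IsCrossedModule.lieAct_conjModule`), so that the integrand is the
  derivative of `[a, b]` (`IsFlatFamily.integral_defect_of_isCrossedModule`).
* At a laminated or path space thin point `(s, x)`, the components `μ₀₁` and `μ₀₂` are proportional
  with a factor independent of `t` (`proportional_of_thin`), so that the integral and `[A, B]` both
  vanish (`IsFlatFamily.integral_defect_of_proportional`). As these points have full measure and
  both sides are continuous, the identity holds on the whole square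
  (`IsFlatFamily.eqOn_square_of_ae`).

Two points about differential equations in a Lie group are proved by hand. Solutions on `[0,1]`
come from the Picard–Lindelöf theorem in the chart at `1`, for small right-hand sides, and by
bisection in general (`exists_solvesLieODE`). The smooth dependence of solutions on a parameter is
not used: the solution at time `1` of `F' = F C`, `F(0) = 1`, for a small `C` is `∫ C` up to a
quadratic error (`exists_solvesLieODE_of_small`), and applied to `e(·, x) e(·, x₀)⁻¹` this suffices
to differentiate the endpoint at `x₀` (`hasVelocityWithinAt_lieODE_endpoint`).

Tangent spaces are throughout identified with the model vector space. The bracket of `𝔢` enters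
only as the infinitesimal action `lieAct` of the pre-crossed module `conjModule` of `E` acting on
itself by conjugation.
-/

namespace LieHolonomy

noncomputable section

open scoped Topology
open Set Filter

/-! ### Velocities and logarithmic derivatives of curves -/

section Param

variable {VN : Type*} [NormedAddCommGroup VN] [NormedSpace ℝ VN]
  {HN : Type*} [TopologicalSpace HN] {J : ModelWithCorners ℝ VN HN}
  {N : Type*} [TopologicalSpace N] [ChartedSpace HN N]
  {VM : Type*} [NormedAddCommGroup VM] [NormedSpace ℝ VM]
  {HM : Type*} [TopologicalSpace HM] {I : ModelWithCorners ℝ VM HM}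
  {M : Type*} [TopologicalSpace M] [ChartedSpace HM M]
  {W : Type*} [NormedAddCommGroup W] [NormedSpace ℝ W]
  {HW : Type*} [TopologicalSpace HW] {I' : ModelWithCorners ℝ W HW}
  {M' : Type*} [TopologicalSpace M'] [ChartedSpace HW M']

/-- The differential `mfderiv I I' f x`, as a linear map between the model spaces. -/
def tderiv (I : ModelWithCorners ℝ VM HM) (I' : ModelWithCorners ℝ W HW) (f : M → M') (x : M) :
    VM →L[ℝ] W :=
  mfderiv I I' f x

lemma tderiv_comp {g : M' → N} {f : M → M'} {x : M} (hg : MDifferentiableAt I' J g (f x))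
    (hf : MDifferentiableAt I I' f x) :
    tderiv I J (g ∘ f) x = (tderiv I' J g (f x)).comp (tderiv I I' f x) :=
  mfderiv_comp (I' := I') x hg hf

lemma tderiv_id (x : M) : tderiv I I id x = ContinuousLinearMap.id ℝ VM :=
  mfderiv_id

lemma tderiv_const (c : M') (x : M) : tderiv I I' (fun _ => c) x = 0 :=
  mfderiv_const

lemma tderiv_extChartAt_self [IsManifold I 1 M] (x : M) :
    tderiv I 𝓘(ℝ, VM) (extChartAt I x) x = ContinuousLinearMap.id ℝ VM :=
  mfderiv_extChartAt_self

lemma tderiv_extChartAt_comp_symm [I.Boundaryless] [IsManifold I 1 M] {x : M} {y : VM}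
    (hy : y ∈ (extChartAt I x).target) :
    (tderiv I 𝓘(ℝ, VM) (extChartAt I x) ((extChartAt I x).symm y)).comp
      (tderiv 𝓘(ℝ, VM) I (extChartAt I x).symm y) = ContinuousLinearMap.id ℝ VM := by
  have h := mfderiv_extChartAt_comp_mfderivWithin_extChartAt_symm hy
  rwa [I.range_eq_univ, mfderivWithin_univ] at h

lemma tderiv_symm_comp_extChartAt [I.Boundaryless] [IsManifold I 1 M] {x : M} {y : VM}
    (hy : y ∈ (extChartAt I x).target) :
    (tderiv 𝓘(ℝ, VM) I (extChartAt I x).symm y).comp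
      (tderiv I 𝓘(ℝ, VM) (extChartAt I x) ((extChartAt I x).symm y)) =
        ContinuousLinearMap.id ℝ VM := by
  have h := mfderivWithin_extChartAt_symm_comp_mfderiv_extChartAt hy
  rwa [I.range_eq_univ, mfderivWithin_univ] at h

lemma tderiv_eq_fderiv {V V' : Type*} [NormedAddCommGroup V] [NormedSpace ℝ V]
    [NormedAddCommGroup V'] [NormedSpace ℝ V'] (f : V → V') (x : V) :
    tderiv 𝓘(ℝ, V) 𝓘(ℝ, V') f x = fderiv ℝ f x :=
  mfderiv_eq_fderiv

/-- The differential of `f n` at a fixed point `x₀` depends smoothly on the parameter `n`. This is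
`ContMDiffAt.mfderiv`, where no change of coordinates is needed because the base point is fixed and
the values are in a vector space. -/
lemma contMDiffAt_tderiv_param {W : Type*} [NormedAddCommGroup W] [NormedSpace ℝ W]
    [IsManifold J ∞ N] [IsManifold I ∞ M] {f : N → M → W} {n₀ : N} {x₀ : M}
    (hf : ContMDiffAt (J.prod I) 𝓘(ℝ, W) ∞ (Function.uncurry f) (n₀, x₀)) :
    ContMDiffAt J 𝓘(ℝ, VM →L[ℝ] W) ∞ (fun n => tderiv I 𝓘(ℝ, W) (f n) x₀) n₀ := by
  have : IsManifold I 1 M := IsManifold.of_le (n := ∞) (by simp)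
  have h := ContMDiffAt.mfderiv (m := ∞) (n := ∞) (x₀ := n₀) f (fun _ => x₀) hf contMDiffAt_const
    (by simp)
  refine h.congr_of_eventuallyEq (Eventually.of_forall fun n => ?_)
  have h1 := inTangentCoordinates_eq_mfderiv_comp (I := I) (I' := 𝓘(ℝ, W)) (f := fun _ : N => x₀)
    (g := fun x => f x x₀) (ϕ := fun x => mfderiv I 𝓘(ℝ, W) (f x) x₀) (x₀ := n₀) (x := n)
    (mem_chart_source _ _) (by rw [chartAt_self_eq]; exact mem_univ _)
  refine Eq.trans ?_ h1.symm
  have h2 : tderiv 𝓘(ℝ, W) 𝓘(ℝ, W) (extChartAt 𝓘(ℝ, W) (f n₀ x₀)) (f n x₀) =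
      ContinuousLinearMap.id ℝ W := by
    rw [extChartAt_model_space_eq_id]; exact tderiv_id _
  have h3 : (mfderivWithin 𝓘(ℝ, VM) I (extChartAt I x₀).symm (range I) (extChartAt I x₀ x₀) :
      VM →L[ℝ] VM) = ContinuousLinearMap.id ℝ VM := mfderivWithin_range_extChartAt_symm
  have h4 : tderiv I 𝓘(ℝ, W) (f n) x₀ =
    (tderiv 𝓘(ℝ, W) 𝓘(ℝ, W) (extChartAt 𝓘(ℝ, W) (f n₀ x₀)) (f n x₀)).comp
      ((tderiv I 𝓘(ℝ, W) (f n) x₀).comp (mfderivWithin 𝓘(ℝ, VM) I (extChartAt I x₀).symm (range I)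
        (extChartAt I x₀ x₀) : VM →L[ℝ] VM)) := by
    rw [h2, h3]; rfl
  exact h4

/-- The curve `F : ℝ → M` has velocity `v` at `t` within `S`, where `v` is read in the model
space. -/
def HasVelocityWithinAt (I : ModelWithCorners ℝ VM HM) (F : ℝ → M) (v : VM) (S : Set ℝ) (t : ℝ) :
    Prop :=
  HasMFDerivWithinAt 𝓘(ℝ, ℝ) I F S t (ContinuousLinearMap.toSpanSingleton ℝ v : ℝ →L[ℝ] VM)

lemma hasVelocityWithinAt_iff_hasDerivWithinAt {W : Type*} [NormedAddCommGroup W] [NormedSpace ℝ W]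
    {F : ℝ → W} {v : W} {S : Set ℝ} {t : ℝ} :
    HasVelocityWithinAt 𝓘(ℝ, W) F v S t ↔ HasDerivWithinAt F v S t :=
  hasMFDerivWithinAt_iff_hasFDerivWithinAt

lemma tderiv_prod_apply {f : M × M' → N} {p : M × M'} (hf : MDifferentiableAt (I.prod I') J f p)
    (v : VM) (w : W) :
    tderiv (I.prod I') J f p (v, w) =
      tderiv I J (fun z => f (z, p.2)) p.1 v + tderiv I' J (fun z => f (p.1, z)) p.2 w :=
  mfderiv_prod_eq_add_apply hf

section Velocity

variable {F : ℝ → M} {v : VM} {S : Set ℝ} {t : ℝ}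

lemma HasVelocityWithinAt.comp (h : HasVelocityWithinAt I F v S t) {ψ : M → M'}
    (hψ : MDifferentiableAt I I' ψ (F t)) :
    HasVelocityWithinAt I' (ψ ∘ F) (tderiv I I' ψ (F t) v) S t := by
  have h1 := hψ.hasMFDerivAt.comp_hasMFDerivWithinAt t h
  have h2 : (tderiv I I' ψ (F t)).comp (ContinuousLinearMap.toSpanSingleton ℝ v) =
    ContinuousLinearMap.toSpanSingleton ℝ (tderiv I I' ψ (F t) v) := by ext; simp
  unfold HasVelocityWithinAt
  rw [← h2]
  exact h1

lemma HasVelocityWithinAt.continuousWithinAt (h : HasVelocityWithinAt I F v S t) :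
    ContinuousWithinAt F S t :=
  HasMFDerivWithinAt.continuousWithinAt h

lemma HasVelocityWithinAt.mono (h : HasVelocityWithinAt I F v S t) {T : Set ℝ} (hT : T ⊆ S) :
    HasVelocityWithinAt I F v T t :=
  HasMFDerivWithinAt.mono h hT

lemma HasVelocityWithinAt.congr_of_eventuallyEq (h : HasVelocityWithinAt I F v S t) {F' : ℝ → M}
    (hF : F' =ᶠ[𝓝[S] t] F) (ht : F' t = F t) : HasVelocityWithinAt I F' v S t :=
  HasMFDerivWithinAt.congr_of_eventuallyEq h hF ht

lemma HasVelocityWithinAt.prodMk (h : HasVelocityWithinAt I F v S t) {F' : ℝ → M'} {v' : W}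
    (h' : HasVelocityWithinAt I' F' v' S t) :
    HasVelocityWithinAt (I.prod I') (fun u => (F u, F' u)) (v, v') S t := by
  have h1 := HasMFDerivWithinAt.prodMk h h'
  have h2 : (ContinuousLinearMap.toSpanSingleton ℝ v).prod
    (ContinuousLinearMap.toSpanSingleton ℝ v') =
      ContinuousLinearMap.toSpanSingleton ℝ (v, v') := by ext <;> simp
  unfold HasVelocityWithinAt
  rw [← h2]
  exact h1

lemma HasVelocityWithinAt.congr (h : HasVelocityWithinAt I F v S t) {F' : ℝ → M}
    (hF : ∀ u ∈ S, F' u = F u) (ht : F' t = F t) : HasVelocityWithinAt I F' v S t := by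
  exact HasMFDerivWithinAt.congr_of_eventuallyEq h (eventually_of_mem self_mem_nhdsWithin hF) ht

lemma HasVelocityWithinAt.union (h : HasVelocityWithinAt I F v S t) {T : Set ℝ}
    (h' : HasVelocityWithinAt I F v T t) : HasVelocityWithinAt I F v (S ∪ T) t :=
  HasMFDerivWithinAt.union h h'

lemma HasVelocityWithinAt.comp_affine {a b : ℝ} (h : HasVelocityWithinAt I F v S (a * t + b))
    {T : Set ℝ} (hT : MapsTo (fun t => a * t + b) T S) :
    HasVelocityWithinAt I (fun t => F (a * t + b)) (a • v) T t := by
  have h0 : HasDerivWithinAt (fun t : ℝ => a * t + b) a T t := by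
    simpa using (((hasDerivAt_id t).const_mul a).add_const b).hasDerivWithinAt
  have h0 := hasVelocityWithinAt_iff_hasDerivWithinAt.2 h0
  have h1 := HasMFDerivWithinAt.comp (g := F) (f := fun t : ℝ => a * t + b) t h h0 hT
  have h2 : (ContinuousLinearMap.toSpanSingleton ℝ v).comp (ContinuousLinearMap.toSpanSingleton ℝ a)
    = ContinuousLinearMap.toSpanSingleton ℝ (a • v) := by ext; simp
  unfold HasVelocityWithinAt
  rw [← h2]
  exact h1

end Velocity

end Param

section Group

variable {VG : Type*} [NormedAddCommGroup VG] [NormedSpace ℝ VG]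
  {HG : Type*} [TopologicalSpace HG] {I : ModelWithCorners ℝ VG HG}
  {G : Type*} [TopologicalSpace G] [ChartedSpace HG G] [Group G] [LieGroup I ∞ G]
  {W : Type*} [NormedAddCommGroup W] [NormedSpace ℝ W]

/-- `F` has left logarithmic derivative `A` at `t`, i.e. `F' = F A`. -/
def HasLogDerivWithinAt (I : ModelWithCorners ℝ VG HG) {G : Type*} [TopologicalSpace G]
    [ChartedSpace HG G] [Group G] (F : ℝ → G) (A : VG) (S : Set ℝ) (t : ℝ) : Prop :=
  HasVelocityWithinAt I F (tderiv I I (F t * ·) 1 A) S t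

omit [LieGroup I ∞ G] in
/-- The equation of `SolvesLieODE` in terms of logarithmic derivatives: the value at `g` of the
left-invariant vector field of `v` is, by definition, the differential of `k ↦ g k` applied to
`v`. -/
lemma solvesLieODE_iff {A : ℝ → VG} {a : ℝ} {F : ℝ → G} :
    SolvesLieODE I A a F ↔
      F a = 1 ∧ ∀ t ∈ Icc (0 : ℝ) 1, HasLogDerivWithinAt I F (A t) (Icc 0 1) t := by
  have h (t : ℝ) : (1 : ℝ →L[ℝ] ℝ).smulRight (tderiv I I (F t * ·) 1 (A t)) =
    ContinuousLinearMap.toSpanSingleton ℝ (tderiv I I (F t * ·) 1 (A t)) := by ext; simp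
  unfold HasLogDerivWithinAt HasVelocityWithinAt
  simp_rw [← h]
  rfl

lemma mdifferentiableAt_mul_left (g h : G) : MDifferentiableAt I I (g * ·) h :=
  (contMDiff_mul_left (I := I) (n := ∞) (a := g)).contMDiffAt.mdifferentiableAt (by simp)

variable {F : ℝ → G} {A : VG} {S : Set ℝ} {t : ℝ}

lemma HasLogDerivWithinAt.comp (h : HasLogDerivWithinAt I F A S t) {ψ : G → W}
    (hψ : MDifferentiableAt I 𝓘(ℝ, W) ψ (F t)) :
    HasDerivWithinAt (ψ ∘ F) (tderiv I 𝓘(ℝ, W) (fun k => ψ (F t * k)) 1 A) S t := by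
  have h1 := hasVelocityWithinAt_iff_hasDerivWithinAt.1 (HasVelocityWithinAt.comp h hψ)
  have h2 := tderiv_comp (I := I) (I' := I) (J := 𝓘(ℝ, W)) (x := (1 : G)) (g := ψ)
    (f := (F t * ·)) (by rwa [mul_one]) (mdifferentiableAt_mul_left _ _)
  rw [mul_one] at h2
  change HasDerivWithinAt _ (tderiv I 𝓘(ℝ, W) (ψ ∘ (F t * ·)) 1 A) S t
  rwa [h2]

lemma HasLogDerivWithinAt.const_mul (h : HasLogDerivWithinAt I F A S t) (g : G) :
    HasLogDerivWithinAt I (fun u => g * F u) A S t := by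
  have h1 := HasVelocityWithinAt.comp h (mdifferentiableAt_mul_left (I := I) g (F t))
  have h2 := tderiv_comp (I := I) (I' := I) (J := I) (x := (1 : G)) (g := (g * ·))
    (f := (F t * ·)) (mdifferentiableAt_mul_left _ _) (mdifferentiableAt_mul_left _ _)
  rw [mul_one] at h2
  unfold HasLogDerivWithinAt
  have h3 : (g * F t * ·) = (g * ·) ∘ (F t * ·) := by ext; simp [mul_assoc]
  rw [h3, h2]
  exact h1

omit [LieGroup I ∞ G] in
lemma hasLogDerivWithinAt_iff_velocity_of_eq_one (h : F t = 1) :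
    HasLogDerivWithinAt I F A S t ↔ HasVelocityWithinAt I F A S t := by
  have h1 : tderiv I I (F t * ·) 1 = ContinuousLinearMap.id ℝ VG := by
    simp only [h, one_mul]; exact tderiv_id _
  unfold HasLogDerivWithinAt
  rw [h1]
  rfl

lemma HasLogDerivWithinAt.velocity_inv_mul (h : HasLogDerivWithinAt I F A S t) :
    HasVelocityWithinAt I (fun u => (F t)⁻¹ * F u) A S t :=
  (hasLogDerivWithinAt_iff_velocity_of_eq_one (by simp)).1 (h.const_mul _)

lemma hasLogDerivWithinAt_of_velocity (h : HasVelocityWithinAt I (fun u => (F t)⁻¹ * F u) A S t) :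
    HasLogDerivWithinAt I F A S t := by
  simpa using ((hasLogDerivWithinAt_iff_velocity_of_eq_one (by simp)).2 h).const_mul (F t)

variable (I G) in
/-- The pre-crossed module `(id : G → G, conjugation)`. Its action on the Lie algebra is the adjoint
representation. -/
def conjModule : LiePreCrossedModule I G I G where
  bd := MonoidHom.id G
  contMDiff_bd := contMDiff_id
  act := MulAut.conj
  contMDiff_act := by
    have h1 : ContMDiff (I.prod I) I ∞ (fun p : G × G => p.1 * p.2 * p.1⁻¹) :=
      (contMDiff_fst.mul contMDiff_snd).mul contMDiff_fst.inv
    exact h1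
  bd_act := fun _ _ => rfl

lemma conjModule_actLie (g : G) :
    (conjModule I G).actLie g = tderiv I I (fun k => g * k * g⁻¹) 1 := rfl

/-- The logarithmic derivative of a quotient. `F₁ F₂⁻¹` is a constant translate of a conjugate of
`(F₁(t)⁻¹ F₁)(F₂(t)⁻¹ F₂)⁻¹`; both factors pass through `1` at time `t`, where the multiplication
map has derivative `(a, b) ↦ a - b`. -/
lemma HasLogDerivWithinAt.div {F₁ F₂ : ℝ → G} {A₁ A₂ : VG} {S : Set ℝ} {t : ℝ}
    (h₁ : HasLogDerivWithinAt I F₁ A₁ S t) (h₂ : HasLogDerivWithinAt I F₂ A₂ S t) :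
    HasLogDerivWithinAt I (fun u => F₁ u * (F₂ u)⁻¹) ((conjModule I G).actLie (F₂ t) (A₁ - A₂))
      S t := by
  apply hasLogDerivWithinAt_of_velocity
  set h := F₂ t with hh
  let Ψ : G × G → G := fun p => h * p.1 * p.2⁻¹ * h⁻¹
  have hΨ : ContMDiff (I.prod I) I ∞ Ψ :=
    ((contMDiff_const.mul contMDiff_fst).mul contMDiff_snd.inv).mul contMDiff_const
  have hd : MDifferentiable (I.prod I) I Ψ := hΨ.mdifferentiable (by simp)
  have hv := (h₁.velocity_inv_mul.prodMk h₂.velocity_inv_mul).comp (hd _)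
  have e1 : Ψ ∘ (fun u => ((F₁ t)⁻¹ * F₁ u, h⁻¹ * F₂ u)) =
      (fun u => (F₁ t * h⁻¹)⁻¹ * (F₁ u * (F₂ u)⁻¹)) := by
    ext u; simp [Ψ, mul_assoc]
  rw [e1] at hv
  have e2 (a b : VG) : tderiv (I.prod I) I Ψ (1, 1) (a, b) =
    tderiv I I (fun k => h * k * h⁻¹) 1 a + tderiv I I (fun k => h * 1 * k⁻¹ * h⁻¹) 1 b := by
    rw [tderiv_prod_apply (hd _)]
    simp [Ψ]
  have e3 (a : VG) : tderiv (I.prod I) I Ψ (1, 1) (a, a) = 0 := by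
    have hdiag : MDifferentiableAt I (I.prod I) (fun k : G => (k, k)) 1 :=
      mdifferentiableAt_id.prodMk mdifferentiableAt_id
    have h4 := tderiv_comp (I := I) (I' := I.prod I) (J := I) (x := (1 : G)) (g := Ψ)
      (f := fun k => (k, k)) (hd _) hdiag
    have h5 : Ψ ∘ (fun k : G => (k, k)) = fun _ => 1 := by ext; simp [Ψ]
    have h6 : tderiv I (I.prod I) (fun k : G => (k, k)) 1 =
        (ContinuousLinearMap.id ℝ VG).prod (ContinuousLinearMap.id ℝ VG) :=
      (mfderiv_prodMk mdifferentiableAt_id mdifferentiableAt_id).trans (by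
        exact congrArg₂ ContinuousLinearMap.prod (tderiv_id (I := I) (1 : G))
          (tderiv_id (I := I) (1 : G)))
    rw [h5, tderiv_const, h6] at h4
    simpa using (congrArg (fun L => L a) h4).symm
  convert hv using 1
  simp only [inv_mul_cancel, h]
  rw [e2, conjModule_actLie, map_sub, sub_eq_add_neg]
  congr 1
  have e4 := e3 A₂
  rw [e2] at e4
  exact (eq_neg_of_add_eq_zero_right e4).symm

end Group

/-! ### The group law in the chart at the identity -/

section Chart

variable {VG : Type*} [NormedAddCommGroup VG] [NormedSpace ℝ VG]
  {HG : Type*} [TopologicalSpace HG] {I : ModelWithCorners ℝ VG HG}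
  {G : Type*} [TopologicalSpace G] [ChartedSpace HG G] [Group G]

variable (I G) in
/-- The left-invariant vector field of `v`, read in the chart at `1`, as a function of the point `y`
of the chart and (linearly) of `v`. -/
def chartField (y : VG) : VG →L[ℝ] VG :=
  tderiv I 𝓘(ℝ, VG) (fun k => extChartAt I (1 : G) ((extChartAt I (1 : G)).symm y * k)) 1

variable [LieGroup I ∞ G] [I.Boundaryless]

omit [Group G] [LieGroup I ∞ G] in
lemma contMDiffAt_extChartAt_symm_of_mem [IsManifold I ∞ G] {g : G} {y : VG}
    (hy : y ∈ (extChartAt I g).target) :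
    ContMDiffAt 𝓘(ℝ, VG) I ∞ (extChartAt I g).symm y :=
  (contMDiffOn_extChartAt_symm g).contMDiffAt ((isOpen_extChartAt_target g).mem_nhds hy)

omit [I.Boundaryless] [Group G] [LieGroup I ∞ G] in
lemma contMDiffAt_extChartAt_of_mem [IsManifold I ∞ G] {g h : G}
    (hh : h ∈ (extChartAt I g).source) :
    ContMDiffAt I 𝓘(ℝ, VG) ∞ (extChartAt I g) h :=
  contMDiffAt_extChartAt' (by rwa [extChartAt_source] at hh)

lemma contDiffAt_chartField {y : VG} (hy : y ∈ (extChartAt I (1 : G)).target) :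
    ContDiffAt ℝ ∞ (chartField I G) y := by
  rw [← contMDiffAt_iff_contDiffAt]
  refine contMDiffAt_tderiv_param (I := I)
    (f := fun y k => extChartAt I (1 : G) ((extChartAt I (1 : G)).symm y * k)) ?_
  have h1 : ContMDiffAt (𝓘(ℝ, VG).prod I) I ∞
      (fun p : VG × G => (extChartAt I (1 : G)).symm p.1 * p.2) (y, 1) :=
    ((contMDiffAt_extChartAt_symm_of_mem hy).comp (y, (1 : G)) contMDiffAt_fst).mul contMDiffAt_snd
  refine (contMDiffAt_extChartAt_of_mem ?_).comp (y, (1 : G)) h1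
  simpa using (extChartAt I (1 : G)).map_target hy

omit [I.Boundaryless] in
lemma chartField_eq_comp {y : VG} (hy : y ∈ (extChartAt I (1 : G)).target) :
    chartField I G y =
      (tderiv I 𝓘(ℝ, VG) (extChartAt I (1 : G)) ((extChartAt I (1 : G)).symm y)).comp
        (tderiv I I ((extChartAt I (1 : G)).symm y * ·) 1) := by
  have h1 := tderiv_comp (I := I) (I' := I) (J := 𝓘(ℝ, VG)) (x := (1 : G))
    (g := extChartAt I (1 : G)) (f := ((extChartAt I (1 : G)).symm y * ·))
    ((contMDiffAt_extChartAt_of_mem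
      (by simpa using (extChartAt I (1 : G)).map_target hy)).mdifferentiableAt (by simp))
    (mdifferentiableAt_mul_left _ _)
  rw [mul_one] at h1
  exact h1

lemma tderiv_symm_chartField {y : VG} (hy : y ∈ (extChartAt I (1 : G)).target) (v : VG) :
    tderiv 𝓘(ℝ, VG) I (extChartAt I (1 : G)).symm y (chartField I G y v) =
      tderiv I I ((extChartAt I (1 : G)).symm y * ·) 1 v := by
  have : IsManifold I 1 G := IsManifold.of_le (n := ∞) (by simp)
  rw [chartField_eq_comp hy]
  exact congrArg (fun L => L (tderiv I I ((extChartAt I (1 : G)).symm y * ·) 1 v))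
    (tderiv_symm_comp_extChartAt (I := I) hy)

omit [I.Boundaryless] in
lemma chartField_one : chartField I G (extChartAt I (1 : G) 1) = ContinuousLinearMap.id ℝ VG := by
  have : IsManifold I 1 G := IsManifold.of_le (n := ∞) (by simp)
  simp only [chartField, extChartAt_to_inv, one_mul]
  exact tderiv_extChartAt_self (1 : G)

/-- The Lie bracket of `𝔤`, computed in the chart at `1` from the invariant vector fields. -/
lemma lieBracketOf_eq_fderiv_chartField (u v : VG) :
    lieBracketOf I G u v =
      fderiv ℝ (fun y => chartField I G y v) (extChartAt I (1 : G) 1) u -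
      fderiv ℝ (fun y => chartField I G y u) (extChartAt I (1 : G) 1) v := by
  have : IsManifold I 1 G := IsManifold.of_le (n := ∞) (by simp)
  set φ := extChartAt I (1 : G) with hφ
  let ξ (w : VG) : VG → VG := VectorField.mpullbackWithin 𝓘(ℝ, VG) I φ.symm
      (mulInvariantVectorField (w : GroupLieAlgebra I G)) (range I)
  have key (w : VG) : ξ w =ᶠ[𝓝 (φ 1)]
        (fun y => chartField I G y w) := by
    filter_upwards [extChartAt_target_mem_nhds (I := I) (1 : G)] with y hy
    have h1 := ContinuousLinearMap.inverse_eq (f := tderiv 𝓘(ℝ, VG) I φ.symm y)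
      (tderiv_symm_comp_extChartAt (I := I) hy) (tderiv_extChartAt_comp_symm (I := I) hy)
    rw [chartField_eq_comp hy]
    show ((mfderivWithin 𝓘(ℝ, VG) I φ.symm (range I) y).inverse) (tderiv I I (φ.symm y * ·) 1 w) = _
    rw [I.range_eq_univ, mfderivWithin_univ]
    exact congrArg (fun L : VG →L[ℝ] VG => L (tderiv I I (φ.symm y * ·) 1 w)) h1
  have h0 (w : VG) : chartField I G (φ 1) w = w := by rw [hφ, chartField_one]; rfl
  have h2 : lieBracketOf I G u v = (tderiv I 𝓘(ℝ, VG) φ 1).inverse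
    (VectorField.lieBracketWithin ℝ (ξ u) (ξ v) (φ.symm ⁻¹' univ ∩ range I) (φ 1)) := rfl
  clear_value ξ
  rw [h2, hφ, tderiv_extChartAt_self, ContinuousLinearMap.inverse_id, ← hφ, I.range_eq_univ,
    preimage_univ, univ_inter, VectorField.lieBracketWithin_univ,
    (key u).lieBracket_vectorField_eq (key v)]
  simp [VectorField.lieBracket, h0]

end Chart

/-! ### Infinitesimal pre-crossed modules -/

/-- A second derivative vanishes on the diagonal in the directions of lines on which the map is
affine. -/
lemma fderiv_fderiv_apply_self_eq_zero_of_affine {V W : Type*} [NormedAddCommGroup V]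
    [NormedSpace ℝ V] [NormedAddCommGroup W] [NormedSpace ℝ W] {f : V → W} {p a : V} {c w : W}
    (hf : ContDiffAt ℝ 2 f p) (h : ∀ᶠ τ : ℝ in 𝓝 0, f (p + τ • a) = c + τ • w) :
    fderiv ℝ (fderiv ℝ f) p a a = 0 := by
  have hline (τ : ℝ) : HasDerivAt (fun τ : ℝ => p + τ • a) a τ := by
    simpa using ((hasDerivAt_id τ).smul_const a).const_add p
  have hcont : Tendsto (fun τ : ℝ => p + τ • a) (𝓝 0) (𝓝 p) := by
    simpa using (hline 0).continuousAt.tendsto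
  have h1 : ∀ᶠ τ : ℝ in 𝓝 0, fderiv ℝ f (p + τ • a) a = w := by
    have hd : ∀ᶠ q in 𝓝 p, DifferentiableAt ℝ f q :=
      (hf.eventually (by simp)).mono fun q hq => hq.differentiableAt (by simp)
    filter_upwards [h.eventually_nhds, hcont.eventually hd] with τ hτ hdτ
    have h2 : HasDerivAt (fun τ : ℝ => f (p + τ • a)) (fderiv ℝ f (p + τ • a) a) τ :=
      hdτ.hasFDerivAt.comp_hasDerivAt τ (hline τ)
    have h3 : HasDerivAt (fun τ : ℝ => c + τ • w) w τ := by
      simpa using ((hasDerivAt_id τ).smul_const w).const_add c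
    exact h2.unique (h3.congr_of_eventuallyEq hτ)
  have h4 : DifferentiableAt ℝ (fderiv ℝ f) (p + (0 : ℝ) • a) := by
    simpa using (hf.fderiv_right (m := 1) (by norm_num)).differentiableAt (by simp)
  have h5 : HasDerivAt (fun τ : ℝ => fderiv ℝ f (p + τ • a) a)
      (fderiv ℝ (fderiv ℝ f) (p + (0 : ℝ) • a) a a) 0 :=
    (ContinuousLinearMap.apply ℝ W a).hasFDerivAt.comp_hasDerivAt (0 : ℝ)
      (HasFDerivAt.comp_hasDerivAt (0 : ℝ) h4.hasFDerivAt (hline 0))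
  have h6 := h5.unique ((hasDerivAt_const (0 : ℝ) w).congr_of_eventuallyEq h1)
  simpa using h6

section Module

variable {VE : Type*} [NormedAddCommGroup VE] [NormedSpace ℝ VE]
  {HE : Type*} [TopologicalSpace HE] {IE : ModelWithCorners ℝ VE HE}
  {E : Type*} [TopologicalSpace E] [ChartedSpace HE E] [Group E] [LieGroup IE ∞ E]
  {VG : Type*} [NormedAddCommGroup VG] [NormedSpace ℝ VG]
  {HG : Type*} [TopologicalSpace HG] {IG : ModelWithCorners ℝ VG HG}
  {G : Type*} [TopologicalSpace G] [ChartedSpace HG G] [Group G] [LieGroup IG ∞ G]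
  (X : LiePreCrossedModule IE E IG G)

namespace LiePreCrossedModule

omit [LieGroup IE ∞ E] [LieGroup IG ∞ G] in
lemma actLie_eq (g : G) : X.actLie g = tderiv IE IE (X.act g) 1 := rfl

omit [LieGroup IE ∞ E] [LieGroup IG ∞ G] in
lemma contMDiff_act_apply (g : G) : ContMDiff IE IE ∞ (X.act g) :=
  X.contMDiff_act.comp (contMDiff_const.prodMk contMDiff_id)

omit [LieGroup IE ∞ E] [LieGroup IG ∞ G] in
lemma mdifferentiable_act_apply (g : G) : MDifferentiable IE IE (X.act g) :=
  (X.contMDiff_act_apply g).mdifferentiable (by simp)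

omit [LieGroup IE ∞ E] [LieGroup IG ∞ G] in
lemma actLie_one : X.actLie 1 = 1 := by
  rw [actLie_eq, map_one]
  exact tderiv_id _

omit [LieGroup IE ∞ E] [LieGroup IG ∞ G] in
lemma actLie_mul (g h : G) : X.actLie (g * h) = X.actLie g * X.actLie h := by
  have h1 := tderiv_comp (I := IE) (I' := IE) (J := IE) (x := (1 : E)) (g := X.act g)
    (f := X.act h) (X.mdifferentiable_act_apply _ _) (X.mdifferentiable_act_apply _ _)
  rw [map_one] at h1
  rw [actLie_eq, map_mul]
  exact h1

omit [LieGroup IE ∞ E] [LieGroup IG ∞ G] in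
lemma actLie_mul_inv (g : G) : X.actLie g * X.actLie g⁻¹ = 1 := by
  rw [← actLie_mul, mul_inv_cancel, actLie_one]

omit [LieGroup IE ∞ E] [LieGroup IG ∞ G] in
lemma actLie_inv_mul (g : G) : X.actLie g⁻¹ * X.actLie g = 1 := by
  rw [← actLie_mul, inv_mul_cancel, actLie_one]

lemma contMDiff_actLie : ContMDiff IG 𝓘(ℝ, VE →L[ℝ] VE) ∞ X.actLie := by
  intro g
  have : IsManifold IE 1 E := IsManifold.of_le (n := ∞) (by simp)
  have h1 : ContMDiffAt (IG.prod IE) 𝓘(ℝ, VE) ∞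
      (Function.uncurry fun (g : G) (e : E) => extChartAt IE (1 : E) (X.act g e)) (g, 1) := by
    refine ContMDiffAt.comp (g := extChartAt IE (1 : E)) (f := fun p : G × E => X.act p.1 p.2)
      (g, (1 : E)) (I' := IE) ?_ X.contMDiff_act.contMDiffAt
    exact contMDiffAt_extChartAt_of_mem (by simp)
  have h2 := contMDiffAt_tderiv_param h1
  refine h2.congr_of_eventuallyEq (Eventually.of_forall fun k => ?_)
  have h3 := tderiv_comp (I := IE) (I' := IE) (J := 𝓘(ℝ, VE)) (x := (1 : E))
    (g := extChartAt IE (1 : E)) (f := X.act k)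
    ((contMDiffAt_extChartAt_of_mem (by simp)).mdifferentiableAt (by simp))
    (X.mdifferentiable_act_apply _ _)
  rw [map_one, tderiv_extChartAt_self] at h3
  exact h3.symm

/-- The infinitesimal action `𝔤 → End 𝔢`. -/
def lieAct : VG →L[ℝ] VE →L[ℝ] VE := tderiv IG 𝓘(ℝ, VE →L[ℝ] VE) X.actLie 1

lemma tderiv_actLie_mul_left (g : G) (v : VG) :
    tderiv IG 𝓘(ℝ, VE →L[ℝ] VE) (fun k => X.actLie (g * k)) 1 v = X.actLie g * X.lieAct v := by
  let T : (VE →L[ℝ] VE) →L[ℝ] (VE →L[ℝ] VE) := ContinuousLinearMap.mul ℝ _ (X.actLie g)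
  have h1 : (fun k => X.actLie (g * k)) = T ∘ X.actLie := by
    ext1 k; simp [T, actLie_mul]
  have hT : MDifferentiable 𝓘(ℝ, VE →L[ℝ] VE) 𝓘(ℝ, VE →L[ℝ] VE) T :=
    T.differentiable.mdifferentiable
  rw [h1, tderiv_comp (hT _) (X.contMDiff_actLie.mdifferentiable (by simp) _), tderiv_eq_fderiv,
    T.fderiv]
  rfl

lemma hasDerivWithinAt_actLie {F : ℝ → G} {A : VG} {S : Set ℝ} {t : ℝ}
    (h : HasLogDerivWithinAt IG F A S t) :
    HasDerivWithinAt (fun u => X.actLie (F u)) (X.actLie (F t) * X.lieAct A) S t := by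
  have h1 := h.comp (X.contMDiff_actLie.mdifferentiable (by simp) _)
  rwa [tderiv_actLie_mul_left] at h1

/-- The infinitesimal version of `∂ (g ▷ e) = g ∂(e) g⁻¹`, seen through the action on `𝔢`. -/
lemma lieAct_bdLie_actLie (g : G) (v : VE) :
    X.lieAct (X.bdLie (X.actLie g v)) = X.actLie g * X.lieAct (X.bdLie v) * X.actLie g⁻¹ := by
  have hρ : MDifferentiable IG 𝓘(ℝ, VE →L[ℝ] VE) X.actLie :=
    X.contMDiff_actLie.mdifferentiable (by simp)
  have hb : MDifferentiable IE IG X.bd := X.contMDiff_bd.mdifferentiable (by simp)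
  have h1 : tderiv IE 𝓘(ℝ, VE →L[ℝ] VE) (X.actLie ∘ X.bd) 1 = X.lieAct.comp X.bdLie := by
    rw [tderiv_comp (hρ _) (hb _), map_one]; rfl
  have h2 := tderiv_comp (I := IE) (I' := IE) (J := 𝓘(ℝ, VE →L[ℝ] VE)) (x := (1 : E))
    (g := X.actLie ∘ X.bd) (f := X.act g) ((hρ _).comp _ (hb _)) (X.mdifferentiable_act_apply _ _)
  rw [map_one, h1] at h2
  let T : (VE →L[ℝ] VE) →L[ℝ] (VE →L[ℝ] VE) :=
    ((ContinuousLinearMap.mul ℝ _).flip (X.actLie g⁻¹)).comp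
      (ContinuousLinearMap.mul ℝ _ (X.actLie g))
  have h3 : (X.actLie ∘ X.bd) ∘ X.act g = T ∘ (X.actLie ∘ X.bd) := by
    ext1 e
    simp only [Function.comp_apply, X.bd_act, actLie_mul]
    rfl
  rw [h3, tderiv_comp (T.differentiable.mdifferentiable _) ((hρ _).comp _ (hb _)), h1,
    tderiv_eq_fderiv, T.fderiv] at h2
  exact (congrArg (fun L => L v) h2).symm

/-- The infinitesimal action is a morphism of Lie algebras: in the chart at `1`, it is the
derivative of a map `ψ` whose derivative along the invariant field of `v` is
`ψ * X.lieAct v`, and second derivatives are symmetric. -/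
lemma lieAct_lieBracketOf [IG.Boundaryless] (u v : VG) :
    X.lieAct (lieBracketOf IG G u v) = X.lieAct u * X.lieAct v - X.lieAct v * X.lieAct u := by
  have : IsManifold IG 1 G := IsManifold.of_le (n := ∞) (by simp)
  set φ := extChartAt IG (1 : G) with hφ
  let ψ : VG → VE →L[ℝ] VE := X.actLie ∘ φ.symm
  have hmem : φ 1 ∈ φ.target := mem_extChartAt_target 1
  have hψ {y : VG} (hy : y ∈ φ.target) : ContDiffAt ℝ ∞ ψ y := by
    rw [← contMDiffAt_iff_contDiffAt]
    exact X.contMDiff_actLie.contMDiffAt.comp y (contMDiffAt_extChartAt_symm_of_mem hy)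
  have hψ1 : ψ (φ 1) = 1 := by simp [ψ, φ, actLie_one]
  have hD {y : VG} (hy : y ∈ φ.target) (w : VG) :
      fderiv ℝ ψ y (chartField IG G y w) = ψ y * X.lieAct w := by
    rw [← tderiv_eq_fderiv, tderiv_comp (I' := IG) (X.contMDiff_actLie.mdifferentiable (by simp) _)
      ((contMDiffAt_extChartAt_symm_of_mem hy).mdifferentiableAt (by simp)),
      ContinuousLinearMap.comp_apply, tderiv_symm_chartField hy]
    refine Eq.trans ?_ (X.tderiv_actLie_mul_left (φ.symm y) w)
    have h1 := tderiv_comp (I := IG) (I' := IG) (J := 𝓘(ℝ, VE →L[ℝ] VE)) (x := (1 : G))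
      (g := X.actLie) (f := (φ.symm y * ·)) (X.contMDiff_actLie.mdifferentiable (by simp) _)
      (mdifferentiableAt_mul_left _ _)
    rw [mul_one] at h1
    exact (congrArg (fun L => L w) h1).symm
  have h1 (w : VG) : chartField IG G (φ 1) w = w := by rw [hφ, chartField_one]; rfl
  have hL (w : VG) : fderiv ℝ ψ (φ 1) w = X.lieAct w := by
    have := hD hmem w
    rwa [h1, hψ1, one_mul] at this
  have hf1 : DifferentiableAt ℝ (fderiv ℝ ψ) (φ 1) :=
    ((hψ hmem).fderiv_right (m := ∞) (by simp)).differentiableAt (by simp)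
  have hc (w : VG) : DifferentiableAt ℝ (fun y => chartField IG G y w) (φ 1) :=
    ((contDiffAt_chartField hmem).differentiableAt (by simp)).clm_apply (by fun_prop)
  have h2 (u v : VG) : fderiv ℝ (fderiv ℝ ψ) (φ 1) u v +
      X.lieAct (fderiv ℝ (fun y => chartField IG G y v) (φ 1) u) = X.lieAct u * X.lieAct v := by
    have e1 := (hf1.hasFDerivAt.clm_apply (hc v).hasFDerivAt)
    have e2 : HasFDerivAt (fun y => ψ y * X.lieAct v) _ (φ 1) :=
      ((hψ hmem).differentiableAt (by simp)).hasFDerivAt.mul_const' (X.lieAct v)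
    have e3 := e1.unique (e2.congr_of_eventuallyEq
      ((isOpen_extChartAt_target (I := IG) (1 : G)).eventually_mem hmem |>.mono
        fun y hy => hD hy v))
    have e4 := congrArg (fun L => L u) e3
    simp [h1, hL] at e4
    rw [← e4, add_comm]
  have h3 : IsSymmSndFDerivAt ℝ ψ (φ 1) := (hψ hmem).isSymmSndFDerivAt
    (by simpa using (ENat.LEInfty.out : (2 : WithTop ℕ∞) ≤ ∞))
  rw [lieBracketOf_eq_fderiv_chartField, map_sub, ← h2 u v, ← h2 v u, h3.eq u v]
  abel

/-- In a crossed module, the adjoint action of `e` is the action of `∂ e`; the infinitesimal form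
of this. -/
lemma IsCrossedModule.lieAct_conjModule {X : LiePreCrossedModule IE E IG G}
    (hX : X.IsCrossedModule) (v : VE) : (conjModule IE E).lieAct v = X.lieAct (X.bdLie v) := by
  have h1 : (conjModule IE E).actLie = X.actLie ∘ X.bd := by
    ext1 e
    have h2 : (fun f => e * f * e⁻¹) = X.act (X.bd e) := by
      ext1 f
      have h3 := hX e f
      unfold peiffer at h3
      rw [map_inv] at h3
      exact mul_inv_eq_one.1 h3
    rw [conjModule_actLie, h2]
    rfl
  unfold lieAct
  rw [h1, tderiv_comp (X.contMDiff_actLie.mdifferentiable (by simp) _)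
    (X.contMDiff_bd.mdifferentiable (by simp) _), map_one]
  rfl

end LiePreCrossedModule

omit X [LieGroup IG ∞ G] in
/-- The infinitesimal adjoint action `ad` satisfies `ad u u = 0`. Read in the chart at `1`, the
conjugation `κ (x, y) = x y x⁻¹` is affine along the lines `x = 1`, `y = 1` and `x = y`, so that its
mixed second derivative vanishes on `(u, u)`. -/
lemma lieAct_conjModule_self [IE.Boundaryless] (u : VE) : (conjModule IE E).lieAct u u = 0 := by
  have : IsManifold IE 1 E := IsManifold.of_le (n := ∞) (by simp)
  set φ := extChartAt IE (1 : E) with hφ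
  set o := φ 1 with ho
  have hφo : φ.symm o = 1 := by simp [o, φ]
  have hmem : o ∈ φ.target := mem_extChartAt_target 1
  let κ : VE × VE → VE := fun p => φ (φ.symm p.1 * φ.symm p.2 * (φ.symm p.1)⁻¹)
  have hκ : ContDiffAt ℝ ∞ κ (o, o) := by
    rw [← contMDiffAt_iff_contDiffAt]
    have h1 : ContMDiffAt 𝓘(ℝ, VE × VE) IE ∞ (fun p : VE × VE => φ.symm p.1) (o, o) :=
      (contMDiffAt_extChartAt_symm_of_mem hmem).comp (o, o) contDiff_fst.contMDiff.contMDiffAt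
    have h2 : ContMDiffAt 𝓘(ℝ, VE × VE) IE ∞ (fun p : VE × VE => φ.symm p.2) (o, o) :=
      (contMDiffAt_extChartAt_symm_of_mem hmem).comp (o, o) contDiff_snd.contMDiff.contMDiffAt
    refine (contMDiffAt_extChartAt_of_mem ?_).comp (o, o) ((h1.mul h2).mul h1.inv)
    simp [hφo]
  have hκ2 : ContDiffAt ℝ 2 κ (o, o) := hκ.of_le ENat.LEInfty.out
  have hnear : ∀ᶠ τ : ℝ in 𝓝 0, o + τ • u ∈ φ.target := by
    have : Tendsto (fun τ : ℝ => o + τ • u) (𝓝 0) (𝓝 o) := by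
      have h : Continuous (fun τ : ℝ => o + τ • u) := by fun_prop
      simpa using h.tendsto 0
    exact this.eventually (extChartAt_target_mem_nhds (I := IE) (1 : E))
  set B := fderiv ℝ (fderiv ℝ κ) (o, o) with hB
  -- `κ` is constant on the line `y = 1`, and equal to the second coordinate on the lines `x = 1`
  -- and `x = y`
  have b1 : B (u, 0) (u, 0) = 0 := by
    refine fderiv_fderiv_apply_self_eq_zero_of_affine (c := o) (w := 0) hκ2
      (Eventually.of_forall fun τ => ?_)
    simp [κ, hφo, ← ho]
  have b2 : B (0, u) (0, u) = 0 := by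
    refine fderiv_fderiv_apply_self_eq_zero_of_affine (c := o) (w := u) hκ2
      (hnear.mono fun τ hτ => ?_)
    simp [κ, hφo, φ.right_inv hτ]
  have b3 : B (u, u) (u, u) = 0 := by
    refine fderiv_fderiv_apply_self_eq_zero_of_affine (c := o) (w := u) hκ2
      (hnear.mono fun τ hτ => ?_)
    simp [κ, φ.right_inv hτ]
  have hsymm : IsSymmSndFDerivAt ℝ κ (o, o) := hκ.isSymmSndFDerivAt
    (by simpa using (ENat.LEInfty.out : (2 : WithTop ℕ∞) ≤ ∞))
  have b4 : B (u, 0) (0, u) = 0 := by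
    have e : ((u, u) : VE × VE) = (u, 0) + (0, u) := by simp
    rw [e] at b3
    simp only [map_add, add_apply, b1, b2] at b3
    have e2 : B (0, u) (u, 0) = B (u, 0) (0, u) := hsymm.eq _ _
    rw [e2] at b3
    have : (2 : ℝ) • B (u, 0) (0, u) = 0 := by rw [two_smul]; simpa using b3
    simpa using this
  -- the partial derivative of `κ` in the second variable is the adjoint action
  have hAd : ∀ᶠ x in 𝓝 o, fderiv ℝ κ (x, o) (0, u) = (conjModule IE E).actLie (φ.symm x) u := by
    have hc : Tendsto (fun x : VE => (x, o)) (𝓝 o) (𝓝 (o, o)) := by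
      have : Continuous (fun x : VE => (x, o)) := by fun_prop
      exact this.tendsto o
    filter_upwards [hc.eventually (hκ2.eventually (by simp))] with x hx
    have hd := (hx.differentiableAt (by simp)).hasFDerivAt
    have h1 : HasFDerivAt (fun y => κ (x, y)) _ o := hd.comp o (hasFDerivAt_prodMk_right x o)
    have hc1 : ContMDiff IE IE ∞ (fun k : E => φ.symm x * k * (φ.symm x)⁻¹) :=
      (contMDiff_const.mul contMDiff_id).mul contMDiff_const
    have h2 : tderiv 𝓘(ℝ, VE) 𝓘(ℝ, VE) (φ ∘ (fun k : E => φ.symm x * k * (φ.symm x)⁻¹) ∘ φ.symm) o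
        = (conjModule IE E).actLie (φ.symm x) := by
      have e1 : tderiv IE 𝓘(ℝ, VE) φ 1 = ContinuousLinearMap.id ℝ VE := tderiv_extChartAt_self _
      have e2 : tderiv 𝓘(ℝ, VE) IE φ.symm o = ContinuousLinearMap.id ℝ VE := by
        have := tderiv_extChartAt_comp_symm (I := IE) hmem
        rw [← hφ, hφo, e1] at this
        simpa using this
      have d2 : MDifferentiableAt 𝓘(ℝ, VE) IE φ.symm o :=
        (contMDiffAt_extChartAt_symm_of_mem hmem).mdifferentiableAt (by simp)
      have d1 : MDifferentiableAt IE 𝓘(ℝ, VE) φ 1 :=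
        (contMDiffAt_extChartAt_of_mem (by simp)).mdifferentiableAt (by simp)
      have d3 := hc1.mdifferentiable (by simp)
      rw [tderiv_comp (I' := IE) (by simpa [hφo] using d1) ((d3 _).comp _ d2),
        tderiv_comp (I' := IE) (d3 _) d2, e2]
      simp only [Function.comp_apply, hφo, mul_one, mul_inv_cancel]
      rw [e1, conjModule_actLie]
      rfl
    rw [tderiv_eq_fderiv] at h2
    have h3 := h1.fderiv
    rw [← h2]
    have h4 : (fun y => κ (x, y)) =
      φ ∘ (fun k : E => φ.symm x * k * (φ.symm x)⁻¹) ∘ φ.symm := rfl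
    rw [← h4, h3]
    rfl
  have hf1 : HasFDerivAt (fderiv ℝ κ) B (o, o) :=
    ((hκ.fderiv_right (m := ∞) (by simp)).differentiableAt (by simp)).hasFDerivAt
  have k0 : HasFDerivAt (fun x : VE => (x, o)) (.inl ℝ VE VE) o := hasFDerivAt_prodMk_left o o
  have k1 : HasFDerivAt (fun x => fderiv ℝ κ (x, o) (0, u))
      ((ContinuousLinearMap.apply ℝ VE ((0 : VE), u)).comp (B.comp (.inl ℝ VE VE))) o :=
    (ContinuousLinearMap.apply ℝ VE ((0 : VE), u)).hasFDerivAt.comp o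
      (HasFDerivAt.comp (g := fderiv ℝ κ) (f := fun x : VE => (x, o)) o hf1 k0)
  have k2 : HasFDerivAt (fun x => (conjModule IE E).actLie (φ.symm x) u)
      ((ContinuousLinearMap.apply ℝ VE u).comp
        (fderiv ℝ ((conjModule IE E).actLie ∘ φ.symm) o)) o := by
    have d2 : MDifferentiableAt 𝓘(ℝ, VE) IE φ.symm o :=
        (contMDiffAt_extChartAt_symm_of_mem hmem).mdifferentiableAt (by simp)
    have hρ : MDifferentiable IE 𝓘(ℝ, VE →L[ℝ] VE) (conjModule IE E).actLie :=
      (conjModule IE E).contMDiff_actLie.mdifferentiable (by simp)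
    have h1 : DifferentiableAt ℝ ((conjModule IE E).actLie ∘ φ.symm) o :=
      ((hρ _).comp o d2).differentiableAt
    exact (ContinuousLinearMap.apply ℝ VE u).hasFDerivAt.comp o h1.hasFDerivAt
  have k3 := (k2.congr_of_eventuallyEq hAd).unique k1
  have e1 : tderiv IE 𝓘(ℝ, VE) φ 1 = ContinuousLinearMap.id ℝ VE := tderiv_extChartAt_self _
  have e2 : tderiv 𝓘(ℝ, VE) IE φ.symm o = ContinuousLinearMap.id ℝ VE := by
    have := tderiv_extChartAt_comp_symm (I := IE) hmem
    rw [← hφ, hφo, e1] at this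
    simpa using this
  have k4 := congrArg (fun L => L u) k3
  rw [← tderiv_eq_fderiv ((conjModule IE E).actLie ∘ φ.symm), tderiv_comp (I' := IE)
    ((conjModule IE E).contMDiff_actLie.mdifferentiable (by simp) _)
    ((contMDiffAt_extChartAt_symm_of_mem hmem).mdifferentiableAt (by simp)), hφo, e2] at k4
  refine Eq.trans ?_ (k4.trans b4)
  rfl

end Module

/-! ### Auxiliary calculus -/

section Calculus

variable {W : Type*} [NormedAddCommGroup W] [NormedSpace ℝ W]

/-- The retraction of `ℝ` onto `[0,1]`. -/
def clamp (t : ℝ) : ℝ := max 0 (min 1 t)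

lemma clamp_mem (t : ℝ) : clamp t ∈ Icc (0 : ℝ) 1 := by
  simp [clamp]

lemma clamp_of_mem {t : ℝ} (ht : t ∈ Icc (0 : ℝ) 1) : clamp t = t := by
  simp [clamp, ht.1, ht.2]

@[fun_prop]
lemma continuous_clamp : Continuous clamp := by unfold clamp; fun_prop

lemma continuous_comp_clamp {Y Z : Type*} [TopologicalSpace Y] [TopologicalSpace Z]
    {f : ℝ → Y → Z} (hf : ContinuousOn (Function.uncurry f) (Icc (0 : ℝ) 1 ×ˢ univ)) :
    Continuous fun p : ℝ × Y => f (clamp p.1) p.2 :=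
  hf.comp_continuous (f := fun p : ℝ × Y => (clamp p.1, p.2)) (by fun_prop)
    fun p => ⟨clamp_mem _, mem_univ _⟩

omit [NormedSpace ℝ W] in
/-- A uniform bound for a continuous function of two variables, uniform in the first variable in
`[0,1]` and local in the second one. -/
lemma exists_bound_on_strip {f : ℝ → ℝ → W} (hf : Continuous (Function.uncurry f)) (x₀ : ℝ) :
    ∃ k, 0 ≤ k ∧ ∀ t ∈ Icc (0 : ℝ) 1, ∀ x ∈ Metric.closedBall x₀ 1, ‖f t x‖ ≤ k := by
  obtain ⟨k, hk⟩ := (isCompact_Icc.prod (isCompact_closedBall x₀ 1)).exists_bound_of_continuousOn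
    (f := Function.uncurry f) (s := Icc (0 : ℝ) 1 ×ˢ Metric.closedBall x₀ 1) hf.continuousOn
  refine ⟨max k 0, le_max_right _ _, fun t ht x hx => (hk (t, x) ⟨ht, hx⟩).trans (le_max_left _ _)⟩

lemma hasDerivAt_integral_of_continuous [CompleteSpace W] {f f' : ℝ → ℝ → W}
    (hf : Continuous (Function.uncurry f)) (hf' : Continuous (Function.uncurry f')) {b : ℝ}
    (hb : b ∈ Icc (0 : ℝ) 1) (x₀ : ℝ)
    (h : ∀ t ∈ Icc (0 : ℝ) 1, ∀ x, HasDerivAt (f t) (f' t x) x) :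
    HasDerivAt (fun x => ∫ t in (0 : ℝ)..b, f t x) (∫ t in (0 : ℝ)..b, f' t x₀) x₀ := by
  obtain ⟨k, -, hk⟩ := exists_bound_on_strip hf' x₀
  have hsub : uIoc 0 b ⊆ Icc (0 : ℝ) 1 := by
    rw [uIoc_of_le hb.1]
    exact fun t ht => ⟨ht.1.le, ht.2.trans hb.2⟩
  have hc (g : ℝ → ℝ → W) (hg : Continuous (Function.uncurry g)) (x : ℝ) :
      Continuous fun t => g t x := hg.comp (by fun_prop : Continuous fun t : ℝ => (t, x))
  refine (intervalIntegral.hasDerivAt_integral_of_dominated_loc_of_deriv_le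
    (F := fun x t => f t x) (F' := fun x t => f' t x) (bound := fun _ => k)
    (Metric.closedBall_mem_nhds x₀ one_pos)
    (Eventually.of_forall fun x => (hc f hf x).aestronglyMeasurable)
    ((hc f hf x₀).intervalIntegrable _ _) (hc f' hf' x₀).aestronglyMeasurable
    (Eventually.of_forall fun t ht x hx => hk t (hsub ht) x hx)
    intervalIntegrable_const
    (Eventually.of_forall fun t ht x _ => h t (hsub ht) x)).2

/-- The fundamental theorem of calculus for a function which is differentiable on `[0,1]`, with a
continuous derivative. -/
lemma integral_eq_sub_of_hasDerivWithinAt [CompleteSpace W] {f f' : ℝ → W} {t : ℝ}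
    (ht : t ∈ Icc (0 : ℝ) 1)
    (h : ∀ u ∈ Icc (0 : ℝ) 1, HasDerivWithinAt f (f' u) (Icc 0 1) u)
    (hf' : ContinuousOn f' (Icc 0 1)) :
    ∫ u in (0 : ℝ)..t, f' u = f t - f 0 := by
  have hsub : Icc 0 t ⊆ Icc (0 : ℝ) 1 := Icc_subset_Icc_right ht.2
  refine intervalIntegral.integral_eq_sub_of_hasDerivAt_of_le ht.1
    (fun u hu => ((h u (hsub hu)).mono hsub).continuousWithinAt)
    (fun u hu => (h u (hsub (Ioo_subset_Icc_self hu))).hasDerivAt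
      (Icc_mem_nhds hu.1 (hu.2.trans_le ht.2))) ?_
  exact (hf'.mono (by rwa [uIcc_of_le ht.1])).intervalIntegrable

end Calculus

/-! ### Equations in Lie groups -/

section Constant

variable {VM : Type*} [NormedAddCommGroup VM] [NormedSpace ℝ VM]
  {HM : Type*} [TopologicalSpace HM] {I : ModelWithCorners ℝ VM HM}
  {M : Type*} [TopologicalSpace M] [ChartedSpace HM M] [IsManifold I ∞ M]

/-- A curve with zero velocity on `[0,1]` is constant: it is locally constant, since it is so in
charts. -/
lemma eq_of_velocity_eq_zero {F : ℝ → M}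
    (h : ∀ t ∈ Icc (0 : ℝ) 1, HasVelocityWithinAt I F 0 (Icc 0 1) t) {a b : ℝ}
    (ha : a ∈ Icc (0 : ℝ) 1) (hb : b ∈ Icc (0 : ℝ) 1) : F a = F b := by
  have : IsManifold I 1 M := IsManifold.of_le (n := ∞) (by simp)
  let f : Icc (0 : ℝ) 1 → M := fun t => F t
  have hf : IsLocallyConstant f := by
    rw [IsLocallyConstant.iff_eventually_eq]
    rintro ⟨t₀, ht₀⟩
    set φ := extChartAt I (F t₀) with hφ
    have h1 : ∀ᶠ t in 𝓝[Icc 0 1] t₀, F t ∈ φ.source :=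
      (h t₀ ht₀).continuousWithinAt.eventually (extChartAt_source_mem_nhds (I := I) (F t₀))
    obtain ⟨δ, hδ, hball⟩ := Metric.mem_nhdsWithin_iff.1 h1
    have h2 : ∀ t ∈ Metric.ball t₀ δ ∩ Icc 0 1,
        HasDerivWithinAt (φ ∘ F) 0 (Metric.ball t₀ δ ∩ Icc 0 1) t := by
      intro t ht
      have h3 := ((h t ht.2).comp (I' := 𝓘(ℝ, VM)) (ψ := φ)
        ((contMDiffAt_extChartAt' (n := ∞)
          (by rw [← extChartAt_source I]; exact hball ht)).mdifferentiableAt (by simp))).mono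
          (inter_subset_right : Metric.ball t₀ δ ∩ Icc 0 1 ⊆ _)
      rw [map_zero] at h3
      exact hasVelocityWithinAt_iff_hasDerivWithinAt.1 h3
    have h4 : ∀ᶠ t in 𝓝[Icc 0 1] t₀, F t = F t₀ := by
      rw [eventually_iff, Metric.mem_nhdsWithin_iff]
      refine ⟨δ, hδ, fun t ht => ?_⟩
      have h5 := Convex.norm_image_sub_le_of_norm_hasDerivWithin_le (C := 0) h2 (by simp)
        ((convex_ball t₀ δ).inter (convex_Icc 0 1)) ⟨Metric.mem_ball_self hδ, ht₀⟩ ht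
      rw [zero_mul, norm_le_zero_iff, sub_eq_zero] at h5
      exact φ.injOn (hball ht) (mem_extChartAt_source _) h5
    exact (preimage_coe_mem_nhds_subtype (a := ⟨t₀, ht₀⟩)).2 h4
  exact hf.apply_eq_of_preconnectedSpace ⟨a, ha⟩ ⟨b, hb⟩

end Constant

section Equation

variable {VG : Type*} [NormedAddCommGroup VG] [NormedSpace ℝ VG]
  {HG : Type*} [TopologicalSpace HG] {I : ModelWithCorners ℝ VG HG}
  {G : Type*} [TopologicalSpace G] [ChartedSpace HG G] [Group G]

lemma SolvesLieODE.congr {A A' : ℝ → VG} {a : ℝ} {F : ℝ → G} (h : SolvesLieODE I A a F)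
    (hA : EqOn A A' (Icc 0 1)) : SolvesLieODE I A' a F := by
  rw [solvesLieODE_iff] at h ⊢
  exact ⟨h.1, fun t ht => hA ht ▸ h.2 t ht⟩

lemma lieODE_congr {A A' : ℝ → VG} (hA : EqOn A A' (Icc 0 1)) (a b : ℝ) :
    lieODE (G := G) I A a b = lieODE I A' a b := by
  have : ∀ F : ℝ → G, SolvesLieODE I A a F ↔ SolvesLieODE I A' a F :=
    fun F => ⟨fun h => h.congr hA, fun h => h.congr hA.symm⟩
  unfold lieODE
  simp only [this]

lemma HasLogDerivWithinAt.comp_affine {F : ℝ → G} {A : VG} {S T : Set ℝ} {a b t : ℝ}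
    (h : HasLogDerivWithinAt I F A S (a * t + b)) (hT : MapsTo (fun t => a * t + b) T S) :
    HasLogDerivWithinAt I (fun t => F (a * t + b)) (a • A) T t := by
  have h1 := HasVelocityWithinAt.comp_affine h hT
  unfold HasLogDerivWithinAt
  rwa [map_smul]

lemma HasLogDerivWithinAt.congr {F F' : ℝ → G} {A : VG} {S : Set ℝ} {t : ℝ}
    (h : HasLogDerivWithinAt I F A S t) (hF : ∀ u ∈ S, F' u = F u) (ht : F' t = F t) :
    HasLogDerivWithinAt I F' A S t := by
  unfold HasLogDerivWithinAt
  rw [ht]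
  exact HasVelocityWithinAt.congr h hF ht

variable [LieGroup I ∞ G]

lemma SolvesLieODE.eqOn {A : ℝ → VG} {F F' : ℝ → G} {a : ℝ} (ha : a ∈ Icc (0 : ℝ) 1)
    (h : SolvesLieODE I A a F) (h' : SolvesLieODE I A a F') : EqOn F F' (Icc 0 1) := by
  rw [solvesLieODE_iff] at h h'
  intro t ht
  have h1 : ∀ t ∈ Icc (0 : ℝ) 1,
      HasVelocityWithinAt I (fun t => F t * (F' t)⁻¹) 0 (Icc 0 1) t := by
    intro t ht
    have h2 := (h.2 t ht).div (h'.2 t ht)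
    rw [sub_self, map_zero] at h2
    unfold HasLogDerivWithinAt at h2
    rwa [map_zero] at h2
  have h3 := eq_of_velocity_eq_zero h1 ht ha
  rw [h.1, h'.1, inv_one, mul_one] at h3
  exact mul_inv_eq_one.1 h3

lemma lieODE_eq_of_solves {A : ℝ → VG} {F : ℝ → G} {a : ℝ} (ha : a ∈ Icc (0 : ℝ) 1)
    (h : SolvesLieODE I A a F) {b : ℝ} (hb : b ∈ Icc (0 : ℝ) 1) : lieODE I A a b = F b := by
  have h1 : ∃ g : G, ∃ F : ℝ → G, SolvesLieODE I A a F ∧ F b = g := ⟨F b, F, h, rfl⟩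
  obtain ⟨F', hF', hb'⟩ := Classical.epsilon_spec h1
  exact hb'.symm.trans (hF'.eqOn ha h hb)

lemma lieODEWellPosed_of_solves {A : ℝ → VG} {F : ℝ → G} {a : ℝ} (ha : a ∈ Icc (0 : ℝ) 1)
    (h : SolvesLieODE I A a F) : LieODEWellPosed I G A a := by
  have h1 : EqOn (lieODE I A a) F (Icc 0 1) := fun b hb => lieODE_eq_of_solves ha h hb
  have h2 : SolvesLieODE I A a (lieODE (G := G) I A a) := by
    rw [solvesLieODE_iff] at h ⊢
    exact ⟨(h1 ha).trans h.1, fun t ht => (h.2 t ht).congr h1 (h1 ht)⟩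
  exact ⟨h2, fun F' hF' => hF'.eqOn ha h2⟩

variable [I.Boundaryless] [CompleteSpace VG]

variable (I G) in
/-- For a small right-hand side `C`, the equation `F' = F C` is solved in the chart at `1`, and the
solution at time `1` agrees with `∫ C` up to an error which is quadratic in `C`. -/
lemma exists_solvesLieODE_of_small : ∃ δ₀ > 0, ∃ K ≥ 0, ∀ (C : ℝ → VG), Continuous C → ∀ δ, δ ≤ δ₀ →
    (∀ t ∈ Icc (0 : ℝ) 1, ‖C t‖ ≤ δ) → ∃ F : ℝ → G, SolvesLieODE I C 0 F ∧
      F 1 ∈ (extChartAt I (1 : G)).source ∧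
      ‖extChartAt I (1 : G) (F 1) - extChartAt I (1 : G) 1 - ∫ t in (0 : ℝ)..1, C t‖ ≤
        K * δ ^ 2 := by
  have : IsManifold I 1 G := IsManifold.of_le (n := ∞) (by simp)
  set φ := extChartAt I (1 : G) with hφ
  set o := φ 1 with ho
  have hmem : o ∈ φ.target := mem_extChartAt_target 1
  obtain ⟨κ, s, hs, hLip⟩ := ((contDiffAt_chartField hmem).of_le (m := 1)
    (by simp)).exists_lipschitzOnWith
  obtain ⟨r', hr', hball⟩ := Metric.nhds_basis_closedBall.mem_iff.1
    (inter_mem hs (extChartAt_target_mem_nhds (I := I) (1 : G)))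
  let r : NNReal := ⟨r', hr'.le⟩
  have hr : (r : ℝ) = r' := rfl
  have hone : chartField I G o = ContinuousLinearMap.id ℝ VG := chartField_one
  have ho_mem : o ∈ Metric.closedBall o r' := Metric.mem_closedBall_self hr'.le
  have hdist {y : VG} (hy : y ∈ Metric.closedBall o r') :
      ‖chartField I G y - ContinuousLinearMap.id ℝ VG‖ ≤ κ * ‖y - o‖ := by
    have := hLip.dist_le_mul y (hball hy).1 o (hball ho_mem).1
    rwa [dist_eq_norm, dist_eq_norm, hone] at this
  let Mb : NNReal := 1 + κ * r
  have hMb {y : VG} (hy : y ∈ Metric.closedBall o r') : ‖chartField I G y‖ ≤ Mb := by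
    have h1 : ‖chartField I G y‖ ≤ ‖ContinuousLinearMap.id ℝ VG‖ +
        ‖chartField I G y - ContinuousLinearMap.id ℝ VG‖ := norm_le_norm_add_norm_sub' _ _
    have h2 : ‖y - o‖ ≤ r' := by simpa [dist_eq_norm] using hy
    have h3 : (Mb : ℝ) = 1 + κ * r' := rfl
    rw [h3]
    refine h1.trans (add_le_add ContinuousLinearMap.norm_id_le ((hdist hy).trans ?_))
    gcongr
  have hMb1 : (1 : ℝ) ≤ Mb := by
    have : (1 : NNReal) ≤ Mb := le_add_of_nonneg_right zero_le
    exact_mod_cast this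
  refine ⟨r' / Mb, by positivity, κ * Mb, by positivity, fun C hC δ' hδ' hCδ => ?_⟩
  have hδ0 : 0 ≤ δ' := (norm_nonneg _).trans (hCδ 0 (by simp))
  let δ : NNReal := ⟨δ', hδ0⟩
  have hPL : IsPicardLindelof (fun t y => chartField I G y (C t)) (tmin := 0) (tmax := 1)
      ⟨0, by simp⟩ o r 0 (Mb * δ) (κ * δ) := by
    refine ⟨fun t ht => LipschitzOnWith.of_dist_le_mul fun x hx y hy => ?_, fun y hy => ?_,
      fun t ht y hy => ?_, ?_⟩
    · rw [dist_eq_norm, ← sub_apply]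
      have h1 := hLip.dist_le_mul x (hball hx).1 y (hball hy).1
      rw [dist_eq_norm] at h1
      calc _ ≤ ‖chartField I G x - chartField I G y‖ * ‖C t‖ := ContinuousLinearMap.le_opNorm _ _
        _ ≤ (κ * dist x y) * δ' := by gcongr; exact hCδ t ht
        _ = _ := by rw [NNReal.coe_mul]; show _ = κ * δ' * _; ring
    · exact ((chartField I G y).continuous.comp hC).continuousOn
    · exact (ContinuousLinearMap.le_opNorm _ _).trans
        (mul_le_mul (hMb hy) (hCδ t ht) (norm_nonneg _) (by positivity))
    · have h1 : (Mb : ℝ) * δ' ≤ r' := by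
        rw [le_div_iff₀ (by positivity)] at hδ'
        linarith
      have h2 : (((Mb * δ : NNReal) : ℝ)) * max ((1 : ℝ) - 0) (0 - 0) ≤ r - (0 : NNReal) := by
        rw [NNReal.coe_zero, sub_zero, sub_zero, sub_zero, max_eq_left zero_le_one, mul_one]
        exact h1
      exact h2
  obtain ⟨y, hy0, hyb, hy⟩ : ∃ y : ℝ → VG, y 0 = o ∧ (∀ t, y t ∈ Metric.closedBall o r') ∧
      ∀ t ∈ Icc (0 : ℝ) 1, HasDerivWithinAt y (chartField I G (y t) (C t)) (Icc 0 1) t := by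
    obtain ⟨α, hα⟩ := ODE.FunSpace.exists_isFixedPt_next hPL (Metric.mem_closedBall_self le_rfl)
    refine ⟨α.compProj, ?_, fun t => α.compProj_mem_closedBall hPL.mul_max_le, fun t ht => ?_⟩
    · have := ODE.FunSpace.compProj_val (α := α) (t := ⟨0, by simp⟩)
      refine this.trans ?_
      rw [← hα, ODE.FunSpace.next_apply₀]
    · apply ODE.hasDerivWithinAt_picard_Icc (⟨by simp, by simp⟩ : (0 : ℝ) ∈ Icc (0 : ℝ) 1)
        hPL.continuousOn_uncurry α.continuous_compProj.continuousOn
        (fun _ _ => α.compProj_mem_closedBall hPL.mul_max_le) o ht |>.congr_of_mem _ ht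
      intro t' ht'
      nth_rw 1 [← hα]
      rw [ODE.FunSpace.compProj_of_mem ht', ODE.FunSpace.next_apply]
  have hyt (t : ℝ) : y t ∈ φ.target := (hball (hyb t)).2
  refine ⟨fun t => φ.symm (y t), ?_, φ.map_target (hyt 1), ?_⟩
  · rw [solvesLieODE_iff]
    refine ⟨by simp [hy0, ho, φ], fun t ht => ?_⟩
    have h1 := (hasVelocityWithinAt_iff_hasDerivWithinAt.2 (hy t ht)).comp (I' := I) (ψ := φ.symm)
      ((contMDiffAt_extChartAt_symm_of_mem (hyt t)).mdifferentiableAt (by simp))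
    rw [tderiv_symm_chartField (hyt t)] at h1
    exact h1
  · have hyo : ∀ t ∈ Icc (0 : ℝ) 1, ‖y t - o‖ ≤ Mb * δ' := by
      intro t ht
      have h1 := norm_image_sub_le_of_norm_deriv_le_segment' hy
        (fun t ht => hPL.norm_le t (Ico_subset_Icc_self ht) (y t) (hyb t)) t ht
      rw [hy0] at h1
      refine h1.trans ?_
      show (Mb * δ') * (t - 0) ≤ _
      rw [sub_zero]
      exact mul_le_of_le_one_right (mul_nonneg Mb.2 hδ0) ht.2
    have hint (t : ℝ) : HasDerivAt (fun t => ∫ u in (0 : ℝ)..t, C u) (C t) t :=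
      intervalIntegral.integral_hasDerivAt_right (hC.intervalIntegrable _ _)
        hC.stronglyMeasurable.stronglyMeasurableAtFilter hC.continuousAt
    have h2 := norm_image_sub_le_of_norm_deriv_le_segment_01'
      (f := fun t => y t - ∫ u in (0 : ℝ)..t, C u) (C := κ * Mb * δ' ^ 2)
      (fun t ht => (hy t ht).sub (hint t).hasDerivWithinAt) (fun t ht => ?_)
    · simp only [intervalIntegral.integral_same, sub_zero, hy0] at h2
      rw [φ.right_inv (hyt 1)]
      convert h2 using 2
      abel
    · have ht' := Ico_subset_Icc_self ht
      have h3 : chartField I G (y t) (C t) - C t =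
        (chartField I G (y t) - ContinuousLinearMap.id ℝ VG) (C t) := by simp
      rw [h3]
      calc _ ≤ ‖chartField I G (y t) - ContinuousLinearMap.id ℝ VG‖ * ‖C t‖ :=
            ContinuousLinearMap.le_opNorm _ _
        _ ≤ (κ * (Mb * δ')) * δ' := by
            gcongr
            · exact (hdist (hyb t)).trans (by gcongr; exact hyo t ht')
            · exact hCδ t ht'
        _ = _ := by ring

omit [I.Boundaryless] [CompleteSpace VG] in
/-- A solution on `[0,1]` is glued from solutions on its two halves. -/
lemma exists_solvesLieODE_of_halves {A : ℝ → VG} {F₁ F₂ : ℝ → G}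
    (h₁ : SolvesLieODE I (fun t => (2⁻¹ : ℝ) • A (2⁻¹ * t)) 0 F₁)
    (h₂ : SolvesLieODE I (fun t => (2⁻¹ : ℝ) • A (2⁻¹ * t + 2⁻¹)) 0 F₂) :
    ∃ F : ℝ → G, SolvesLieODE I A 0 F := by
  rw [solvesLieODE_iff] at h₁ h₂
  let F : ℝ → G := fun t => if t ≤ 2⁻¹ then F₁ (2 * t + 0) else F₁ 1 * F₂ (2 * t + (-1))
  have e1 : ∀ t ∈ Icc (0 : ℝ) 2⁻¹, F t = F₁ (2 * t + 0) := fun t ht => if_pos ht.2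
  have e2 : ∀ t ∈ Icc (2⁻¹ : ℝ) 1, F t = F₁ 1 * F₂ (2 * t + (-1)) := by
    intro t ht
    rcases ht.1.eq_or_lt with h | h
    · rw [← h]; norm_num [F, h₂.1]
    · exact if_neg (not_le.2 h)
  have d1 : ∀ t ∈ Icc (0 : ℝ) 2⁻¹, HasLogDerivWithinAt I F (A t) (Icc 0 2⁻¹) t := by
    intro t ht
    have hm : MapsTo (fun t : ℝ => 2 * t + 0) (Icc 0 2⁻¹) (Icc 0 1) := by
      intro u hu; constructor <;> simp only [] <;> linarith [hu.1, hu.2]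
    have h := ((h₁.2 (2 * t + 0) (hm ht)).comp_affine hm).congr e1 (e1 t ht)
    convert h using 1
    rw [smul_smul]; norm_num
    congr 1; ring
  have d2 : ∀ t ∈ Icc (2⁻¹ : ℝ) 1, HasLogDerivWithinAt I F (A t) (Icc 2⁻¹ 1) t := by
    intro t ht
    have hm : MapsTo (fun t : ℝ => 2 * t + (-1)) (Icc 2⁻¹ 1) (Icc 0 1) := by
      intro u hu; constructor <;> simp only [] <;> linarith [hu.1, hu.2]
    have h := (((h₂.2 (2 * t + (-1)) (hm ht)).comp_affine hm).const_mul (F₁ 1)).congr e2 (e2 t ht)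
    convert h using 1
    rw [smul_smul]; norm_num
    congr 1; ring
  refine ⟨F, solvesLieODE_iff.2 ⟨?_, fun t ht => ?_⟩⟩
  · rw [e1 0 (by norm_num)]; simpa using h₁.1
  · rcases lt_trichotomy t 2⁻¹ with h | h | h
    · refine HasMFDerivWithinAt.mono_of_mem_nhdsWithin (d1 t ⟨ht.1, h.le⟩) ?_
      filter_upwards [self_mem_nhdsWithin, mem_nhdsWithin_of_mem_nhds (Iio_mem_nhds h)]
        with u hu hu'
      exact ⟨hu.1, le_of_lt hu'⟩
    · have hu := HasVelocityWithinAt.union (d1 t ⟨ht.1, h.le⟩) (d2 t ⟨h.ge, ht.2⟩)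
      rwa [Icc_union_Icc_eq_Icc (by norm_num) (by norm_num)] at hu
    · refine HasMFDerivWithinAt.mono_of_mem_nhdsWithin (d2 t ⟨h.le, ht.2⟩) ?_
      filter_upwards [self_mem_nhdsWithin, mem_nhdsWithin_of_mem_nhds (Ioi_mem_nhds h)]
        with u hu hu'
      exact ⟨le_of_lt hu', hu.2⟩

/-- The equation `F' = F A` has a solution on the whole of `[0,1]`: by repeated bisection one
reduces to small right-hand sides. -/
lemma exists_solvesLieODE {A : ℝ → VG} (hA : Continuous A) :
    ∃ F : ℝ → G, SolvesLieODE I A 0 F := by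
  obtain ⟨δ₀, hδ₀, K, -, hsmall⟩ := exists_solvesLieODE_of_small I G
  have key : ∀ n : ℕ, ∀ A : ℝ → VG, Continuous A → (∀ t ∈ Icc (0 : ℝ) 1, ‖A t‖ ≤ 2 ^ n * δ₀) →
      ∃ F : ℝ → G, SolvesLieODE I A 0 F := by
    intro n
    induction n with
    | zero =>
      intro A hA hb
      obtain ⟨F, hF, -⟩ := hsmall A hA δ₀ le_rfl (by simpa using hb)
      exact ⟨F, hF⟩
    | succ n ih =>
      intro A hA hb
      have hhalf (u : ℝ) (hu : u ∈ Icc (0 : ℝ) 1) : ‖(2⁻¹ : ℝ) • A u‖ ≤ 2 ^ n * δ₀ := by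
        rw [norm_smul]
        have := hb u hu
        norm_num
        rw [pow_succ] at this
        linarith
      obtain ⟨F₁, h₁⟩ := ih (fun t => (2⁻¹ : ℝ) • A (2⁻¹ * t)) (by fun_prop) (fun t ht =>
        hhalf _ ⟨by linarith [ht.1], by linarith [ht.2]⟩)
      obtain ⟨F₂, h₂⟩ := ih (fun t => (2⁻¹ : ℝ) • A (2⁻¹ * t + 2⁻¹)) (by fun_prop) (fun t ht =>
        hhalf _ ⟨by linarith [ht.1], by linarith [ht.2]⟩)
      exact exists_solvesLieODE_of_halves h₁ h₂
  obtain ⟨k, hk⟩ := isCompact_Icc.exists_bound_of_continuousOn (s := Icc (0 : ℝ) 1) hA.continuousOn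
  obtain ⟨n, hn⟩ := pow_unbounded_of_one_lt (k / δ₀) (one_lt_two (α := ℝ))
  refine key n A hA fun t ht => (hk t ht).trans ?_
  rw [div_lt_iff₀ hδ₀] at hn
  exact hn.le

lemma lieODEWellPosed {A : ℝ → VG} (hA : ContinuousOn A (Icc 0 1)) : LieODEWellPosed I G A 0 := by
  obtain ⟨F, hF⟩ := exists_solvesLieODE (I := I) (G := G) (A := fun t => A (clamp t))
    (hA.comp_continuous continuous_clamp clamp_mem)
  exact lieODEWellPosed_of_solves (by simp) (hF.congr fun t ht => by simp only [clamp_of_mem ht])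

end Equation

/-! ### Dependence of the endpoint on a parameter -/

section Endpoint

variable {VE : Type*} [NormedAddCommGroup VE] [NormedSpace ℝ VE] [CompleteSpace VE]
  {HE : Type*} [TopologicalSpace HE] {IE : ModelWithCorners ℝ VE HE} [IE.Boundaryless]
  {E : Type*} [TopologicalSpace E] [ChartedSpace HE E] [Group E] [LieGroup IE ∞ E]
  {A A' : ℝ → ℝ → VE} {x₀ : ℝ}

/-- Let `eₓ` solve `eₓ' = eₓ A(·, x)`. If `∂ₓA = B' + [A, B]` at `x₀` with `B(0) = B(1) = 0`, then
`x ↦ eₓ(1)` is stationary at `x₀`. Indeed `eₓ e_{x₀}⁻¹` solves the equation with the small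
right-hand side `C = Ad(e_{x₀}) (A(·, x) - A(·, x₀))`, so that it is `∫ C` to first order, and the
derivative of `∫ C` is `∫ Ad(e_{x₀}) (B' + [A, B]) = ∫ (Ad(e_{x₀}) B)' = 0`. -/
lemma hasVelocityWithinAt_lieODE_endpoint (hA : Continuous (Function.uncurry A))
    (hA' : Continuous (Function.uncurry A'))
    (hAA' : ∀ s ∈ Icc (0 : ℝ) 1, ∀ x, HasDerivAt (A s) (A' s x) x) {B B' : ℝ → VE}
    (hB : ∀ s ∈ Icc (0 : ℝ) 1, HasDerivWithinAt B (B' s) (Icc 0 1) s) (hB0 : B 0 = 0)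
    (hB1 : B 1 = 0)
    (hflat : ∀ s ∈ Icc (0 : ℝ) 1, A' s x₀ = B' s + (conjModule IE E).lieAct (A s x₀) (B s)) :
    HasVelocityWithinAt IE (fun x => lieODE (G := E) IE (fun s => A s x) 0 1) 0 univ x₀ := by
  have : IsManifold IE 1 E := IsManifold.of_le (n := ∞) (by simp)
  have hAx (x : ℝ) : Continuous fun s => A s x :=
    hA.comp (by fun_prop : Continuous fun s : ℝ => (s, x))
  have hAx' (x : ℝ) : Continuous fun s => A' s x :=
    hA'.comp (by fun_prop : Continuous fun s : ℝ => (s, x))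
  let e (x s : ℝ) : E := lieODE IE (fun s => A s x) 0 s
  have he (x : ℝ) : SolvesLieODE IE (fun s => A s x) 0 (e x) :=
    (lieODEWellPosed (hAx x).continuousOn).1
  set 𝒜 := conjModule IE E with h𝒜
  have hAd (s : ℝ) (hs : s ∈ Icc (0 : ℝ) 1) : HasDerivWithinAt (fun s => 𝒜.actLie (e x₀ s))
      (𝒜.actLie (e x₀ s) * 𝒜.lieAct (A s x₀)) (Icc 0 1) s :=
    𝒜.hasDerivWithinAt_actLie ((solvesLieODE_iff.1 (he x₀)).2 s hs)
  let Adc (s : ℝ) : VE →L[ℝ] VE := 𝒜.actLie (e x₀ (clamp s))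
  have hAdc : Continuous Adc := by
    have h1 : ContinuousOn (fun s => 𝒜.actLie (e x₀ s)) (Icc 0 1) :=
      fun s hs => (hAd s hs).continuousWithinAt
    exact h1.comp_continuous continuous_clamp clamp_mem
  have hAdc_eq (s : ℝ) (hs : s ∈ Icc (0 : ℝ) 1) : Adc s = 𝒜.actLie (e x₀ s) := by
    simp only [Adc, clamp_of_mem hs]
  let C (x s : ℝ) : VE := Adc s (A s x - A s x₀)
  have hC (x : ℝ) : Continuous (C x) := hAdc.clm_apply ((hAx x).sub (hAx x₀))
  -- `eₓ e_{x₀}⁻¹` has logarithmic derivative `C x`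
  have hquot (x : ℝ) : SolvesLieODE IE (C x) 0 (fun s => e x s * (e x₀ s)⁻¹) := by
    have h1 := solvesLieODE_iff.1 (he x)
    have h2 := solvesLieODE_iff.1 (he x₀)
    refine solvesLieODE_iff.2 ⟨by simp only [h1.1, h2.1, inv_one, mul_one], fun s hs => ?_⟩
    simp only [C, hAdc_eq s hs]
    exact (h1.2 s hs).div (h2.2 s hs)
  obtain ⟨k₁, hk₁⟩ := isCompact_Icc.exists_bound_of_continuousOn (s := Icc (0 : ℝ) 1)
    hAdc.continuousOn
  have hk₁0 : 0 ≤ k₁ := (norm_nonneg _).trans (hk₁ 0 (by simp))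
  obtain ⟨k₂, hk₂0, hk₂⟩ := exists_bound_on_strip hA' x₀
  have hCb (x : ℝ) (hx : x ∈ Metric.closedBall x₀ 1) (s : ℝ) (hs : s ∈ Icc (0 : ℝ) 1) :
      ‖C x s‖ ≤ k₁ * k₂ * ‖x - x₀‖ := by
    have h1 : ‖A s x - A s x₀‖ ≤ k₂ * ‖x - x₀‖ :=
      Convex.norm_image_sub_le_of_norm_hasDerivWithin_le (s := Metric.closedBall x₀ 1)
        (fun y _ => (hAA' s hs y).hasDerivWithinAt) (fun y hy => hk₂ s hs y hy)
        (convex_closedBall _ _) (Metric.mem_closedBall_self zero_le_one) hx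
    calc _ ≤ ‖Adc s‖ * ‖A s x - A s x₀‖ := ContinuousLinearMap.le_opNorm _ _
      _ ≤ k₁ * (k₂ * ‖x - x₀‖) := by gcongr; exact hk₁ s hs
      _ = _ := by ring
  obtain ⟨δ₀, hδ₀, K, hK, hsmall⟩ := exists_solvesLieODE_of_small IE E
  set φ := extChartAt IE (1 : E) with hφ
  let g (x : ℝ) : VE := φ (e x 1 * (e x₀ 1)⁻¹)
  have hnear : ∀ᶠ x in 𝓝 x₀, e x 1 * (e x₀ 1)⁻¹ ∈ φ.source ∧
      ‖g x - φ 1 - ∫ s in (0 : ℝ)..1, C x s‖ ≤ K * (k₁ * k₂ * ‖x - x₀‖) ^ 2 := by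
    have h1 : Tendsto (fun x => k₁ * k₂ * ‖x - x₀‖) (𝓝 x₀) (𝓝 0) := by
      have : Continuous fun x => k₁ * k₂ * ‖x - x₀‖ := by fun_prop
      simpa using this.tendsto x₀
    filter_upwards [h1.eventually_le_const hδ₀, Metric.closedBall_mem_nhds x₀ one_pos] with x hx hx1
    obtain ⟨F, hF, hF1, hF2⟩ := hsmall (C x) (hC x) _ hx (hCb x hx1)
    have h2 : F 1 = e x 1 * (e x₀ 1)⁻¹ := hF.eqOn (by simp) (hquot x) (by simp)
    rw [h2] at hF1 hF2
    exact ⟨hF1, hF2⟩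
  have hint : HasDerivAt (fun x => ∫ s in (0 : ℝ)..1, C x s) 0 x₀ := by
    have h1 := hasDerivAt_integral_of_continuous (f := fun s x => C x s)
      (f' := fun s x => Adc s (A' s x)) (b := 1)
      ((hAdc.comp continuous_fst).clm_apply (hA.sub ((hAx x₀).comp continuous_fst)))
      ((hAdc.comp continuous_fst).clm_apply hA') (by simp) x₀
      (fun s hs x => (Adc s).hasFDerivAt.comp_hasDerivAt x ((hAA' s hs x).sub_const (A s x₀)))
    have h2 := integral_eq_sub_of_hasDerivWithinAt (t := 1) (by simp)
      (f := fun s => 𝒜.actLie (e x₀ s) (B s)) (f' := fun s => Adc s (A' s x₀))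
      (fun s hs => ((hAd s hs).clm_apply (hB s hs)).congr_deriv ?_)
      (hAdc.clm_apply (hAx' x₀)).continuousOn
    · rwa [h2, hB0, hB1, map_zero, map_zero, sub_zero] at h1
    · rw [hAdc_eq s hs, hflat s hs, map_add, add_comm]
      rfl
  have hg : HasDerivAt g 0 x₀ := by
    have h1 : HasFDerivAt (fun x => g x - φ 1 - ∫ s in (0 : ℝ)..1, C x s) (0 : ℝ →L[ℝ] VE) x₀ := by
      refine Asymptotics.IsBigO.hasFDerivAt (n := 2) ?_ (by norm_num)
      refine Asymptotics.IsBigO.of_bound (K * (k₁ * k₂) ^ 2) (hnear.mono fun x hx => hx.2.trans ?_)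
      rw [norm_pow, norm_norm]
      exact le_of_eq (by ring)
    have h2 : HasDerivAt (fun x => g x - φ 1 - ∫ s in (0 : ℝ)..1, C x s) 0 x₀ := by
      simpa using h1.hasDerivAt
    have h3 := (h2.add hint).add_const (φ 1)
    rw [add_zero] at h3
    refine h3.congr_of_eventuallyEq (Eventually.of_forall fun x => ?_)
    simp
  have hg1 : g x₀ = φ 1 := by simp [g]
  have hT : ContMDiffAt 𝓘(ℝ, VE) IE ∞ (fun y => φ.symm y * e x₀ 1) (g x₀) :=
    (contMDiffAt_extChartAt_symm_of_mem
      (by rw [hg1]; exact mem_extChartAt_target (1 : E))).mul contMDiffAt_const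
  have h4 := (hasVelocityWithinAt_iff_hasDerivWithinAt.2 (hg.hasDerivWithinAt (s := univ))).comp
    (hT.mdifferentiableAt (by simp))
  rw [map_zero] at h4
  have h5 : ∀ x, e x 1 * (e x₀ 1)⁻¹ ∈ φ.source → φ.symm (g x) * e x₀ 1 = e x 1 := by
    intro x hx
    simp only [g]
    rw [φ.left_inv hx, inv_mul_cancel_right]
  refine h4.congr_of_eventuallyEq ?_ (h5 x₀ (by simp [φ])).symm
  rw [nhdsWithin_univ]
  exact hnear.mono fun x hx => (h5 x hx.1).symm

/-- Flatness of the connection `A ds + B dx` on the square, together with `B = 0` on the sides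
`s = 0` and `s = 1`, makes the transports along the sides `x = 0` and `x = 1` agree. -/
theorem lieODE_endpoint_eq (hA : Continuous (Function.uncurry A))
    (hA' : Continuous (Function.uncurry A'))
    (hAA' : ∀ s ∈ Icc (0 : ℝ) 1, ∀ x, HasDerivAt (A s) (A' s x) x) {B B' : ℝ → ℝ → VE}
    (hB : ∀ x ∈ Icc (0 : ℝ) 1, ∀ s ∈ Icc (0 : ℝ) 1,
      HasDerivWithinAt (fun s => B s x) (B' s x) (Icc 0 1) s)
    (hB0 : ∀ x ∈ Icc (0 : ℝ) 1, B 0 x = 0) (hB1 : ∀ x ∈ Icc (0 : ℝ) 1, B 1 x = 0)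
    (hflat : ∀ x ∈ Icc (0 : ℝ) 1, ∀ s ∈ Icc (0 : ℝ) 1,
      A' s x = B' s x + (conjModule IE E).lieAct (A s x) (B s x)) :
    lieODE (G := E) IE (fun s => A s 0) 0 1 = lieODE IE (fun s => A s 1) 0 1 :=
  eq_of_velocity_eq_zero (I := IE) (F := fun x => lieODE (G := E) IE (fun s => A s x) 0 1)
    (fun x hx => (hasVelocityWithinAt_lieODE_endpoint hA hA' hAA' (hB x hx) (hB0 x hx) (hB1 x hx)
      (hflat x hx)).mono (subset_univ _)) (by simp) (by simp)

end Endpoint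

/-! ### Linear equations depending on parameters -/

section Linear

variable {𝔸 : Type*} [NormedRing 𝔸] [NormedAlgebra ℝ 𝔸]

/-- The solution of a linear equation depends continuously on a parameter, by Grönwall's
inequality. -/
lemma continuousOn_of_linear_equation {Y : Type*} [TopologicalSpace Y] {Λ P : ℝ → Y → 𝔸}
    (hΛ : Continuous (Function.uncurry Λ)) (hP0 : ∀ y, P 0 y = 1)
    (hP : ∀ y, ∀ t ∈ Icc (0 : ℝ) 1,
      HasDerivWithinAt (fun t => P t y) (P t y * Λ t y) (Icc 0 1) t) :
    ContinuousOn (Function.uncurry P) (Icc (0 : ℝ) 1 ×ˢ univ) := by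
  have hPc (y : Y) : ContinuousOn (fun t => P t y) (Icc 0 1) :=
    fun t ht => (hP y t ht).continuousWithinAt
  have hΛc (y : Y) : Continuous fun t => Λ t y :=
    hΛ.comp (by fun_prop : Continuous fun t : ℝ => (t, y))
  have key (y₀ : Y) (η : ℝ) (hη : 0 < η) :
      ∀ᶠ y in 𝓝 y₀, ∀ t ∈ Icc (0 : ℝ) 1, ‖P t y - P t y₀‖ < η := by
    obtain ⟨c, hc⟩ := isCompact_Icc.exists_bound_of_continuousOn (hPc y₀)
    obtain ⟨κ, hκ⟩ := isCompact_Icc.exists_bound_of_continuousOn (s := Icc (0 : ℝ) 1)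
      (hΛc y₀).continuousOn
    have hc0 : 0 ≤ c := (norm_nonneg _).trans (hc 0 (by simp))
    have hκ0 : 0 ≤ κ := (norm_nonneg _).trans (hκ 0 (by simp))
    obtain ⟨ε, ⟨hε0, hε1⟩, hε⟩ : ∃ ε, (0 < ε ∧ ε ≤ 1) ∧ gronwallBound 0 (κ + 1) (c * ε) 1 < η := by
      have h1 : Tendsto (fun ε => gronwallBound 0 (κ + 1) (c * ε) 1) (𝓝[>] 0) (𝓝 0) := by
        have h2 : Continuous fun ε => gronwallBound 0 (κ + 1) (c * ε) 1 :=
          (gronwallBound_continuous_ε 0 (κ + 1) 1).comp (continuous_const.mul continuous_id)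
        have h3 := h2.tendsto 0
        simp only [mul_zero, gronwallBound_ε0_δ0] at h3
        exact h3.mono_left nhdsWithin_le_nhds
      have h4 : ∀ᶠ ε : ℝ in 𝓝[>] 0, 0 < ε ∧ ε ≤ 1 := by
        filter_upwards [Ioc_mem_nhdsGT (zero_lt_one (α := ℝ))] with ε hε using hε
      exact (h4.and (h1.eventually_lt_const hη)).exists
    have hclose : ∀ᶠ y in 𝓝 y₀, ∀ t ∈ Icc (0 : ℝ) 1, ‖Λ t y - Λ t y₀‖ < ε := by
      refine isCompact_Icc.eventually_forall_of_forall_eventually fun t _ => ?_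
      have h1 : Continuous fun p : Y × ℝ => ‖Λ p.2 p.1 - Λ p.2 y₀‖ :=
        ((hΛ.comp continuous_swap).sub ((hΛc y₀).comp continuous_snd)).norm
      have h2 := h1.tendsto (y₀, t)
      simp only [sub_self, norm_zero] at h2
      exact h2.eventually_lt_const hε0
    filter_upwards [hclose] with y hy t ht
    have hd : ∀ u ∈ Ico (0 : ℝ) 1, HasDerivWithinAt (fun u => P u y - P u y₀)
        (P u y * Λ u y - P u y₀ * Λ u y₀) (Ici u) u := fun u hu =>
      ((hP y u (Ico_subset_Icc_self hu)).sub
        (hP y₀ u (Ico_subset_Icc_self hu))).mono_of_mem_nhdsWithin (Icc_mem_nhdsGE_of_mem hu)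
    have hg := norm_le_gronwallBound_of_norm_deriv_right_le (δ := 0) (K := κ + 1) (ε := c * ε)
      ((hPc y).sub (hPc y₀)) hd (by simp [hP0]) (fun u hu => ?_) t ht
    · refine (hg.trans ?_).trans_lt hε
      exact gronwallBound_mono le_rfl (by positivity) (by positivity) (by simpa using ht.2)
    · have hu' := Ico_subset_Icc_self hu
      have h1 : P u y * Λ u y - P u y₀ * Λ u y₀ =
        (P u y - P u y₀) * Λ u y + P u y₀ * (Λ u y - Λ u y₀) := by noncomm_ring
      have h2 : ‖Λ u y‖ ≤ κ + 1 := by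
        have := norm_le_norm_add_norm_sub' (Λ u y) (Λ u y₀)
        linarith [hκ u hu', (hy u hu').le]
      rw [h1]
      calc _ ≤ ‖P u y - P u y₀‖ * ‖Λ u y‖ + ‖P u y₀‖ * ‖Λ u y - Λ u y₀‖ :=
            (norm_add_le _ _).trans (add_le_add (norm_mul_le _ _) (norm_mul_le _ _))
        _ ≤ ‖P u y - P u y₀‖ * (κ + 1) + c * ε := by
            gcongr
            · exact hc u hu'
            · exact (hy u hu').le
        _ = _ := by simp only [Pi.sub_apply]; ring
  rintro ⟨t₀, y₀⟩ ⟨ht₀, -⟩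
  rw [ContinuousWithinAt, Metric.tendsto_nhds]
  intro η hη
  have h1 : ∀ᶠ p : ℝ × Y in 𝓝[Icc 0 1 ×ˢ univ] (t₀, y₀), ‖P p.1 y₀ - P t₀ y₀‖ < η / 2 := by
    have h2 := (Metric.tendsto_nhds.1 (hPc y₀ t₀ ht₀).tendsto (η / 2) (by positivity))
    simp only [dist_eq_norm] at h2
    rw [nhdsWithin_prod_eq]
    exact tendsto_fst.eventually h2
  have h3 : ∀ᶠ p : ℝ × Y in 𝓝[Icc 0 1 ×ˢ univ] (t₀, y₀),
      ∀ t ∈ Icc (0 : ℝ) 1, ‖P t p.2 - P t y₀‖ < η / 2 :=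
    (continuous_snd.continuousWithinAt (x := (t₀, y₀))).eventually (key y₀ (η / 2) (by positivity))
  filter_upwards [h1, h3, self_mem_nhdsWithin] with p hp1 hp3 hp
  rw [dist_eq_norm]
  calc _ = ‖(P p.1 p.2 - P p.1 y₀) + (P p.1 y₀ - P t₀ y₀)‖ := by simp [Function.uncurry]
    _ ≤ _ := norm_add_le _ _
    _ < η := by linarith [hp3 p.1 hp.1]

lemma hasDerivWithinAt_of_mul_eq_one [CompleteSpace 𝔸] {P R : ℝ → 𝔸} {Λ : 𝔸} {t : ℝ} {S : Set ℝ}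
    (h : ∀ u, P u * R u = 1) (h' : ∀ u, R u * P u = 1)
    (hP : HasDerivWithinAt P (P t * Λ) S t) : HasDerivWithinAt R (-(Λ * R t)) S t := by
  have h1 : R = fun u => Ring.inverse (P u) := by
    ext u
    exact (Ring.inverse_unit (⟨P u, R u, h u, h' u⟩ : 𝔸ˣ)).symm
  have h2 := hasFDerivAt_ringInverse (𝕜 := ℝ) (⟨P t, R t, h t, h' t⟩ : 𝔸ˣ)
  have h3 := HasFDerivAt.comp_hasDerivWithinAt (l := Ring.inverse) (f := P) t h2 hP
  have h4 : HasDerivWithinAt (Ring.inverse ∘ P) (-(Λ * R t)) S t := by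
    refine h3.congr_deriv ?_
    show -(R t * (P t * Λ) * R t) = _
    rw [← mul_assoc, h', one_mul]
  exact h4.congr (fun u _ => congrFun h1 u) (congrFun h1 t)

omit [NormedAlgebra ℝ 𝔸] in
lemma continuous_of_mul_eq_one [CompleteSpace 𝔸] {Y : Type*} [TopologicalSpace Y] {P R : Y → 𝔸}
    (h : ∀ u, P u * R u = 1) (h' : ∀ u, R u * P u = 1) (hP : Continuous P) : Continuous R := by
  have h1 : R = fun u => Ring.inverse (P u) := by
    ext u
    exact (Ring.inverse_unit (⟨P u, R u, h u, h' u⟩ : 𝔸ˣ)).symm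
  rw [h1, continuous_iff_continuousAt]
  intro y
  exact ContinuousAt.comp (g := Ring.inverse) (f := P)
    (NormedRing.inverse_continuousAt (⟨P y, R y, h y, h' y⟩ : 𝔸ˣ)) hP.continuousAt

/-- A function with a quotient in the sense of Hadamard that is continuous at `y₀` is differentiable
there. -/
lemma hasDerivAt_of_eq_add_smul {W : Type*} [NormedAddCommGroup W] [NormedSpace ℝ W] {f c : ℝ → W}
    {y₀ : ℝ} (hc : ContinuousAt c y₀) (hf : ∀ y, f y = f y₀ + (y - y₀) • c y) :
    HasDerivAt f (c y₀) y₀ := by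
  rw [hasDerivAt_iff_tendsto_slope]
  refine (hc.tendsto.mono_left nhdsWithin_le_nhds).congr' ?_
  filter_upwards [self_mem_nhdsWithin] with y hy
  rw [slope_def_module, hf y, add_sub_cancel_left, smul_smul, inv_mul_cancel₀ (sub_ne_zero.2 hy),
    one_smul]

/-- Duhamel's formula for the derivative of the solution of `∂P/∂t = P Λ` in a parameter. With `R`
the inverse of `P`, the derivative in `u` of `P(u, y) R(u, y₀)` is
`P(u, y) (Λ(u, y) - Λ(u, y₀)) R(u, y₀)`, and the increment of `Λ` is divisible by `y - y₀`. -/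
lemma hasDerivAt_of_linear_equation [CompleteSpace 𝔸] {Λ Λ' P R : ℝ → ℝ → 𝔸}
    (hΛ' : Continuous (Function.uncurry Λ'))
    (hΛΛ' : ∀ t ∈ Icc (0 : ℝ) 1, ∀ y, HasDerivAt (Λ t) (Λ' t y) y)
    (hPc : Continuous (Function.uncurry P)) (hPR : ∀ t y, P t y * R t y = 1)
    (hRP : ∀ t y, R t y * P t y = 1) (hP0 : ∀ y, P 0 y = 1)
    (hP : ∀ y, ∀ t ∈ Icc (0 : ℝ) 1,
      HasDerivWithinAt (fun t => P t y) (P t y * Λ t y) (Icc 0 1) t) {t : ℝ}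
    (ht : t ∈ Icc (0 : ℝ) 1) (y₀ : ℝ) :
    HasDerivAt (P t) ((∫ u in (0 : ℝ)..t, P u y₀ * Λ' u y₀ * R u y₀) * P t y₀) y₀ := by
  have hRc : Continuous (Function.uncurry R) :=
    continuous_of_mul_eq_one (P := Function.uncurry P) (fun p => hPR p.1 p.2)
      (fun p => hRP p.1 p.2) hPc
  have hfix {f : ℝ → ℝ → 𝔸} (hf : Continuous (Function.uncurry f)) (y : ℝ) :
      Continuous fun t => f t y := hf.comp (by fun_prop : Continuous fun t : ℝ => (t, y))
  -- Hadamard's quotient of the right-hand side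
  let q (u y : ℝ) : 𝔸 := ∫ θ in (0 : ℝ)..1, Λ' u (y₀ + θ * (y - y₀))
  have hq : Continuous (Function.uncurry q) := by
    refine intervalIntegral.continuous_parametric_intervalIntegral_of_continuous'
      (f := fun (p : ℝ × ℝ) θ => Λ' p.1 (y₀ + θ * (p.2 - y₀))) ?_ 0 1
    exact hΛ'.comp (by fun_prop : Continuous fun p : (ℝ × ℝ) × ℝ =>
      (p.1.1, y₀ + p.2 * (p.1.2 - y₀)))
  have hq0 (u : ℝ) : q u y₀ = Λ' u y₀ := by simp [q]
  have hdiff (u : ℝ) (hu : u ∈ Icc (0 : ℝ) 1) (y : ℝ) :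
      Λ u y - Λ u y₀ = (y - y₀) • q u y := by
    have h1 := integral_eq_sub_of_hasDerivWithinAt (t := 1) (by simp)
      (f := fun θ => Λ u (y₀ + θ * (y - y₀))) (f' := fun θ => (y - y₀) • Λ' u (y₀ + θ * (y - y₀)))
      (fun θ _ => (HasDerivAt.scomp θ (hΛΛ' u hu _)
        (by simpa using ((hasDerivAt_id θ).mul_const (y - y₀)).const_add y₀)).hasDerivWithinAt)
      (Continuous.continuousOn ((hΛ'.comp (by fun_prop : Continuous fun θ : ℝ =>
        (u, y₀ + θ * (y - y₀)))).const_smul (y - y₀)))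
    rw [intervalIntegral.integral_smul] at h1
    simpa using h1.symm
  let c (y : ℝ) : 𝔸 := (∫ u in (0 : ℝ)..t, P u y * q u y * R u y₀) * P t y₀
  have hc : Continuous c := by
    refine Continuous.mul ?_ continuous_const
    refine intervalIntegral.continuous_parametric_intervalIntegral_of_continuous'
      (f := fun y u => P u y * q u y * R u y₀) ?_ 0 t
    exact ((hPc.comp continuous_swap).mul (hq.comp continuous_swap)).mul
      ((hfix hRc y₀).comp continuous_snd)
  have hduh (y : ℝ) : P t y = P t y₀ + (y - y₀) • c y := by
    have h1 := integral_eq_sub_of_hasDerivWithinAt ht (f := fun u => P u y * R u y₀)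
      (f' := fun u => (y - y₀) • (P u y * q u y * R u y₀)) (fun u hu => ?_)
      (Continuous.continuousOn
        ((((hfix hPc y).mul (hfix hq y)).mul (hfix hRc y₀)).const_smul (y - y₀)))
    · rw [intervalIntegral.integral_smul, hP0] at h1
      have hR0 : R 0 y₀ = 1 := by have := hPR 0 y₀; rwa [hP0, one_mul] at this
      rw [hR0, mul_one, eq_sub_iff_add_eq] at h1
      have h2 := congrArg (· * P t y₀) h1
      simp only [mul_assoc, hRP, mul_one, add_mul, one_mul, smul_mul_assoc] at h2
      simp only [c]
      rw [← h2, add_comm]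
      simp only [mul_assoc]
    · have h2 := (hP y u hu).mul (hasDerivWithinAt_of_mul_eq_one (fun u => hPR u y₀)
        (fun u => hRP u y₀) (hP y₀ u hu))
      refine h2.congr_deriv ?_
      have h3 : (y - y₀) • (P u y * q u y * R u y₀) = P u y * ((y - y₀) • q u y) * R u y₀ := by
        simp
      rw [h3, ← hdiff u hu]
      noncomm_ring
  have h := hasDerivAt_of_eq_add_smul hc.continuousAt hduh
  simpa only [c, hq0] using h

end Linear

lemma continuous_left {Y Z W : Type*} [TopologicalSpace Y] [TopologicalSpace Z]
    [TopologicalSpace W] {f : Y → Z → W} (hf : Continuous (Function.uncurry f)) (z : Z) :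
    Continuous fun y => f y z :=
  hf.comp (by fun_prop : Continuous fun y : Y => (y, z))

/-! ### The variation of parallel transport and the flatness identity -/

section Variation

variable {VE : Type*} [NormedAddCommGroup VE] [NormedSpace ℝ VE] [CompleteSpace VE]
  {HE : Type*} [TopologicalSpace HE] {IE : ModelWithCorners ℝ VE HE}
  {E : Type*} [TopologicalSpace E] [ChartedSpace HE E] [Group E] [LieGroup IE ∞ E]
  {VG : Type*} [NormedAddCommGroup VG] [NormedSpace ℝ VG] [CompleteSpace VG]
  {HG : Type*} [TopologicalSpace HG] {IG : ModelWithCorners ℝ VG HG} [IG.Boundaryless]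
  {G : Type*} [TopologicalSpace G] [ChartedSpace HG G] [Group G] [LieGroup IG ∞ G]
  (X : LiePreCrossedModule IE E IG G)

/-- The action on `𝔢` of the parallel transport along `t ↦ Λ t y`, extended constantly in `t`
outside `[0,1]`. -/
def transport {Y : Type*} (Λ : ℝ → Y → VG) (t : ℝ) (y : Y) : VE →L[ℝ] VE :=
  X.actLie (lieODE IG (fun u => Λ u y) 0 (clamp t))

/-- The inverse of `transport`. -/
def transportInv {Y : Type*} (Λ : ℝ → Y → VG) (t : ℝ) (y : Y) : VE →L[ℝ] VE :=
  X.actLie (lieODE IG (fun u => Λ u y) 0 (clamp t))⁻¹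

variable {X} {Y : Type*} {Λ : ℝ → Y → VG}

omit [LieGroup IE ∞ E] [LieGroup IG ∞ G] [CompleteSpace VE] [CompleteSpace VG]
  [IG.Boundaryless] in
lemma transport_mul_transportInv (t : ℝ) (y : Y) :
    transport X Λ t y * transportInv X Λ t y = 1 := X.actLie_mul_inv _

omit [LieGroup IE ∞ E] [LieGroup IG ∞ G] [CompleteSpace VE] [CompleteSpace VG]
  [IG.Boundaryless] in
lemma transportInv_mul_transport (t : ℝ) (y : Y) :
    transportInv X Λ t y * transport X Λ t y = 1 := X.actLie_inv_mul _

omit [CompleteSpace VE] [LieGroup IE ∞ E] in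
lemma transport_zero {y : Y} (hΛ : Continuous fun t => Λ t y) : transport X Λ 0 y = 1 := by
  have h := (lieODEWellPosed (I := IG) (G := G) hΛ.continuousOn).1.1
  rw [transport, clamp_of_mem (by simp), h, X.actLie_one]

omit [CompleteSpace VE] in
lemma hasDerivWithinAt_transport {y : Y} (hΛ : Continuous fun t => Λ t y) {t : ℝ}
    (ht : t ∈ Icc (0 : ℝ) 1) :
    HasDerivWithinAt (fun t => transport X Λ t y) (transport X Λ t y * X.lieAct (Λ t y))
      (Icc 0 1) t := by
  have h := (lieODEWellPosed (I := IG) (G := G) hΛ.continuousOn).1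
  rw [solvesLieODE_iff] at h
  have h1 := X.hasDerivWithinAt_actLie (h.2 t ht)
  have h2 : transport X Λ t y = X.actLie (lieODE IG (fun u => Λ u y) 0 t) := by
    rw [transport, clamp_of_mem ht]
  rw [h2]
  exact h1.congr (fun u hu => by simp only [transport, clamp_of_mem hu]) h2

omit [CompleteSpace VE] in
lemma continuous_transport [TopologicalSpace Y] (hΛ : Continuous (Function.uncurry Λ)) :
    Continuous (Function.uncurry (transport X Λ)) := by
  have hΛ' (y : Y) : Continuous fun t => Λ t y := continuous_left hΛ y
  have h := continuous_comp_clamp (continuousOn_of_linear_equation (P := transport X Λ)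
    (Λ := fun t y => X.lieAct (Λ t y)) (X.lieAct.continuous.comp hΛ)
    (fun y => transport_zero (hΛ' y)) (fun y t ht => hasDerivWithinAt_transport (hΛ' y) ht))
  refine h.congr fun p => ?_
  simp only [Function.uncurry, transport, clamp_of_mem (clamp_mem _)]

variable {ω₀ ω₀' ω₁ ω₁' : ℝ → ℝ → VG} {μ : ℝ → ℝ → VE}

/-- The derivative of parallel transport in a parameter `y`: if the curvature
`∂ω₁/∂t - ∂ω₀/∂y + [ω₀, ω₁]` is `∂(μ)` and `ω₁` vanishes at `t = 0`, then the only
contribution besides that of the endpoint comes from the integral of the transported `μ`. In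
Duhamel's formula the integrand is the derivative of `P ω₁ P⁻¹ - ∂(∫ P μ)`. -/
lemma hasDerivAt_transport_param
    (hω₀ : Continuous (Function.uncurry ω₀))
    (hω₀' : Continuous (Function.uncurry ω₀')) (hμ : Continuous (Function.uncurry μ))
    (hdω₀ : ∀ t y, HasDerivAt (ω₀ t) (ω₀' t y) y)
    (hdω₁ : ∀ t y, HasDerivAt (fun t => ω₁ t y) (ω₁' t y) t)
    (hcurv : ∀ t y, X.bdLie (μ t y) =
      ω₁' t y - ω₀' t y + lieBracketOf IG G (ω₀ t y) (ω₁ t y))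
    (hbase : ∀ y, ω₁ 0 y = 0) {t : ℝ} (ht : t ∈ Icc (0 : ℝ) 1) (y : ℝ) :
    HasDerivAt (transport X ω₀ t) (transport X ω₀ t y * X.lieAct (ω₁ t y) -
      X.lieAct (X.bdLie (∫ u in (0 : ℝ)..t, transport X ω₀ u y (μ u y))) *
        transport X ω₀ t y) y := by
  have hP := continuous_transport (X := X) hω₀
  have hR : Continuous (Function.uncurry (transportInv X ω₀)) :=
    continuous_of_mul_eq_one (P := Function.uncurry (transport X ω₀))
      (fun p => transport_mul_transportInv _ _) (fun p => transportInv_mul_transport _ _) hP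
  have hcL {f : ℝ → ℝ → VG} (hf : Continuous (Function.uncurry f)) :
      Continuous (Function.uncurry fun t y => X.lieAct (f t y)) := X.lieAct.continuous.comp hf
  have h := hasDerivAt_of_linear_equation (Λ := fun t y => X.lieAct (ω₀ t y))
    (Λ' := fun t y => X.lieAct (ω₀' t y)) (P := transport X ω₀) (R := transportInv X ω₀)
    (hcL hω₀') (fun t _ y => X.lieAct.hasFDerivAt.comp_hasDerivAt y (hdω₀ t y)) hP
    (fun t y => transport_mul_transportInv _ _) (fun t y => transportInv_mul_transport _ _)
    (fun y => transport_zero (continuous_left hω₀ y))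
    (fun y t ht => hasDerivWithinAt_transport (continuous_left hω₀ y) ht) ht y
  refine h.congr_deriv ?_
  have hα : Continuous fun u => transport X ω₀ u y (μ u y) :=
    (continuous_left hP y).clm_apply (continuous_left hμ y)
  have hft := integral_eq_sub_of_hasDerivWithinAt ht
    (f := fun u => transport X ω₀ u y * X.lieAct (ω₁ u y) * transportInv X ω₀ u y -
      X.lieAct (X.bdLie (∫ r in (0 : ℝ)..u, transport X ω₀ r y (μ r y))))
    (f' := fun u => transport X ω₀ u y * X.lieAct (ω₀' u y) * transportInv X ω₀ u y)
    (fun u hu => ?_) (((continuous_left hP y).mul (continuous_left (hcL hω₀') y)).mul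
      (continuous_left hR y)).continuousOn
  · rw [hft]
    simp only [hbase, intervalIntegral.integral_same, map_zero, mul_zero, zero_mul, sub_zero]
    rw [sub_mul, mul_assoc, transportInv_mul_transport, mul_one]
  · have hdP := hasDerivWithinAt_transport (X := X) (continuous_left hω₀ y) hu
    have hdR := hasDerivWithinAt_of_mul_eq_one (P := fun u => transport X ω₀ u y)
      (R := fun u => transportInv X ω₀ u y) (fun u => transport_mul_transportInv _ _)
      (fun u => transportInv_mul_transport _ _) hdP
    have hdω := (X.lieAct.hasFDerivAt.comp_hasDerivAt u (hdω₁ u y)).hasDerivWithinAt (s := Icc 0 1)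
    have hda := ((X.lieAct.comp X.bdLie).hasFDerivAt.comp_hasDerivAt u
      (intervalIntegral.integral_hasDerivAt_right (hα.intervalIntegrable 0 u)
        (hα.stronglyMeasurableAtFilter _ _) hα.continuousAt)).hasDerivWithinAt (s := Icc 0 1)
    refine (((hdP.mul hdω).mul hdR).sub hda).congr_deriv ?_
    have h1 : (X.lieAct.comp X.bdLie) (transport X ω₀ u y (μ u y)) =
        transport X ω₀ u y * X.lieAct (X.bdLie (μ u y)) * transportInv X ω₀ u y :=
      X.lieAct_bdLie_actLie _ _
    rw [h1, hcurv, map_add, map_sub, X.lieAct_lieBracketOf]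
    simp only [Pi.mul_apply, Function.comp_apply]
    noncomm_ring

end Variation

/-! ### Partial derivatives -/

section Cube

variable {W : Type*} [NormedAddCommGroup W] [NormedSpace ℝ W]

/-- The partial derivative of a vector-valued function on `ℝⁿ`. -/
def pderiv {n : ℕ} (i : Fin n) (f : (Fin n → ℝ) → W) (v : Fin n → ℝ) : W :=
  fderiv ℝ f v (Pi.single i 1)

lemma continuous_pderiv {n : ℕ} (i : Fin n) {f : (Fin n → ℝ) → W} (hf : ContDiff ℝ ∞ f) :
    Continuous (pderiv i f) :=
  (hf.continuous_fderiv (by simp)).clm_apply continuous_const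

lemma hasDerivAt_update_pderiv {n : ℕ} (i : Fin n) {f : (Fin n → ℝ) → W} (hf : ContDiff ℝ ∞ f)
    (v : Fin n → ℝ) (r : ℝ) :
    HasDerivAt (fun r => f (Function.update v i r)) (pderiv i f (Function.update v i r)) r :=
  HasFDerivAt.comp_hasDerivAt r (hf.differentiable (by simp) _).hasFDerivAt
    (hasDerivAt_update v i r)

variable {f : (Fin 3 → ℝ) → W} (hf : ContDiff ℝ ∞ f) (t s x : ℝ)
include hf

lemma hasDerivAt_pderiv_zero : HasDerivAt (fun t => f ![t, s, x]) (pderiv 0 f ![t, s, x]) t := by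
  have h (r : ℝ) : Function.update ![0, s, x] 0 r = ![r, s, x] := by
    ext i; fin_cases i <;> simp
  simpa only [h] using hasDerivAt_update_pderiv 0 hf ![0, s, x] t

lemma hasDerivAt_pderiv_one : HasDerivAt (fun s => f ![t, s, x]) (pderiv 1 f ![t, s, x]) s := by
  have h (r : ℝ) : Function.update ![t, 0, x] 1 r = ![t, r, x] := by
    ext i; fin_cases i <;> simp
  simpa only [h] using hasDerivAt_update_pderiv 1 hf ![t, 0, x] s

lemma hasDerivAt_pderiv_two : HasDerivAt (fun x => f ![t, s, x]) (pderiv 2 f ![t, s, x]) x := by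
  have h (r : ℝ) : Function.update ![t, s, 0] 2 r = ![t, s, r] := by
    ext i; fin_cases i <;> simp
  simpa only [h] using hasDerivAt_update_pderiv 2 hf ![t, s, 0] x

end Cube

/-! ### Flat families of forms on the cube -/

section Flat

variable {VE : Type*} [NormedAddCommGroup VE] [NormedSpace ℝ VE]
  {HE : Type*} [TopologicalSpace HE] {IE : ModelWithCorners ℝ VE HE}
  {E : Type*} [TopologicalSpace E] [ChartedSpace HE E] [Group E]
  {VG : Type*} [NormedAddCommGroup VG] [NormedSpace ℝ VG]
  {HG : Type*} [TopologicalSpace HG] {IG : ModelWithCorners ℝ VG HG}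
  {G : Type*} [TopologicalSpace G] [ChartedSpace HG G] [Group G]
  (X : LiePreCrossedModule IE E IG G)
  (η : Fin 3 → (Fin 3 → ℝ) → VG) (μ : Fin 3 → Fin 3 → (Fin 3 → ℝ) → VE)

/-- The parallel transport (acting on `𝔢`) of the form `∑ᵢ ηᵢ dxᵢ` on `ℝ³` along the segment from
`(0, s, x)` to `(t, s, x)`. -/
def frame (t s x : ℝ) : VE →L[ℝ] VE :=
  transport X (fun t (p : ℝ × ℝ) => η 0 ![t, p.1, p.2]) t (s, x)

/-- The integral, over the segment from `(0, s, x)` to `(t, s, x)`, of the transported component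
`μ₀ₖ` of the `2`-form `μ`. -/
def surfaceIntegral (k : Fin 3) (t s x : ℝ) : VE :=
  ∫ u in (0 : ℝ)..t, frame X η u s x (μ 0 k ![u, s, x])

/-- The derivative of `frame` in the `k`-th coordinate. -/
def frameDeriv (k : Fin 3) (t s x : ℝ) : VE →L[ℝ] VE :=
  frame X η t s x * X.lieAct (η k ![t, s, x]) -
    X.lieAct (X.bdLie (surfaceIntegral X η μ k t s x)) * frame X η t s x

/-- The components `ηᵢ` of a `𝔤`-valued `1`-form and `μᵢⱼ` of an `𝔢`-valued `2`-form on `ℝ³`, with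
`∂(μ)` the curvature of `η`, such that on the cube the covariant exterior derivative of `μ`
vanishes, and such that `μ` vanishes on vectors tangent to the faces `t = 0` and `t = 1`, and
`η` on those tangent to the face `t = 0`. -/
structure IsFlatFamily : Prop where
  smooth_one : ∀ i, ContDiff ℝ ∞ (η i)
  smooth_two : ∀ i j, ContDiff ℝ ∞ (μ i j)
  curvature : ∀ i j v, X.bdLie (μ i j v) =
    pderiv i (η j) v - pderiv j (η i) v + lieBracketOf IG G (η i v) (η j v)
  base_one : ∀ s x, η 1 ![0, s, x] = 0 ∧ η 2 ![0, s, x] = 0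
  base_two : ∀ s x, μ 1 2 ![0, s, x] = 0 ∧ μ 1 2 ![1, s, x] = 0
  closed : ∀ v ∈ cube 3, pderiv 0 (μ 1 2) v - pderiv 1 (μ 0 2) v + pderiv 2 (μ 0 1) v +
    X.lieAct (η 0 v) (μ 1 2 v) - X.lieAct (η 1 v) (μ 0 2 v) + X.lieAct (η 2 v) (μ 0 1 v) = 0

lemma vec3_mem_cube {t s x : ℝ} (ht : t ∈ Icc (0 : ℝ) 1) (hs : s ∈ Icc (0 : ℝ) 1)
    (hx : x ∈ Icc (0 : ℝ) 1) : ![t, s, x] ∈ cube 3 := by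
  constructor <;> intro i <;> fin_cases i <;> simp [ht.1, hs.1, hx.1, ht.2, hs.2, hx.2]

namespace IsFlatFamily

variable {X η μ} [LieGroup IE ∞ E] [LieGroup IG ∞ G] [IG.Boundaryless]
  [CompleteSpace VE] [CompleteSpace VG]

omit [CompleteSpace VE] in
lemma continuous_frame (h : IsFlatFamily X η μ) :
    Continuous fun p : ℝ × ℝ × ℝ => frame X η p.1 p.2.1 p.2.2 := by
  have h1 : Continuous (Function.uncurry fun t (p : ℝ × ℝ) => η 0 ![t, p.1, p.2]) :=
    (h.smooth_one 0).continuous.comp (by fun_prop : Continuous fun p : ℝ × ℝ × ℝ =>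
      ![p.1, p.2.1, p.2.2])
  exact continuous_transport h1

omit [CompleteSpace VE] in
lemma continuous_integrand (h : IsFlatFamily X η μ) (k : Fin 3) :
    Continuous fun p : ℝ × ℝ × ℝ =>
      frame X η p.1 p.2.1 p.2.2 (μ 0 k ![p.1, p.2.1, p.2.2]) :=
  h.continuous_frame.clm_apply ((h.smooth_two 0 k).continuous.comp
    (by fun_prop : Continuous fun p : ℝ × ℝ × ℝ => ![p.1, p.2.1, p.2.2]))

omit [CompleteSpace VE] in
lemma continuous_surfaceIntegral (h : IsFlatFamily X η μ) (k : Fin 3) :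
    Continuous fun p : ℝ × ℝ × ℝ => surfaceIntegral X η μ k p.1 p.2.1 p.2.2 := by
  have h1 : Continuous (Function.uncurry fun (p : ℝ × ℝ × ℝ) u =>
      frame X η u p.2.1 p.2.2 (μ 0 k ![u, p.2.1, p.2.2])) :=
    (h.continuous_integrand k).comp (by fun_prop : Continuous fun p : (ℝ × ℝ × ℝ) × ℝ =>
      (p.2, p.1.2.1, p.1.2.2))
  exact intervalIntegral.continuous_parametric_intervalIntegral_of_continuous h1 continuous_fst

omit [CompleteSpace VE] in
lemma continuous_frameDeriv (h : IsFlatFamily X η μ) (k : Fin 3) :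
    Continuous fun p : ℝ × ℝ × ℝ => frameDeriv X η μ k p.1 p.2.1 p.2.2 :=
  (h.continuous_frame.mul (X.lieAct.continuous.comp ((h.smooth_one k).continuous.comp
    (by fun_prop : Continuous fun p : ℝ × ℝ × ℝ => ![p.1, p.2.1, p.2.2])))).sub
    ((X.lieAct.continuous.comp (X.bdLie.continuous.comp (h.continuous_surfaceIntegral k))).mul
      h.continuous_frame)

lemma continuous_vec3_left {W : Type*} [TopologicalSpace W] {f : (Fin 3 → ℝ) → W}
    (hf : Continuous f) (x : ℝ) : Continuous (Function.uncurry fun t s => f ![t, s, x]) :=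
  hf.comp (by fun_prop : Continuous fun p : ℝ × ℝ => ![p.1, p.2, x])

lemma continuous_vec3_right {W : Type*} [TopologicalSpace W] {f : (Fin 3 → ℝ) → W}
    (hf : Continuous f) (s : ℝ) : Continuous (Function.uncurry fun t x => f ![t, s, x]) :=
  hf.comp (by fun_prop : Continuous fun p : ℝ × ℝ => ![p.1, s, p.2])

lemma hasDerivAt_frame_one (h : IsFlatFamily X η μ) {t : ℝ} (ht : t ∈ Icc (0 : ℝ) 1) (s x : ℝ) :
    HasDerivAt (fun s => frame X η t s x) (frameDeriv X η μ 1 t s x) s :=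
  hasDerivAt_transport_param (X := X) (ω₀ := fun t s => η 0 ![t, s, x])
    (ω₀' := fun t s => pderiv 1 (η 0) ![t, s, x]) (ω₁ := fun t s => η 1 ![t, s, x])
    (ω₁' := fun t s => pderiv 0 (η 1) ![t, s, x]) (μ := fun t s => μ 0 1 ![t, s, x])
    (continuous_vec3_left (h.smooth_one 0).continuous x)
    (continuous_vec3_left (continuous_pderiv 1 (h.smooth_one 0)) x)
    (continuous_vec3_left (h.smooth_two 0 1).continuous x)
    (fun t s => hasDerivAt_pderiv_one (h.smooth_one 0) t s x)
    (fun t s => hasDerivAt_pderiv_zero (h.smooth_one 1) t s x)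
    (fun _ _ => h.curvature 0 1 _) (fun s => (h.base_one s x).1) ht s

lemma hasDerivAt_frame_two (h : IsFlatFamily X η μ) {t : ℝ} (ht : t ∈ Icc (0 : ℝ) 1) (s x : ℝ) :
    HasDerivAt (fun x => frame X η t s x) (frameDeriv X η μ 2 t s x) x :=
  hasDerivAt_transport_param (X := X) (ω₀ := fun t x => η 0 ![t, s, x])
    (ω₀' := fun t x => pderiv 2 (η 0) ![t, s, x]) (ω₁ := fun t x => η 2 ![t, s, x])
    (ω₁' := fun t x => pderiv 0 (η 2) ![t, s, x]) (μ := fun t x => μ 0 2 ![t, s, x])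
    (continuous_vec3_right (h.smooth_one 0).continuous s)
    (continuous_vec3_right (continuous_pderiv 2 (h.smooth_one 0)) s)
    (continuous_vec3_right (h.smooth_two 0 2).continuous s)
    (fun t x => hasDerivAt_pderiv_two (h.smooth_one 0) t s x)
    (fun t x => hasDerivAt_pderiv_zero (h.smooth_one 2) t s x)
    (fun _ _ => h.curvature 0 2 _) (fun x => (h.base_one s x).2) ht x

/-- The derivative in the `j`-th coordinate of the integrand of `surfaceIntegral X η μ k`. -/
def integrandDeriv (X : LiePreCrossedModule IE E IG G) (η : Fin 3 → (Fin 3 → ℝ) → VG)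
    (μ : Fin 3 → Fin 3 → (Fin 3 → ℝ) → VE) (j k : Fin 3) (t s x : ℝ) : VE :=
  frameDeriv X η μ j t s x (μ 0 k ![t, s, x]) + frame X η t s x (pderiv j (μ 0 k) ![t, s, x])

omit [CompleteSpace VE] in
lemma continuous_integrandDeriv (h : IsFlatFamily X η μ) (j k : Fin 3) :
    Continuous fun p : ℝ × ℝ × ℝ => integrandDeriv X η μ j k p.1 p.2.1 p.2.2 := by
  have hv : Continuous fun p : ℝ × ℝ × ℝ => ![p.1, p.2.1, p.2.2] := by fun_prop
  exact ((h.continuous_frameDeriv j).clm_apply ((h.smooth_two 0 k).continuous.comp hv)).add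
    (h.continuous_frame.clm_apply ((continuous_pderiv j (h.smooth_two 0 k)).comp hv))

lemma hasDerivAt_surfaceIntegral_two (h : IsFlatFamily X η μ) (k : Fin 3) (s x : ℝ) :
    HasDerivAt (fun x => surfaceIntegral X η μ k 1 s x)
      (∫ t in (0 : ℝ)..1, integrandDeriv X η μ 2 k t s x) x := by
  have h1 : Continuous (Function.uncurry fun t x => frame X η t s x (μ 0 k ![t, s, x])) :=
    (h.continuous_integrand k).comp₃ continuous_fst continuous_const continuous_snd
  have h2 : Continuous (Function.uncurry fun t x => integrandDeriv X η μ 2 k t s x) :=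
    (h.continuous_integrandDeriv 2 k).comp₃ continuous_fst continuous_const continuous_snd
  have h3 (t : ℝ) (ht : t ∈ Icc (0 : ℝ) 1) (x : ℝ) :
      HasDerivAt (fun x => frame X η t s x (μ 0 k ![t, s, x]))
        (integrandDeriv X η μ 2 k t s x) x :=
    (h.hasDerivAt_frame_two ht s x).clm_apply
      (hasDerivAt_pderiv_two (h.smooth_two 0 k) t s x)
  exact hasDerivAt_integral_of_continuous h1 h2 (by simp) x h3

lemma hasDerivAt_surfaceIntegral_one (h : IsFlatFamily X η μ) (k : Fin 3) (s x : ℝ) :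
    HasDerivAt (fun s => surfaceIntegral X η μ k 1 s x)
      (∫ t in (0 : ℝ)..1, integrandDeriv X η μ 1 k t s x) s := by
  have h1 : Continuous (Function.uncurry fun t s => frame X η t s x (μ 0 k ![t, s, x])) :=
    (h.continuous_integrand k).comp₃ continuous_fst continuous_snd continuous_const
  have h2 : Continuous (Function.uncurry fun t s => integrandDeriv X η μ 1 k t s x) :=
    (h.continuous_integrandDeriv 1 k).comp₃ continuous_fst continuous_snd continuous_const
  have h3 (t : ℝ) (ht : t ∈ Icc (0 : ℝ) 1) (s : ℝ) :
      HasDerivAt (fun s => frame X η t s x (μ 0 k ![t, s, x]))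
        (integrandDeriv X η μ 1 k t s x) s :=
    (h.hasDerivAt_frame_one ht s x).clm_apply
      (hasDerivAt_pderiv_one (h.smooth_two 0 k) t s x)
  exact hasDerivAt_integral_of_continuous h1 h2 (by simp) s h3

/-- The difference of the derivatives of the two transported components `μ₀₁` and `μ₀₂`, up to a
derivative in `t`. Its integral over `t ∈ [0,1]` is to be compared with the bracket of the two
surface integrals. -/
def defect (X : LiePreCrossedModule IE E IG G) (η : Fin 3 → (Fin 3 → ℝ) → VG)
    (μ : Fin 3 → Fin 3 → (Fin 3 → ℝ) → VE) (t s x : ℝ) : VE :=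
  X.lieAct (X.bdLie (surfaceIntegral X η μ 1 t s x)) (frame X η t s x (μ 0 2 ![t, s, x])) -
    X.lieAct (X.bdLie (surfaceIntegral X η μ 2 t s x)) (frame X η t s x (μ 0 1 ![t, s, x]))

omit [CompleteSpace VE] in
lemma continuous_defect (h : IsFlatFamily X η μ) :
    Continuous fun p : ℝ × ℝ × ℝ => defect X η μ p.1 p.2.1 p.2.2 := by
  have hL (k : Fin 3) := X.lieAct.continuous.comp
    (X.bdLie.continuous.comp (h.continuous_surfaceIntegral k))
  exact ((hL 1).clm_apply (h.continuous_integrand 2)).sub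
    ((hL 2).clm_apply (h.continuous_integrand 1))

omit [CompleteSpace VE] in
lemma hasDerivWithinAt_frame (h : IsFlatFamily X η μ) {t : ℝ} (ht : t ∈ Icc (0 : ℝ) 1) (s x : ℝ) :
    HasDerivWithinAt (fun t => frame X η t s x)
      (frame X η t s x * X.lieAct (η 0 ![t, s, x])) (Icc 0 1) t :=
  hasDerivWithinAt_transport (Λ := fun t (p : ℝ × ℝ) => η 0 ![t, p.1, p.2])
    ((h.smooth_one 0).continuous.comp (by fun_prop : Continuous fun t : ℝ => ![t, s, x])) ht

/-- The derivatives of the two surface integrals differ by the integral of the defect: by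
closedness, the remaining terms are the derivative in `t` of the transported `μ₁₂`, which vanishes
at both ends. -/
lemma integral_integrandDeriv (h : IsFlatFamily X η μ) {s x : ℝ} (hs : s ∈ Icc (0 : ℝ) 1)
    (hx : x ∈ Icc (0 : ℝ) 1) :
    ∫ t in (0 : ℝ)..1, integrandDeriv X η μ 2 1 t s x =
      (∫ t in (0 : ℝ)..1, integrandDeriv X η μ 1 2 t s x) +
        ∫ t in (0 : ℝ)..1, defect X η μ t s x := by
  have hv : Continuous fun t : ℝ => (t, s, x) := by fun_prop
  have hv' : Continuous fun t : ℝ => ![t, s, x] := by fun_prop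
  have c21 := (h.continuous_integrandDeriv 2 1).comp hv
  have c12 := (h.continuous_integrandDeriv 1 2).comp hv
  have cd := h.continuous_defect.comp hv
  -- the derivative in `t` of the transported `μ₁₂`
  let q (t : ℝ) : VE := frame X η t s x
    (X.lieAct (η 0 ![t, s, x]) (μ 1 2 ![t, s, x]) + pderiv 0 (μ 1 2) ![t, s, x])
  have hq : Continuous q := (h.continuous_frame.comp hv).clm_apply
    (((X.lieAct.continuous.comp ((h.smooth_one 0).continuous.comp hv')).clm_apply
      ((h.smooth_two 1 2).continuous.comp hv')).add
      ((continuous_pderiv 0 (h.smooth_two 1 2)).comp hv'))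
  have h1 : ∫ t in (0 : ℝ)..1, q t = 0 := by
    rw [integral_eq_sub_of_hasDerivWithinAt (t := 1) (by simp)
      (f := fun t => frame X η t s x (μ 1 2 ![t, s, x])) (fun t ht => ?_) hq.continuousOn]
    · simp [(h.base_two s x).1, (h.base_two s x).2]
    · refine ((h.hasDerivWithinAt_frame ht s x).clm_apply
        (hasDerivAt_pderiv_zero (h.smooth_two 1 2) t s x).hasDerivWithinAt).congr_deriv ?_
      simp [q]
  have h2 : EqOn (fun t => integrandDeriv X η μ 2 1 t s x)
      (fun t => integrandDeriv X η μ 1 2 t s x + defect X η μ t s x - q t) (uIcc 0 1) := by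
    intro t ht
    rw [uIcc_of_le zero_le_one] at ht
    have h3 := congrArg (frame X η t s x) (h.closed _ (vec3_mem_cube ht hs hx))
    simp only [map_add, map_sub, map_zero] at h3
    simp only [integrandDeriv, defect, frameDeriv, q, sub_apply, mul_apply_eq_comp,
      map_add]
    rw [← sub_eq_zero] at h3 ⊢
    rw [← h3]
    abel
  rw [intervalIntegral.integral_congr h2, intervalIntegral.integral_sub, h1,
    intervalIntegral.integral_add, sub_zero]
  · exact c12.intervalIntegrable _ _
  · exact cd.intervalIntegrable _ _
  · exact (c12.add cd).intervalIntegrable _ _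
  · exact hq.intervalIntegrable _ _

lemma hasDerivAt_surfaceIntegral_zero (h : IsFlatFamily X η μ) (k : Fin 3) (t s x : ℝ) :
    HasDerivAt (fun t => surfaceIntegral X η μ k t s x) (frame X η t s x (μ 0 k ![t, s, x])) t := by
  have hc : Continuous fun t => frame X η t s x (μ 0 k ![t, s, x]) :=
    (h.continuous_integrand k).comp₃ continuous_id continuous_const continuous_const
  have h1 := intervalIntegral.integral_hasDerivAt_right (hc.intervalIntegrable 0 t)
    (hc.stronglyMeasurableAtFilter _ _) hc.continuousAt
  exact h1

/-- In a crossed module `𝔢` acts on itself through `∂` by the bracket, and the defect is the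
derivative of a bracket of surface integrals. -/
lemma integral_defect_of_isCrossedModule [IE.Boundaryless] (h : IsFlatFamily X η μ)
    (hX : X.IsCrossedModule) (s x : ℝ) :
    ∫ t in (0 : ℝ)..1, defect X η μ t s x = (conjModule IE E).lieAct
      (surfaceIntegral X η μ 1 1 s x) (surfaceIntegral X η μ 2 1 s x) := by
  have hskew (u v : VE) : (conjModule IE E).lieAct u v = -(conjModule IE E).lieAct v u := by
    have h1 := lieAct_conjModule_self (IE := IE) (E := E) (u + v)
    simp only [map_add, add_apply, lieAct_conjModule_self, zero_add, add_zero] at h1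
    exact eq_neg_of_add_eq_zero_right h1
  have hd : Continuous fun t => defect X η μ t s x :=
    h.continuous_defect.comp₃ continuous_id continuous_const continuous_const
  rw [integral_eq_sub_of_hasDerivWithinAt (t := 1) (by simp)
    (f := fun t => (conjModule IE E).lieAct (surfaceIntegral X η μ 1 t s x)
      (surfaceIntegral X η μ 2 t s x)) (fun t _ => ?_)
    hd.continuousOn]
  · simp [surfaceIntegral]
  · refine ((((conjModule IE E).lieAct.hasFDerivAt.comp_hasDerivAt t
      (h.hasDerivAt_surfaceIntegral_zero 1 t s x)).clm_apply
      (h.hasDerivAt_surfaceIntegral_zero 2 t s x)).hasDerivWithinAt).congr_deriv ?_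
    simp only [defect, ← hX.lieAct_conjModule, Function.comp_apply]
    rw [hskew (frame X η t s x (μ 0 1 ![t, s, x]))]
    abel

omit [LieGroup IE ∞ E] [LieGroup IG ∞ G] [IG.Boundaryless] [CompleteSpace VE]
  [CompleteSpace VG] in
lemma surfaceIntegral_eq_smul {j k : Fin 3} {c s x : ℝ}
    (hc : ∀ t ∈ Icc (0 : ℝ) 1, μ 0 k ![t, s, x] = c • μ 0 j ![t, s, x]) {t : ℝ}
    (ht : t ∈ Icc (0 : ℝ) 1) :
    surfaceIntegral X η μ k t s x = c • surfaceIntegral X η μ j t s x := by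
  unfold surfaceIntegral
  rw [← intervalIntegral.integral_smul]
  refine intervalIntegral.integral_congr fun u hu => ?_
  rw [uIcc_of_le ht.1] at hu
  simp only [hc u ⟨hu.1, hu.2.trans ht.2⟩, map_smul]

omit [LieGroup IG ∞ G] [IG.Boundaryless] [CompleteSpace VE] [CompleteSpace VG] in
/-- If the components `μ₀₁` and `μ₀₂` are proportional along a segment, then so are their surface
integrals, with the same constant. Both the defect and the bracket of the surface integrals then
vanish. -/
lemma integral_defect_of_proportional [IE.Boundaryless] {s x : ℝ}
    (hc : (∃ c : ℝ, ∀ t ∈ Icc (0 : ℝ) 1, μ 0 1 ![t, s, x] = c • μ 0 2 ![t, s, x]) ∨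
      ∃ c : ℝ, ∀ t ∈ Icc (0 : ℝ) 1, μ 0 2 ![t, s, x] = c • μ 0 1 ![t, s, x]) :
    ∫ t in (0 : ℝ)..1, defect X η μ t s x = (conjModule IE E).lieAct
      (surfaceIntegral X η μ 1 1 s x) (surfaceIntegral X η μ 2 1 s x) := by
  have h0 : EqOn (fun t => defect X η μ t s x) (fun _ => 0) (uIcc 0 1) := by
    intro t ht
    rw [uIcc_of_le zero_le_one] at ht
    obtain ⟨c, hc⟩ | ⟨c, hc⟩ := hc <;>
    simp [defect, surfaceIntegral_eq_smul hc ht, hc t ht]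
  rw [intervalIntegral.integral_congr h0]
  obtain ⟨c, hc⟩ | ⟨c, hc⟩ := hc <;>
  simp [surfaceIntegral_eq_smul (X := X) (η := η) hc (t := 1) (by simp), lieAct_conjModule_self]

omit [NormedSpace ℝ VE] [CompleteSpace VE] in
/-- If the identity of the two functions holds almost everywhere on the open square, it holds on
the closed square. -/
lemma eqOn_square_of_ae {f g : ℝ × ℝ → VE} (hf : Continuous f) (hg : Continuous g)
    (h : ∀ᵐ p : ℝ × ℝ, p.1 ∈ Ioo (0 : ℝ) 1 → p.2 ∈ Ioo (0 : ℝ) 1 → f p = g p) :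
    EqOn f g (Icc 0 1 ×ˢ Icc 0 1) := by
  have h1 : EqOn f g (Ioo (0 : ℝ) 1 ×ˢ Ioo 0 1) := by
    refine MeasureTheory.Measure.eqOn_open_of_ae_eq (μ := MeasureTheory.volume) ?_
      (isOpen_Ioo.prod isOpen_Ioo) hf.continuousOn hg.continuousOn
    rw [Filter.EventuallyEq,
      MeasureTheory.ae_restrict_iff' (measurableSet_Ioo.prod measurableSet_Ioo)]
    filter_upwards [h] with p hp hmem using hp hmem.1 hmem.2
  have h2 := h1.closure hf hg
  rwa [closure_prod_eq, closure_Ioo zero_ne_one] at h2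

/-- For a flat family whose `2`-form vanishes on the faces `s = 0` and `s = 1`, and whose two
transported components are almost everywhere proportional (or arbitrary, in a crossed module),
the two surface integrals are the components of a flat connection, and the holonomies at `x = 0` and
`x = 1` agree. -/
theorem lieODE_surfaceIntegral_eq [IE.Boundaryless]
    (h : IsFlatFamily X η μ)
    (hface : ∀ t ∈ Icc (0 : ℝ) 1, ∀ x ∈ Icc (0 : ℝ) 1,
      μ 0 2 ![t, 0, x] = 0 ∧ μ 0 2 ![t, 1, x] = 0)
    (hthin : X.IsCrossedModule ∨ ∀ᵐ p : ℝ × ℝ, p.1 ∈ Ioo (0 : ℝ) 1 → p.2 ∈ Ioo (0 : ℝ) 1 →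
      (∃ c : ℝ, ∀ t ∈ Icc (0 : ℝ) 1, μ 0 1 ![t, p.1, p.2] = c • μ 0 2 ![t, p.1, p.2]) ∨
      ∃ c : ℝ, ∀ t ∈ Icc (0 : ℝ) 1, μ 0 2 ![t, p.1, p.2] = c • μ 0 1 ![t, p.1, p.2]) :
    lieODE (G := E) IE (fun s => surfaceIntegral X η μ 1 1 s 0) 0 1 =
      lieODE IE (fun s => surfaceIntegral X η μ 1 1 s 1) 0 1 := by
  have hS (k : Fin 3) : Continuous fun p : ℝ × ℝ => surfaceIntegral X η μ k 1 p.1 p.2 :=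
    (h.continuous_surfaceIntegral k).comp₃ continuous_const continuous_fst continuous_snd
  have hcI {f : ℝ → ℝ → ℝ → VE} (hf : Continuous fun p : ℝ × ℝ × ℝ => f p.1 p.2.1 p.2.2) :
      Continuous fun p : ℝ × ℝ => ∫ t in (0 : ℝ)..1, f t p.1 p.2 :=
    intervalIntegral.continuous_parametric_intervalIntegral_of_continuous'
      (f := fun (p : ℝ × ℝ) t => f t p.1 p.2)
      (hf.comp (by fun_prop : Continuous fun p : (ℝ × ℝ) × ℝ => (p.2, p.1.1, p.1.2))) 0 1
  have hflat : EqOn (fun p : ℝ × ℝ => ∫ t in (0 : ℝ)..1, defect X η μ t p.1 p.2)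
      (fun p => (conjModule IE E).lieAct (surfaceIntegral X η μ 1 1 p.1 p.2)
        (surfaceIntegral X η μ 2 1 p.1 p.2)) (Icc 0 1 ×ˢ Icc 0 1) := by
    obtain hX | hae := hthin
    · exact fun p _ => h.integral_defect_of_isCrossedModule hX _ _
    · refine eqOn_square_of_ae (hcI h.continuous_defect)
        (((conjModule IE E).lieAct.continuous.comp
          (hS 1)).clm_apply (hS 2)) ?_
      filter_upwards [hae] with p hp h1 h2
      exact integral_defect_of_proportional (hp h1 h2)
  have hB (c x : ℝ) (hc : ∀ t ∈ Icc (0 : ℝ) 1, μ 0 2 ![t, c, x] = 0) :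
      surfaceIntegral X η μ 2 1 c x = 0 := by
    have := surfaceIntegral_eq_smul (X := X) (η := η) (μ := μ) (j := 2) (k := 2)
      (c := 0) (s := c) (x := x) (fun t ht => by simp [hc t ht]) (t := 1) (by simp)
    simpa using this
  have hA : Continuous (Function.uncurry fun s x => surfaceIntegral X η μ 1 1 s x) :=
    hS 1
  have hA' : Continuous (Function.uncurry fun s x =>
      ∫ t in (0 : ℝ)..1, integrandDeriv X η μ 2 1 t s x) := hcI (h.continuous_integrandDeriv 2 1)
  have hB' (x : ℝ) (_ : x ∈ Icc (0 : ℝ) 1) (s : ℝ) (_ : s ∈ Icc (0 : ℝ) 1) :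
      HasDerivWithinAt (fun s => surfaceIntegral X η μ 2 1 s x)
        (∫ t in (0 : ℝ)..1, integrandDeriv X η μ 1 2 t s x) (Icc 0 1) s :=
    (h.hasDerivAt_surfaceIntegral_one 2 s x).hasDerivWithinAt
  have hcurv (x : ℝ) (hx : x ∈ Icc (0 : ℝ) 1) (s : ℝ) (hs : s ∈ Icc (0 : ℝ) 1) :
      ∫ t in (0 : ℝ)..1, integrandDeriv X η μ 2 1 t s x =
        (∫ t in (0 : ℝ)..1, integrandDeriv X η μ 1 2 t s x) + (conjModule IE E).lieAct
          (surfaceIntegral X η μ 1 1 s x) (surfaceIntegral X η μ 2 1 s x) := by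
    rw [h.integral_integrandDeriv hs hx]
    exact congrArg _ (hflat (x := (s, x)) ⟨hs, hx⟩)
  exact lieODE_endpoint_eq (A := fun s x => surfaceIntegral X η μ 1 1 s x)
    (A' := fun s x => ∫ t in (0 : ℝ)..1, integrandDeriv X η μ 2 1 t s x)
    (B := fun s x => surfaceIntegral X η μ 2 1 s x)
    (B' := fun s x => ∫ t in (0 : ℝ)..1, integrandDeriv X η μ 1 2 t s x) hA hA'
    (fun s _ x => h.hasDerivAt_surfaceIntegral_two 1 s x) hB'
    (fun x hx => hB 0 x fun t ht => (hface t ht x hx).1)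
    (fun x hx => hB 1 x fun t ht => (hface t ht x hx).2) hcurv

end IsFlatFamily

end Flat

/-! ### Pull-back of differential forms to a vector space -/

section Alternating

variable {Z V W : Type*} [NormedAddCommGroup Z] [NormedSpace ℝ Z] [NormedAddCommGroup V]
  [NormedSpace ℝ V] [NormedAddCommGroup W] [NormedSpace ℝ W]

/-- Evaluation of a continuous alternating map on vectors is a smooth operation, by induction on the
degree through `curryLeft`. -/
lemma contDiffAt_alternating_apply {r : WithTop ℕ∞} {z : Z} {n : ℕ}
    {F : Z → V [⋀^Fin n]→L[ℝ] W} {u : Fin n → Z → V} (hF : ContDiffAt ℝ r F z)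
    (hu : ∀ i, ContDiffAt ℝ r (u i) z) : ContDiffAt ℝ r (fun z => F z fun i => u i z) z := by
  induction n with
  | zero =>
    have h : (fun z => F z fun i => u i z) =
        fun z => ContinuousAlternatingMap.apply ℝ V W ![] (F z) := by
      ext z
      exact congrArg (F z) (Subsingleton.elim _ _)
    rw [h]
    exact (ContinuousAlternatingMap.apply ℝ V W ![]).contDiff.contDiffAt.comp z hF
  | succ n ih =>
    have hL : ContDiff ℝ r (fun f : V [⋀^Fin (n + 1)]→L[ℝ] W => f.curryLeft) :=
      LinearIsometry.contDiff (𝕜 := ℝ) (E := V [⋀^Fin (n + 1)]→L[ℝ] W)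
        (F := V →L[ℝ] V [⋀^Fin n]→L[ℝ] W) (n := r) ContinuousAlternatingMap.curryLeftLI
    have h0 : ContDiffAt ℝ r (fun z => (F z).curryLeft) z := hL.contDiffAt.comp z hF
    have h1 : ContDiffAt ℝ r (fun z => (F z).curryLeft (u 0 z)) z := h0.clm_apply (hu 0)
    refine (ih h1 fun i => hu i.succ).congr_of_eventuallyEq (Eventually.of_forall fun z => ?_)
    simp only [ContinuousAlternatingMap.curryLeft_apply_apply]
    congr 1
    ext i
    cases i using Fin.cases <;> rfl

end Alternating

section Pull

variable {VM : Type*} [NormedAddCommGroup VM] [NormedSpace ℝ VM]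
  {HM : Type*} [TopologicalSpace HM] {IM : ModelWithCorners ℝ VM HM}
  {M : Type*} [TopologicalSpace M] [ChartedSpace HM M]
  {n : ℕ} {V W : Type*} [NormedAddCommGroup V] [NormedSpace ℝ V]
  [NormedAddCommGroup W] [NormedSpace ℝ W]

/-- The pull-back of a differential form along a map `K` from a vector space. -/
def DiffForm.pull (w : DiffForm IM M n W) (K : V → M) (v : V) : V [⋀^Fin n]→L[ℝ] W :=
  ContinuousAlternatingMap.compContinuousLinearMap (M := VM) (w (K v)) (tderiv 𝓘(ℝ, V) IM K v)

variable [IM.Boundaryless] [IsManifold IM ∞ M]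

/-- Around `v₀`, the pull-back is that of the form read in the chart at `K v₀`. -/
lemma DiffForm.pull_eventuallyEq (w : DiffForm IM M n W) {K : V → M}
    (hK : ContMDiff 𝓘(ℝ, V) IM ∞ K) (v₀ : V) :
    w.pull K =ᶠ[𝓝 v₀] fun v =>
      (w.inChart (K v₀) (extChartAt IM (K v₀) (K v))).compContinuousLinearMap
      (fderiv ℝ (extChartAt IM (K v₀) ∘ K) v) := by
  have : IsManifold IM 1 M := IsManifold.of_le (n := ∞) (by simp)
  have hsrc : ∀ᶠ v in 𝓝 v₀, K v ∈ (extChartAt IM (K v₀)).source :=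
    hK.continuous.continuousAt.eventually (extChartAt_source_mem_nhds _)
  filter_upwards [hsrc] with v hv
  set φ := extChartAt IM (K v₀) with hφ
  have h1 : φ.symm (φ (K v)) = K v := φ.left_inv hv
  have h2 : fderiv ℝ (φ ∘ K) v =
      (tderiv IM 𝓘(ℝ, VM) φ (K v)).comp (tderiv 𝓘(ℝ, V) IM K v) := by
    rw [← tderiv_eq_fderiv]
    exact tderiv_comp ((contMDiffAt_extChartAt_of_mem hv).mdifferentiableAt (by simp))
      (hK.mdifferentiable (by simp) v)
  have h3 := tderiv_symm_comp_extChartAt (I := IM) (φ.map_source hv)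
  rw [← hφ, h1] at h3
  let w' : M → VM [⋀^Fin n]→L[ℝ] W := w
  have h4 : w' (φ.symm (φ (K v))) = w' (K v) := congrArg w' h1
  show (w' (K v)).compContinuousLinearMap (tderiv 𝓘(ℝ, V) IM K v) =
    ((w' (φ.symm (φ (K v)))).compContinuousLinearMap
      (tderiv 𝓘(ℝ, VM) IM φ.symm (φ (K v)))).compContinuousLinearMap _
  rw [h2, h4]
  ext u
  simp only [ContinuousAlternatingMap.compContinuousLinearMap_apply]
  congr 1
  ext i
  exact (congrArg (fun L => L (tderiv 𝓘(ℝ, V) IM K v (u i))) h3).symm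

section

variable {w : DiffForm IM M n W} (hw : w.IsSmooth) {K : V → M} (hK : ContMDiff 𝓘(ℝ, V) IM ∞ K)
include hw hK

lemma DiffForm.IsSmooth.contDiffAt_inChart_comp (v : V) :
    ContDiffAt ℝ ∞ (w.inChart (K v)) (extChartAt IM (K v) (K v)) ∧
      ContDiffAt ℝ ∞ (extChartAt IM (K v) ∘ K) v := by
  refine ⟨(hw (K v)).contDiffAt
    ((isOpen_extChartAt_target _).mem_nhds (mem_extChartAt_target _)), ?_⟩
  rw [← contMDiffAt_iff_contDiffAt]
  exact (contMDiffAt_extChartAt_of_mem (mem_extChartAt_source _)).comp v hK.contMDiffAt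

lemma DiffForm.IsSmooth.contDiff_pull_apply (u : Fin n → V) :
    ContDiff ℝ ∞ fun v => w.pull K v u := by
  rw [contDiff_iff_contDiffAt]
  intro v
  obtain ⟨h1, h2⟩ := hw.contDiffAt_inChart_comp hK v
  refine (contDiffAt_alternating_apply (h1.comp v h2) (u := fun i z =>
    fderiv ℝ (extChartAt IM (K v) ∘ K) z (u i)) fun i => ?_).congr_of_eventuallyEq ?_
  · exact (h2.fderiv_right (m := ∞) (by simp)).clm_apply contDiffAt_const
  · filter_upwards [w.pull_eventuallyEq hK v] with z hz
    rw [hz]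
    rfl

lemma DiffForm.IsSmooth.differentiableAt_pull (v : V) : DifferentiableAt ℝ (w.pull K) v := by
  obtain ⟨h1, h2⟩ := hw.contDiffAt_inChart_comp hK v
  refine DifferentiableAt.congr_of_eventuallyEq ?_ (w.pull_eventuallyEq hK v)
  exact ((h1.comp v h2).differentiableAt
    (by simp)).continuousAlternatingMapCompContinuousLinearMap
    ((h2.fderiv_right (m := ∞) (by simp)).differentiableAt (by simp))

/-- The exterior derivative commutes with pull-backs. -/
lemma DiffForm.IsSmooth.extDeriv_pull (v : V) : extDeriv (w.pull K) v = w.d.pull K v := by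
  have : IsManifold IM 1 M := IsManifold.of_le (n := ∞) (by simp)
  obtain ⟨h1, h2⟩ := hw.contDiffAt_inChart_comp hK v
  have h3 : fderiv ℝ (extChartAt IM (K v) ∘ K) v =
      (tderiv IM 𝓘(ℝ, VM) (extChartAt IM (K v)) (K v)).comp (tderiv 𝓘(ℝ, V) IM K v) := by
    rw [← tderiv_eq_fderiv]
    exact tderiv_comp ((contMDiffAt_extChartAt_of_mem
      (mem_extChartAt_source _)).mdifferentiableAt (by simp)) (hK.mdifferentiable (by simp) v)
  have h4 := extDeriv_pullback (f := extChartAt IM (K v) ∘ K) (h1.differentiableAt (by simp)) h2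
    (by rw [minSmoothness_of_isRCLikeNormedField]; exact ENat.LEInfty.out)
  rw [(w.pull_eventuallyEq hK v).extDeriv_eq]
  refine h4.trans ?_
  rw [h3]
  rfl

end

end Pull

section Flatness

variable {VM : Type*} [NormedAddCommGroup VM] [NormedSpace ℝ VM]
  {HM : Type*} [TopologicalSpace HM] {IM : ModelWithCorners ℝ VM HM}
  {M : Type*} [TopologicalSpace M] [ChartedSpace HM M]
  {VE : Type*} [NormedAddCommGroup VE] [NormedSpace ℝ VE]
  {HE : Type*} [TopologicalSpace HE] {IE : ModelWithCorners ℝ VE HE}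
  {E : Type*} [TopologicalSpace E] [ChartedSpace HE E] [Group E]
  {VG : Type*} [NormedAddCommGroup VG] [NormedSpace ℝ VG]
  {HG : Type*} [TopologicalSpace HG] {IG : ModelWithCorners ℝ VG HG}
  {G : Type*} [TopologicalSpace G] [ChartedSpace HG G] [Group G]
  {X : LiePreCrossedModule IE E IG G} {w : DiffForm IM M 1 VG} {m : DiffForm IM M 2 VE}
  {n : ℕ} {K : (Fin n → ℝ) → M}

/-- The `i`-th coordinate vector of `ℝⁿ`. -/
def basisVec (i : Fin n) : Fin n → ℝ := Pi.single i 1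

/-- The `i`-th component of the pull-back of a `1`-form to `ℝⁿ`. -/
def DiffForm.oneComp {W : Type*} [NormedAddCommGroup W] [NormedSpace ℝ W]
    (w : DiffForm IM M 1 W) (K : (Fin n → ℝ) → M) (i : Fin n) (v : Fin n → ℝ) : W :=
  w.pull K v ![basisVec i]

/-- The components of the pull-back of a `2`-form to `ℝⁿ`. -/
def DiffForm.twoComp {W : Type*} [NormedAddCommGroup W] [NormedSpace ℝ W]
    (m : DiffForm IM M 2 W) (K : (Fin n → ℝ) → M) (i j : Fin n) (v : Fin n → ℝ) : W :=
  m.pull K v ![basisVec i, basisVec j]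

lemma DiffForm.oneComp_eq (w : DiffForm IM M 1 VG) (K : (Fin n → ℝ) → M) (i : Fin n)
    (v : Fin n → ℝ) :
    w.oneComp K i v =
      (w (K v) : VM [⋀^Fin 1]→L[ℝ] VG) ![tderiv 𝓘(ℝ, Fin n → ℝ) IM K v (basisVec i)] := by
  refine congrArg (w (K v) : VM [⋀^Fin 1]→L[ℝ] VG) ?_
  ext j
  fin_cases j
  rfl

lemma DiffForm.twoComp_eq (m : DiffForm IM M 2 VE) (K : (Fin n → ℝ) → M) (i j : Fin n)
    (v : Fin n → ℝ) :
    m.twoComp K i j v =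
      (m (K v) : VM [⋀^Fin 2]→L[ℝ] VE) ![tderiv 𝓘(ℝ, Fin n → ℝ) IM K v (basisVec i),
        tderiv 𝓘(ℝ, Fin n → ℝ) IM K v (basisVec j)] := by
  refine congrArg (m (K v) : VM [⋀^Fin 2]→L[ℝ] VE) ?_
  ext k
  fin_cases k <;> rfl

section Components

variable [IM.Boundaryless] [IsManifold IM ∞ M] (hK : ContMDiff 𝓘(ℝ, Fin n → ℝ) IM ∞ K)
include hK

lemma DiffForm.IsSmooth.d_apply_two (hw : w.IsSmooth) (i j : Fin n) (v : Fin n → ℝ) :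
    (w.d (K v) : VM [⋀^Fin 2]→L[ℝ] VG) ![tderiv 𝓘(ℝ, Fin n → ℝ) IM K v (basisVec i),
        tderiv 𝓘(ℝ, Fin n → ℝ) IM K v (basisVec j)] =
      pderiv i (w.oneComp K j) v - pderiv j (w.oneComp K i) v := by
  have h1 := w.d.twoComp_eq K i j v
  rw [← h1, DiffForm.twoComp, ← hw.extDeriv_pull hK, extDeriv_apply (hw.differentiableAt_pull hK v),
    Fin.sum_univ_two]
  have h2 : Fin.removeNth 0 ![basisVec i, basisVec j] = ![basisVec j] := by
    ext k; fin_cases k; rfl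
  have h3 : Fin.removeNth 1 ![basisVec i, basisVec j] = ![basisVec i] := by
    ext k; fin_cases k; rfl
  rw [h2, h3]
  simp only [Fin.val_zero, pow_zero, one_smul, Fin.val_one, pow_one, neg_smul, ← sub_eq_add_neg]
  rfl

lemma DiffForm.IsSmooth.d_apply_three (hm : m.IsSmooth) (i j k : Fin n) (v : Fin n → ℝ) :
    (m.d (K v) : VM [⋀^Fin 3]→L[ℝ] VE) ![tderiv 𝓘(ℝ, Fin n → ℝ) IM K v (basisVec i),
        tderiv 𝓘(ℝ, Fin n → ℝ) IM K v (basisVec j), tderiv 𝓘(ℝ, Fin n → ℝ) IM K v (basisVec k)] =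
      pderiv i (m.twoComp K j k) v - pderiv j (m.twoComp K i k) v +
        pderiv k (m.twoComp K i j) v := by
  have h1 : (m.d (K v) : VM [⋀^Fin 3]→L[ℝ] VE) ![tderiv 𝓘(ℝ, Fin n → ℝ) IM K v (basisVec i),
        tderiv 𝓘(ℝ, Fin n → ℝ) IM K v (basisVec j), tderiv 𝓘(ℝ, Fin n → ℝ) IM K v (basisVec k)] =
      m.d.pull K v ![basisVec i, basisVec j, basisVec k] := by
    refine congrArg (m.d (K v) : VM [⋀^Fin 3]→L[ℝ] VE) ?_
    ext l
    fin_cases l <;> rfl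
  rw [h1, ← hm.extDeriv_pull hK, extDeriv_apply (hm.differentiableAt_pull hK v),
    Fin.sum_univ_three]
  have h2 : Fin.removeNth 0 ![basisVec i, basisVec j, basisVec k] = ![basisVec j, basisVec k] := by
    ext l; fin_cases l <;> rfl
  have h3 : Fin.removeNth 1 ![basisVec i, basisVec j, basisVec k] = ![basisVec i, basisVec k] := by
    ext l; fin_cases l <;> rfl
  have h4 : Fin.removeNth 2 ![basisVec i, basisVec j, basisVec k] = ![basisVec i, basisVec j] := by
    ext l; fin_cases l <;> rfl
  rw [h2, h3, h4]
  simp only [Fin.val_zero, pow_zero, one_smul, Fin.val_one, pow_one, neg_smul, ← sub_eq_add_neg,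
    Fin.val_two, neg_one_sq]
  rfl

end Components

/-- The partial derivatives of `K`, as velocities of coordinate curves. -/
lemma tderiv_basisVec (hK : ContMDiff 𝓘(ℝ, Fin n → ℝ) IM ∞ K) (v : Fin n → ℝ) (i : Fin n) :
    tderiv 𝓘(ℝ, Fin n → ℝ) IM K v (basisVec i) =
      tderiv 𝓘(ℝ, ℝ) IM (fun r => K (Function.update v i r)) (v i) 1 := by
  have h1 := hasDerivAt_update v i (v i)
  have h2 := tderiv_comp (I := 𝓘(ℝ, ℝ)) (I' := 𝓘(ℝ, Fin n → ℝ)) (J := IM) (g := K)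
    (f := Function.update v i) (x := v i) (hK.mdifferentiable (by simp) _)
    h1.differentiableAt.mdifferentiableAt
  have h3 : tderiv 𝓘(ℝ, ℝ) IM (fun r => K (Function.update v i r)) (v i) =
    tderiv 𝓘(ℝ, ℝ) IM (K ∘ Function.update v i) (v i) := rfl
  rw [h3, h2, Function.update_eq_self, ContinuousLinearMap.comp_apply, tderiv_eq_fderiv,
    fderiv_apply_one_eq_deriv, h1.deriv]
  rfl

lemma tderiv_basisVec_eq_zero (hK : ContMDiff 𝓘(ℝ, Fin n → ℝ) IM ∞ K) {v : Fin n → ℝ} {i : Fin n}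
    (h : ∀ r, K (Function.update v i r) = K v) :
    tderiv 𝓘(ℝ, Fin n → ℝ) IM K v (basisVec i) = 0 := by
  rw [tderiv_basisVec hK, funext h, tderiv_const]
  rfl

lemma alternating_two_eq_zero {V W : Type*} [NormedAddCommGroup V] [NormedSpace ℝ V]
    [NormedAddCommGroup W] [NormedSpace ℝ W] (f : V [⋀^Fin 2]→L[ℝ] W) {u v : V}
    (h : ¬ LinearIndependent ℝ ![u, v]) : f ![u, v] = 0 :=
  f.toAlternatingMap.map_linearDependent _ h

/-- At a point where the rank of `K` is at most two, the covariant exterior derivative of the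
pull-back of `m`, being an alternating `3`-form evaluated on the image of the differential of `K`,
vanishes. -/
lemma covariant_closed [IM.Boundaryless] [IsManifold IM ∞ M] [FiniteDimensional ℝ VM]
    {K : (Fin 3 → ℝ) → M} (hK : ContMDiff 𝓘(ℝ, Fin 3 → ℝ) IM ∞ K) (hm : m.IsSmooth)
    (w : DiffForm IM M 1 VG) (L : VG →L[ℝ] VE →L[ℝ] VE)
    {v : Fin 3 → ℝ}
    (hrank : Module.finrank ℝ (LinearMap.range
      (tderiv 𝓘(ℝ, Fin 3 → ℝ) IM K v).toLinearMap) ≤ 2) :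
    pderiv 0 (m.twoComp K 1 2) v - pderiv 1 (m.twoComp K 0 2) v + pderiv 2 (m.twoComp K 0 1) v +
      L (w.oneComp K 0 v) (m.twoComp K 1 2 v) - L (w.oneComp K 1 v) (m.twoComp K 0 2 v) +
      L (w.oneComp K 2 v) (m.twoComp K 0 1 v) = 0 := by
  set D := tderiv 𝓘(ℝ, Fin 3 → ℝ) IM K v with hD
  let wx : VM [⋀^Fin 1]→L[ℝ] VG := w (K v)
  let mx : VM [⋀^Fin 2]→L[ℝ] VE := m (K v)
  let dx : VM [⋀^Fin 3]→L[ℝ] VE := m.d (K v)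
  let w1 : VM →L[ℝ] VG := (ContinuousAlternatingMap.apply ℝ VM VG ![]).comp wx.curryLeft
  let f : VM →L[ℝ] VM [⋀^Fin 2]→L[ℝ] VE :=
    ((ContinuousLinearMap.compContinuousAlternatingMapCLM ℝ VM VE VE (Fin 2)).flip mx).comp
      (L.comp w1)
  -- the covariant exterior derivative `dm + w ∧ m` at `K v`
  let Ψ : VM [⋀^Fin 3]→L[ℝ] VE := dx + ContinuousAlternatingMap.alternatizeUncurryFin f
  have hdep : ¬ LinearIndependent ℝ ![D (basisVec 0), D (basisVec 1), D (basisVec 2)] := by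
    intro hli
    have h1 := finrank_span_eq_card hli
    have h2 : Submodule.span ℝ (range ![D (basisVec 0), D (basisVec 1), D (basisVec 2)]) ≤
        LinearMap.range D.toLinearMap := by
      rw [Submodule.span_le]
      rintro _ ⟨k, rfl⟩
      fin_cases k <;> exact ⟨_, rfl⟩
    have h3 := Submodule.finrank_mono h2
    rw [h1, Fintype.card_fin] at h3
    omega
  have h0 : Ψ ![D (basisVec 0), D (basisVec 1), D (basisVec 2)] = 0 :=
    Ψ.toAlternatingMap.map_linearDependent _ hdep
  have h1 : dx ![D (basisVec 0), D (basisVec 1), D (basisVec 2)] = _ :=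
    hm.d_apply_three hK 0 1 2 v
  have h2 (i j k : Fin 3) : f (D (basisVec i)) ![D (basisVec j), D (basisVec k)] =
      L (w.oneComp K i v) (m.twoComp K j k v) := by
    rw [m.twoComp_eq, w.oneComp_eq]
    rfl
  have h3 : ContinuousAlternatingMap.alternatizeUncurryFin f
      ![D (basisVec 0), D (basisVec 1), D (basisVec 2)] =
      L (w.oneComp K 0 v) (m.twoComp K 1 2 v) - L (w.oneComp K 1 v) (m.twoComp K 0 2 v) +
      L (w.oneComp K 2 v) (m.twoComp K 0 1 v) := by
    rw [ContinuousAlternatingMap.alternatizeUncurryFin_apply, Fin.sum_univ_three,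
      ← h2, ← h2, ← h2]
    have e0 : Fin.removeNth 0 ![D (basisVec 0), D (basisVec 1), D (basisVec 2)] =
      ![D (basisVec 1), D (basisVec 2)] := by ext1 l; fin_cases l <;> rfl
    have e1 : Fin.removeNth 1 ![D (basisVec 0), D (basisVec 1), D (basisVec 2)] =
      ![D (basisVec 0), D (basisVec 2)] := by ext1 l; fin_cases l <;> rfl
    have e2 : Fin.removeNth 2 ![D (basisVec 0), D (basisVec 1), D (basisVec 2)] =
      ![D (basisVec 0), D (basisVec 1)] := by ext1 l; fin_cases l <;> rfl
    rw [e0, e1, e2]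
    simp only [Fin.val_zero, pow_zero, one_smul, Fin.val_one, pow_one, neg_smul, ← sub_eq_add_neg,
      Fin.val_two, neg_one_sq]
    rfl
  rw [ContinuousAlternatingMap.add_apply, h1, h3] at h0
  rw [← h0]
  abel

/-- A map of rank at most two on the cube which is constant on the faces `t = 0` and `t = 1` pulls
`(w, m)` back to a flat family. -/
theorem isFlatFamily_pull [IM.Boundaryless] [IsManifold IM ∞ M] [FiniteDimensional ℝ VM]
    [LieGroup IE ∞ E] [LieGroup IG ∞ G]
    {K : (Fin 3 → ℝ) → M} (hK : ContMDiff 𝓘(ℝ, Fin 3 → ℝ) IM ∞ K) (hw : w.IsSmooth)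
    (hm : m.IsSmooth)
    (hcurv : ∀ (x : M) (u v : TangentSpace IM x),
      X.bdLie (m x ![u, v]) = LieHolonomy.curvature IG G w x u v)
    (hsource : ∀ v v' : Fin 3 → ℝ, v 0 = 0 → v' 0 = 0 → K v = K v')
    (htarget : ∀ v v' : Fin 3 → ℝ, v 0 = 1 → v' 0 = 1 → K v = K v')
    (hrank : ∀ v ∈ cube 3, Module.finrank ℝ (LinearMap.range
      (tderiv 𝓘(ℝ, Fin 3 → ℝ) IM K v).toLinearMap) ≤ 2) :
    IsFlatFamily X (w.oneComp K) (m.twoComp K) where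
  smooth_one i := hw.contDiff_pull_apply hK _
  smooth_two i j := hm.contDiff_pull_apply hK _
  curvature i j v := by
    rw [← hw.d_apply_two hK, m.twoComp_eq, w.oneComp_eq, w.oneComp_eq]
    exact hcurv (K v) _ _
  base_one s x := by
    have h (i : Fin 3) (hi : i ≠ 0) : w.oneComp K i ![0, s, x] = 0 := by
      rw [w.oneComp_eq, tderiv_basisVec_eq_zero hK fun r => hsource _ _ ?_ rfl]
      · exact ContinuousAlternatingMap.map_coord_zero (M := VM) _ 0 rfl
      · rw [Function.update_of_ne hi.symm]; rfl
    exact ⟨h 1 (by decide), h 2 (by decide)⟩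
  base_two s x := by
    constructor
    · rw [m.twoComp_eq, tderiv_basisVec_eq_zero (i := 1) hK fun r => hsource _ _ ?_ rfl]
      · exact ContinuousAlternatingMap.map_coord_zero (M := VM) _ 0 rfl
      · rw [Function.update_of_ne (by decide)]; rfl
    · rw [m.twoComp_eq, tderiv_basisVec_eq_zero (i := 1) hK fun r => htarget _ _ ?_ rfl]
      · exact ContinuousAlternatingMap.map_coord_zero (M := VM) _ 0 rfl
      · rw [Function.update_of_ne (by decide)]; rfl
  closed v hv := covariant_closed hK hm w X.lieAct (hrank v hv)

end Flatness

/-! ### Extension of cubical paths -/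

section Extension

variable {VM : Type*} [NormedAddCommGroup VM] [NormedSpace ℝ VM]
  {HM : Type*} [TopologicalSpace HM] {IM : ModelWithCorners ℝ VM HM}
  {M : Type*} [TopologicalSpace M] [ChartedSpace HM M]

/-- The extension of a map on the cube to `ℝⁿ` by projecting each coordinate to `[0,1]`. -/
def cubeExtend {n : ℕ} (α : (Fin n → ℝ) → M) (v : Fin n → ℝ) : M := α fun i => clamp (v i)

lemma mem_cube_iff {n : ℕ} {v : Fin n → ℝ} : v ∈ cube n ↔ ∀ i, v i ∈ Icc (0 : ℝ) 1 :=
  ⟨fun h i => ⟨h.1 i, h.2 i⟩, fun h => ⟨fun i => (h i).1, fun i => (h i).2⟩⟩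

omit [TopologicalSpace M] in
lemma cubeExtend_of_mem {n : ℕ} (α : (Fin n → ℝ) → M) : EqOn (cubeExtend α) α (cube n) :=
  fun _ hv => congrArg α (funext fun i => clamp_of_mem (mem_cube_iff.1 hv i))

lemma cube_eq_pi (n : ℕ) : cube n = univ.pi fun _ => Icc (0 : ℝ) 1 := by
  ext v
  rw [mem_cube_iff, mem_univ_pi]

lemma uniqueDiffOn_cube (n : ℕ) : UniqueDiffOn ℝ (cube n) := by
  rw [cube_eq_pi]
  exact UniqueDiffOn.univ_pi fun _ => uniqueDiffOn_Icc zero_lt_one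

omit [TopologicalSpace M] in
/-- A map with a product structure near the boundary does not change if some coordinates are moved
within the boundary layers. -/
lemma eq_of_product {n : ℕ} {α : (Fin n → ℝ) → M} {ε : ℝ}
    (h : ∀ x ∈ cube n, ∀ i : Fin n, (x i ≤ ε → α x = α (Function.update x i 0)) ∧
      (1 - ε ≤ x i → α x = α (Function.update x i 1))) {x y : Fin n → ℝ} (hx : x ∈ cube n)
    (hy : y ∈ cube n)
    (hxy : ∀ i, x i = y i ∨ (x i ≤ ε ∧ y i ≤ ε) ∨ (1 - ε ≤ x i ∧ 1 - ε ≤ y i)) : α x = α y := by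
  classical
  have hmem (S : Finset (Fin n)) : S.piecewise y x ∈ cube n := by
    rw [mem_cube_iff] at hx hy ⊢
    intro i
    by_cases hi : i ∈ S <;> simp only [hi, Finset.piecewise_eq_of_mem, not_false_eq_true,
      Finset.piecewise_eq_of_notMem, hx i, hy i]
  have key (S : Finset (Fin n)) : α x = α (S.piecewise y x) := by
    induction S using Finset.induction_on with
    | empty => simp
    | insert i S hi ih =>
      rw [ih, Finset.piecewise_insert]
      set z := S.piecewise y x with hz
      have hzi : z i = x i := Finset.piecewise_eq_of_notMem _ _ _ hi
      have hmem' : Function.update z i (y i) ∈ cube n := by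
        rw [← Finset.piecewise_insert]; exact hmem _
      have h1 := h z (hmem S) i
      have h2 := h _ hmem' i
      simp only [Function.update_idem, Function.update_self] at h2
      rw [hzi] at h1
      obtain h3 | h3 | h3 := hxy i
      · rw [← h3, ← hzi, Function.update_eq_self]
      · rw [h1.1 h3.1, h2.1 h3.2]
      · rw [h1.2 h3.1, h2.2 h3.2]
  simpa using key Finset.univ

/-- By the product structure near the boundary, the extension of an `n`-path is smooth: near each
point it is the composition of the path with a map into the interior of the cube which leaves alone
the coordinates that are not in a boundary layer, and makes the others constant. -/
lemma IsNPath.contMDiff_cubeExtend {n : ℕ} [NeZero n] {α : (Fin n → ℝ) → M} (hα : IsNPath IM α) :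
    ContMDiff 𝓘(ℝ, Fin n → ℝ) IM ∞ (cubeExtend α) := by
  obtain ⟨ε₀, hε₀, hprod₀⟩ := hα.product
  obtain ⟨ε, hε, hε1, hεε₀⟩ : ∃ ε : ℝ, 0 < ε ∧ ε ≤ 1 / 2 ∧ ε ≤ ε₀ :=
    ⟨min ε₀ (1 / 2), by positivity, min_le_right _ _, min_le_left _ _⟩
  have hprod : ∀ x ∈ cube n, ∀ i : Fin n, (x i ≤ ε → α x = α (Function.update x i 0)) ∧
      (1 - ε ≤ x i → α x = α (Function.update x i 1)) := fun x hx i =>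
    ⟨fun h => (hprod₀ x hx i).1 (h.trans hεε₀), fun h => (hprod₀ x hx i).2 (by linarith)⟩
  intro v
  let σ (u : Fin n → ℝ) (i : Fin n) : ℝ :=
    if v i < ε then ε / 2 else if 1 - ε < v i then 1 - ε / 2 else u i
  have hσ : ContDiff ℝ ∞ σ := by
    rw [contDiff_pi]
    intro i
    by_cases h1 : v i < ε
    · simp only [σ, h1, if_true]; exact contDiff_const
    · by_cases h2 : 1 - ε < v i
      · simp only [σ, h1, h2, if_true, if_false]; exact contDiff_const
      · simp only [σ, h1, h2, if_false]; exact contDiff_apply ℝ ℝ i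
  have hσv (i : Fin n) : σ v i ∈ Ioo (0 : ℝ) 1 := by
    simp only [σ]
    split_ifs with h1 h2
    · constructor <;> linarith
    · constructor <;> linarith
    · constructor <;> linarith
  have hcube : cube n ∈ 𝓝 (σ v) := by
    rw [cube_eq_pi]
    exact set_pi_mem_nhds finite_univ fun i _ => Icc_mem_nhds (hσv i).1 (hσv i).2
  have hsmooth : ContMDiffAt 𝓘(ℝ, Fin n → ℝ) IM ∞ (α ∘ σ) v :=
    (hα.smooth.contMDiffAt hcube).comp v hσ.contMDiff.contMDiffAt
  refine hsmooth.congr_of_eventuallyEq ?_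
  have hnear : ∀ᶠ u in 𝓝 v, ∀ i, (v i < ε → u i < ε) ∧ (1 - ε < v i → 1 - ε < u i) ∧
      (¬ v i < ε → ¬ 1 - ε < v i → u i ∈ Ioo (0 : ℝ) 1) := by
    rw [eventually_all]
    intro i
    have hc : ContinuousAt (fun u : Fin n → ℝ => u i) v := (continuous_apply i).continuousAt
    refine (eventually_imp_distrib_left.2 fun h => hc.eventually_lt_const h).and
      ((eventually_imp_distrib_left.2 fun h => hc.eventually_const_lt h).and
      (eventually_imp_distrib_left.2 fun h => eventually_imp_distrib_left.2 fun h' =>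
        hc.eventually (Ioo_mem_nhds (by linarith) (by linarith))))
  filter_upwards [hnear, hσ.continuous.continuousAt.eventually hcube] with u hu hσu
  refine eq_of_product hprod (mem_cube_iff.2 fun i => clamp_mem _) hσu fun i => ?_
  simp only [σ]
  split_ifs with h1 h2
  · refine .inr (.inl ⟨max_le hε.le ((min_le_right _ _).trans ((hu i).1 h1).le), by linarith⟩)
  · refine .inr (.inr ⟨le_max_of_le_right (le_min (by linarith) ((hu i).2.1 h2).le), by linarith⟩)
  · exact .inl (clamp_of_mem (Ioo_subset_Icc_self ((hu i).2.2 h1 h2)))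

variable {n : ℕ} {α K : (Fin n → ℝ) → M}

section

variable (hK : ContMDiff 𝓘(ℝ, Fin n → ℝ) IM ∞ K) (hα : EqOn K α (cube n))
include hK hα

lemma mfderivWithin_cube {v : Fin n → ℝ} (hv : v ∈ cube n) :
    (mfderivWithin 𝓘(ℝ, Fin n → ℝ) IM α (cube n) v : (Fin n → ℝ) →L[ℝ] VM) =
      tderiv 𝓘(ℝ, Fin n → ℝ) IM K v := by
  have h1 := mfderivWithin_congr (I := 𝓘(ℝ, Fin n → ℝ)) (I' := IM) (fun u hu => (hα hu).symm)
    (hα hv).symm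
  refine Eq.trans (b := (mfderivWithin 𝓘(ℝ, Fin n → ℝ) IM K (cube n) v)) h1 ?_
  exact mfderivWithin_eq_mfderiv ((uniqueDiffOn_cube n).uniqueMDiffOn v hv)
    (hK.mdifferentiable (by simp) v)

lemma partialDeriv_eq {v : Fin n → ℝ} (hv : v ∈ cube n) (i : Fin n) :
    (partialDeriv IM i α v : VM) = tderiv 𝓘(ℝ, Fin n → ℝ) IM K v (basisVec i) :=
  congrArg (fun L : (Fin n → ℝ) →L[ℝ] VM => L (basisVec i)) (mfderivWithin_cube hK hα hv)

lemma rankAt_eq {v : Fin n → ℝ} (hv : v ∈ cube n) :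
    rankAt IM α v =
      Module.finrank ℝ (LinearMap.range (tderiv 𝓘(ℝ, Fin n → ℝ) IM K v).toLinearMap) :=
  congrArg (fun L : (Fin n → ℝ) →L[ℝ] VM => Module.finrank ℝ (LinearMap.range L.toLinearMap))
    (mfderivWithin_cube hK hα hv)

end

lemma contMDiff_face {K : (Fin (n + 1) → ℝ) → M} (hK : ContMDiff 𝓘(ℝ, Fin (n + 1) → ℝ) IM ∞ K)
    (i : Fin (n + 1)) (c : ℝ) : ContMDiff 𝓘(ℝ, Fin n → ℝ) IM ∞ (face i c K) := by
  have h : ContDiff ℝ ∞ fun y : Fin n → ℝ => (Fin.insertNth i c y : Fin (n + 1) → ℝ) := by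
    rw [contDiff_pi]
    intro j
    induction j using Fin.succAboveCases i with
    | x => simp only [Fin.insertNth_apply_same]; exact contDiff_const
    | p j => simp only [Fin.insertNth_apply_succAbove]; exact contDiff_apply ℝ ℝ j
  exact hK.comp h.contMDiff

lemma tderiv_face {K : (Fin (n + 1) → ℝ) → M} (hK : ContMDiff 𝓘(ℝ, Fin (n + 1) → ℝ) IM ∞ K)
    (i : Fin (n + 1)) (c : ℝ) (y : Fin n → ℝ) (j : Fin n) :
    tderiv 𝓘(ℝ, Fin n → ℝ) IM (face i c K) y (basisVec j) =
      tderiv 𝓘(ℝ, Fin (n + 1) → ℝ) IM K (Fin.insertNth i c y) (basisVec (i.succAbove j)) := by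
  rw [tderiv_basisVec (contMDiff_face hK i c), tderiv_basisVec hK]
  simp only [face, Fin.insertNth_update, Fin.insertNth_apply_succAbove]

lemma insertNth_mem_cube {i : Fin (n + 1)} {c : ℝ} (hc : c ∈ Icc (0 : ℝ) 1) {y : Fin n → ℝ}
    (hy : y ∈ cube n) : (Fin.insertNth i c y : Fin (n + 1) → ℝ) ∈ cube (n + 1) := by
  rw [mem_cube_iff] at hy ⊢
  intro j
  induction j using Fin.succAboveCases i with
  | x => simpa using hc
  | p j => simpa using hy j

omit [TopologicalSpace M] in
lemma eqOn_face {K J : (Fin (n + 1) → ℝ) → M} (h : EqOn K J (cube (n + 1))) (i : Fin (n + 1))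
    {c : ℝ} (hc : c ∈ Icc (0 : ℝ) 1) : EqOn (face i c K) (face i c J) (cube n) :=
  fun _ hy => h (insertNth_mem_cube hc hy)

end Extension

/-! ### Holonomy in terms of the pulled back forms -/

section Comparison

variable {VM : Type*} [NormedAddCommGroup VM] [NormedSpace ℝ VM]
  {HM : Type*} [TopologicalSpace HM] {IM : ModelWithCorners ℝ VM HM}
  {M : Type*} [TopologicalSpace M] [ChartedSpace HM M]
  {VE : Type*} [NormedAddCommGroup VE] [NormedSpace ℝ VE]
  {HE : Type*} [TopologicalSpace HE] {IE : ModelWithCorners ℝ VE HE}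
  {E : Type*} [TopologicalSpace E] [ChartedSpace HE E] [Group E]
  {VG : Type*} [NormedAddCommGroup VG] [NormedSpace ℝ VG]
  {HG : Type*} [TopologicalSpace HG] {IG : ModelWithCorners ℝ VG HG}
  {G : Type*} [TopologicalSpace G] [ChartedSpace HG G] [Group G]
  {X : LiePreCrossedModule IE E IG G} {w : DiffForm IM M 1 VG} {m : DiffForm IM M 2 VE}
  {Γ K₂ : (Fin 2 → ℝ) → M}

lemma vec2_mem_cube {t s : ℝ} (ht : t ∈ Icc (0 : ℝ) 1) (hs : s ∈ Icc (0 : ℝ) 1) :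
    ![t, s] ∈ cube 2 := by
  constructor <;> intro i <;> fin_cases i <;> simp [ht.1, hs.1, ht.2, hs.2]

lemma oneIntegrand_slice (hK : ContMDiff 𝓘(ℝ, Fin 2 → ℝ) IM ∞ K₂) (hΓ : EqOn K₂ Γ (cube 2))
    {t s : ℝ} (ht : t ∈ Icc (0 : ℝ) 1) (hs : s ∈ Icc (0 : ℝ) 1) :
    oneIntegrand w (slice Γ s) t = w.oneComp K₂ 0 ![t, s] := by
  have hup (r : ℝ) : Function.update ![t, s] 0 r = ![r, s] := by
    ext i; fin_cases i <;> rfl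
  have h1 : EqOn (slice K₂ s) (slice Γ s) (Icc 0 1) := fun r hr => hΓ (vec2_mem_cube hr hs)
  have hsm : ContMDiff 𝓘(ℝ, ℝ) IM ∞ (slice K₂ s) := by
    have h : ContDiff ℝ ∞ fun r : ℝ => ![r, s] := by
      rw [contDiff_pi]
      intro i
      fin_cases i
      · exact contDiff_id
      · exact contDiff_const
    exact hK.comp h.contMDiff
  have h2 : (mfderivWithin 𝓘(ℝ, ℝ) IM (slice Γ s) (Icc 0 1) t : ℝ →L[ℝ] VM) =
      tderiv 𝓘(ℝ, ℝ) IM (slice K₂ s) t := by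
    have h3 := mfderivWithin_congr (I := 𝓘(ℝ, ℝ)) (I' := IM) (fun u hu => (h1 hu).symm)
      (h1 ht).symm
    refine Eq.trans (b := (mfderivWithin 𝓘(ℝ, ℝ) IM (slice K₂ s) (Icc 0 1) t)) h3 ?_
    exact mfderivWithin_eq_mfderiv ((uniqueDiffOn_Icc zero_lt_one).uniqueMDiffOn t ht)
      (hsm.mdifferentiable (by simp) t)
  have h4 : tderiv 𝓘(ℝ, Fin 2 → ℝ) IM K₂ ![t, s] (basisVec 0) =
      tderiv 𝓘(ℝ, ℝ) IM (slice K₂ s) t 1 := by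
    rw [tderiv_basisVec hK]
    simp only [hup]
    rfl
  let w' : M → VM [⋀^Fin 1]→L[ℝ] VG := w
  have h5 : w' (slice Γ s t) = w' (K₂ ![t, s]) := congrArg w' (h1 ht).symm
  rw [w.oneComp_eq, h4, ← h2]
  exact congrArg (fun f : VM [⋀^Fin 1]→L[ℝ] VG =>
    f ![(mfderivWithin 𝓘(ℝ, ℝ) IM (slice Γ s) (Icc 0 1) t : ℝ →L[ℝ] VM) 1]) h5

lemma twoIntegrand_eq (hK : ContMDiff 𝓘(ℝ, Fin 2 → ℝ) IM ∞ K₂) (hΓ : EqOn K₂ Γ (cube 2))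
    {t s : ℝ} (ht : t ∈ Icc (0 : ℝ) 1) (hs : s ∈ Icc (0 : ℝ) 1) :
    twoIntegrand X w m Γ s t = X.actLie (lieODE IG (fun t => w.oneComp K₂ 0 ![t, s]) 0 t)
      (m.twoComp K₂ 0 1 ![t, s]) := by
  have h1 : oneHolonomy (G := G) IG w (slice Γ s) 0 t =
      lieODE IG (fun t => w.oneComp K₂ 0 ![t, s]) 0 t :=
    lieODE_congr (fun r hr => oneIntegrand_slice hK hΓ hr hs) 0 t
  let m' : M → VM [⋀^Fin 2]→L[ℝ] VE := m
  have h2 : m' (Γ ![t, s]) = m' (K₂ ![t, s]) := congrArg m' (hΓ (vec2_mem_cube ht hs)).symm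
  have h3 (i : Fin 2) : (partialDeriv IM i Γ ![t, s] : VM) = _ :=
    partialDeriv_eq hK hΓ (vec2_mem_cube ht hs) i
  rw [twoIntegrand, h1, m.twoComp_eq, ← h3 0, ← h3 1]
  exact congrArg (fun f : VM [⋀^Fin 2]→L[ℝ] VE => X.actLie _
    (f ![(partialDeriv IM 0 Γ ![t, s] : VM), (partialDeriv IM 1 Γ ![t, s] : VM)])) h2

lemma DiffForm.oneComp_face {n : ℕ} {K : (Fin (n + 1) → ℝ) → M}
    (hK : ContMDiff 𝓘(ℝ, Fin (n + 1) → ℝ) IM ∞ K) (w : DiffForm IM M 1 VG) (i : Fin (n + 1)) (c : ℝ)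
    (j : Fin n) (y : Fin n → ℝ) :
    w.oneComp (face i c K) j y = w.oneComp K (i.succAbove j) (Fin.insertNth i c y) := by
  rw [w.oneComp_eq, w.oneComp_eq, tderiv_face hK]
  rfl

lemma DiffForm.twoComp_face {n : ℕ} {K : (Fin (n + 1) → ℝ) → M}
    (hK : ContMDiff 𝓘(ℝ, Fin (n + 1) → ℝ) IM ∞ K) (m : DiffForm IM M 2 VE) (i : Fin (n + 1)) (c : ℝ)
    (j k : Fin n) (y : Fin n → ℝ) :
    m.twoComp (face i c K) j k y =
      m.twoComp K (i.succAbove j) (i.succAbove k) (Fin.insertNth i c y) := by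
  rw [m.twoComp_eq, m.twoComp_eq, tderiv_face hK, tderiv_face hK]
  rfl

variable {K : (Fin 3 → ℝ) → M} {c : ℝ}

section

variable (hK : ContMDiff 𝓘(ℝ, Fin 3 → ℝ) IM ∞ K) (hΓ : EqOn (face 2 c K) Γ (cube 2))
include hK hΓ

lemma oneIntegrand_of_face {t s : ℝ} (ht : t ∈ Icc (0 : ℝ) 1) (hs : s ∈ Icc (0 : ℝ) 1) :
    oneIntegrand w (slice Γ s) t = w.oneComp K 0 ![t, s, c] := by
  have h : (Fin.insertNth 2 c ![t, s] : Fin 3 → ℝ) = ![t, s, c] := by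
    ext i; fin_cases i <;> rfl
  rw [oneIntegrand_slice (contMDiff_face hK 2 c) hΓ ht hs, w.oneComp_face hK, h]
  rfl

lemma twoIntegrand_of_face {t s : ℝ} (ht : t ∈ Icc (0 : ℝ) 1) (hs : s ∈ Icc (0 : ℝ) 1) :
    twoIntegrand X w m Γ s t =
      frame X (w.oneComp K) t s c (m.twoComp K 0 1 ![t, s, c]) := by
  have h (t : ℝ) : (Fin.insertNth 2 c ![t, s] : Fin 3 → ℝ) = ![t, s, c] := by
    ext i; fin_cases i <;> rfl
  rw [twoIntegrand_eq (contMDiff_face hK 2 c) hΓ ht hs]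
  simp only [w.oneComp_face hK, m.twoComp_face hK, h]
  rw [frame, transport, clamp_of_mem ht]
  rfl

lemma integral_twoIntegrand_of_face {s : ℝ} (hs : s ∈ Icc (0 : ℝ) 1) :
    ∫ t in (0 : ℝ)..1, twoIntegrand X w m Γ s t =
      surfaceIntegral X (w.oneComp K) (m.twoComp K) 1 1 s c := by
  refine intervalIntegral.integral_congr fun t ht => ?_
  rw [uIcc_of_le zero_le_one] at ht
  exact twoIntegrand_of_face hK hΓ ht hs

/-- The holonomy of the slice `x = c` of `K` in terms of the pulled back forms. -/
lemma twoHolonomy_of_face :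
    twoHolonomy X w m Γ 0 1 =
      lieODE IE (fun s => surfaceIntegral X (w.oneComp K) (m.twoComp K) 1 1 s c) 0 1 :=
  lieODE_congr (fun _ hs => integral_twoIntegrand_of_face hK hΓ hs) 0 1

end

lemma twoComp_eq_zero_of_rank_le_one [FiniteDimensional ℝ VM] {n : ℕ} {K : (Fin n → ℝ) → M}
    {v : Fin n → ℝ} (h : Module.finrank ℝ (LinearMap.range
      (tderiv 𝓘(ℝ, Fin n → ℝ) IM K v).toLinearMap) ≤ 1) (i j : Fin n) :
    m.twoComp K i j v = 0 := by
  rw [m.twoComp_eq]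
  refine alternating_two_eq_zero (V := VM) (W := VE) _ fun hli => ?_
  have h1 := finrank_span_eq_card hli
  have h2 : Submodule.span ℝ (range ![tderiv 𝓘(ℝ, Fin n → ℝ) IM K v (basisVec i),
      tderiv 𝓘(ℝ, Fin n → ℝ) IM K v (basisVec j)]) ≤
      LinearMap.range (tderiv 𝓘(ℝ, Fin n → ℝ) IM K v).toLinearMap := by
    rw [Submodule.span_le]
    rintro _ ⟨k, rfl⟩
    fin_cases k <;> exact ⟨_, rfl⟩
  have h3 := Submodule.finrank_mono h2
  rw [h1, Fintype.card_fin] at h3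
  omega

/-- Along a segment over a laminated or path space thin point, the components `m₀₁` and `m₀₂` of the
pulled back `2`-form are proportional. -/
lemma proportional_of_thin {J : (Fin 3 → ℝ) → M} (hK : ContMDiff 𝓘(ℝ, Fin 3 → ℝ) IM ∞ K)
    (hJ : EqOn K J (cube 3)) {s x : ℝ} (hs : s ∈ Icc (0 : ℝ) 1) (hx : x ∈ Icc (0 : ℝ) 1)
    (h : LaminatedAt IM J s x ∨ PathSpaceThinAt IM J s x) :
    (∃ c : ℝ, ∀ t ∈ Icc (0 : ℝ) 1,
      m.twoComp K 0 1 ![t, s, x] = c • m.twoComp K 0 2 ![t, s, x]) ∨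
    ∃ c : ℝ, ∀ t ∈ Icc (0 : ℝ) 1,
      m.twoComp K 0 2 ![t, s, x] = c • m.twoComp K 0 1 ![t, s, x] := by
  have hpd (t : ℝ) (ht : t ∈ Icc (0 : ℝ) 1) (i : Fin 3) :=
    partialDeriv_eq (IM := IM) hK hJ (vec3_mem_cube ht hs hx) i
  obtain ⟨ζ, hζ, hrank⟩ | ⟨a, b, -, hb, hab⟩ := h
  · have h0 (t : ℝ) (ht : t ∈ Icc (0 : ℝ) 1) : m.twoComp K 0 ζ ![t, s, x] = 0 := by
      rw [m.twoComp_eq]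
      refine alternating_two_eq_zero (V := VM) (W := VE) _ fun hli => ?_
      have h1 := finrank_span_eq_card hli
      have h2 : Module.finrank ℝ (Submodule.span ℝ
        ({(partialDeriv IM 0 J ![t, s, x] : VM), (partialDeriv IM ζ J ![t, s, x] : VM)} :
          Set VM)) ≤ 1 := hrank t ht
      rw [hpd t ht, hpd t ht] at h2
      rw [Matrix.range_cons_cons_empty, Fintype.card_fin] at h1
      omega
    obtain rfl | rfl := hζ
    · exact .inl ⟨0, fun t ht => by rw [h0 t ht, zero_smul]⟩
    · exact .inr ⟨0, fun t ht => by rw [h0 t ht, zero_smul]⟩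
  · refine .inr ⟨-(b⁻¹ * a), fun t ht => ?_⟩
    have h1 : a • (partialDeriv IM 1 J ![t, s, x] : VM) +
      b • (partialDeriv IM 2 J ![t, s, x] : VM) = 0 := hab t ht
    rw [hpd t ht, hpd t ht] at h1
    have h2 : tderiv 𝓘(ℝ, Fin 3 → ℝ) IM K ![t, s, x] (basisVec 2) =
        (-(b⁻¹ * a)) • tderiv 𝓘(ℝ, Fin 3 → ℝ) IM K ![t, s, x] (basisVec 1) := by
      have h3 (u v : VM) (h : a • u + b • v = 0) : v = (-(b⁻¹ * a)) • u := by
        rw [neg_smul, mul_smul, ← smul_neg, ← eq_neg_of_add_eq_zero_right h, inv_smul_smul₀ hb]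
      exact h3 _ _ h1
    rw [m.twoComp_eq, m.twoComp_eq, h2]
    let f : VM [⋀^Fin 2]→L[ℝ] VE := m (K ![t, s, x])
    have h3 (u v : VM) (c : ℝ) : f ![u, c • v] = c • f ![u, v] := by
      have h4 := f.map_update_smul ![u, v] 1 c v
      have h5 (z : VM) : Function.update ![u, v] 1 z = ![u, z] := by
        ext i; fin_cases i <;> rfl
      rwa [h5, h5] at h4
    exact h3 _ _ _

section Existence

variable [FiniteDimensional ℝ VM] [FiniteDimensional ℝ VE] [FiniteDimensional ℝ VG]
  [IM.Boundaryless] [IE.Boundaryless] [IG.Boundaryless] [IsManifold IM ∞ M] [LieGroup IE ∞ E]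
  [LieGroup IG ∞ G] (hw : w.IsSmooth) (hm : m.IsSmooth)
  (hcurv : ∀ (x : M) (u v : TangentSpace IM x),
      X.bdLie (m x ![u, v]) = LieHolonomy.curvature IG G w x u v)
include hw hm hcurv

/-- For the homotopy `K` from `Γ` to itself which is constant in `x`, the coefficients of the
differential equations are components of a flat family, hence continuous. -/
theorem IsNPath.twoHolonomyWellDefined (hΓ : IsNPath IM Γ) : TwoHolonomyWellDefined X w m Γ := by
  have : CompleteSpace VE := FiniteDimensional.complete ℝ VE
  have : CompleteSpace VG := FiniteDimensional.complete ℝ VG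
  have hΓc := hΓ.contMDiff_cubeExtend
  let p : (Fin 3 → ℝ) → Fin 2 → ℝ := fun v => ![v 0, v 1]
  have hp : ContDiff ℝ ∞ p := by
    rw [contDiff_pi]
    intro i
    fin_cases i
    · exact contDiff_apply ℝ ℝ 0
    · exact contDiff_apply ℝ ℝ 1
  let K : (Fin 3 → ℝ) → M := cubeExtend Γ ∘ p
  have hK : ContMDiff 𝓘(ℝ, Fin 3 → ℝ) IM ∞ K := hΓc.comp hp.contMDiff
  have hface : EqOn (face 2 0 K) Γ (cube 2) := by
    intro y hy
    have h1 : face 2 0 K y = cubeExtend Γ y := by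
      refine congrArg (cubeExtend Γ) ?_
      ext i; fin_cases i <;> rfl
    rw [h1, cubeExtend_of_mem Γ hy]
  have hclamp (v : Fin 2 → ℝ) : (fun i => clamp (v i)) ∈ cube 2 :=
    mem_cube_iff.2 fun i => clamp_mem _
  have hflat : IsFlatFamily X (w.oneComp K) (m.twoComp K) := by
    refine isFlatFamily_pull hK hw hm hcurv (fun v v' hv hv' => ?_) (fun v v' hv hv' => ?_)
      (fun v _ => ?_)
    · exact hΓ.source _ (hclamp _) _ (hclamp _) (by simp [p, hv, clamp]) (by simp [p, hv', clamp])
    · exact hΓ.target _ (hclamp _) _ (hclamp _) (by simp [p, hv, clamp]) (by simp [p, hv', clamp])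
    · -- the differential of `K` factors through `ℝ²`
      have h1 : tderiv 𝓘(ℝ, Fin 3 → ℝ) IM K v =
          (tderiv 𝓘(ℝ, Fin 2 → ℝ) IM (cubeExtend Γ) (p v)).comp
            (tderiv 𝓘(ℝ, Fin 3 → ℝ) 𝓘(ℝ, Fin 2 → ℝ) p v) :=
        tderiv_comp (hΓc.mdifferentiable (by simp) _) (hp.contMDiff.mdifferentiable (by simp) _)
      rw [h1, ContinuousLinearMap.toLinearMap_comp]
      refine (Submodule.finrank_mono (LinearMap.range_comp_le_range _ _)).trans ?_
      refine (LinearMap.finrank_range_le _).trans ?_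
      simp
  refine ⟨fun s hs => ?_, fun s hs => ?_, ?_⟩
  · refine lieODEWellPosed (ContinuousOn.congr (f := fun t => w.oneComp K 0 ![t, s, 0]) ?_
      fun t ht => oneIntegrand_of_face hK hface ht hs)
    exact ((hflat.smooth_one 0).continuous.comp
      (by fun_prop : Continuous fun t : ℝ => ![t, s, 0])).continuousOn
  · refine ContinuousOn.intervalIntegrable (ContinuousOn.congr (f := fun t =>
      frame X (w.oneComp K) t s 0 (m.twoComp K 0 1 ![t, s, 0])) ?_ fun t ht => ?_)
    · exact ((hflat.continuous_integrand 1).comp₃ continuous_id continuous_const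
        continuous_const).continuousOn
    · rw [uIcc_of_le zero_le_one] at ht
      exact twoIntegrand_of_face hK hface ht hs
  · refine lieODEWellPosed (ContinuousOn.congr (f := fun s =>
      surfaceIntegral X (w.oneComp K) (m.twoComp K) 1 1 s 0) ?_
      fun s hs => integral_twoIntegrand_of_face hK hface hs)
    exact ((hflat.continuous_surfaceIntegral 1).comp₃ continuous_const continuous_id
      continuous_const).continuousOn

/-- The extension to `ℝ³` of a rank-2 homotopy pulls the forms back to a flat family. The rank
condition on the two side homotopies makes `m₀₂` vanish for `s = 0` and `s = 1`. -/
theorem IsStrongRankTwoHomotopy.twoHolonomy_eq {J : (Fin 3 → ℝ) → M} {Γ' : (Fin 2 → ℝ) → M}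
    (hJ : IsStrongRankTwoHomotopy IM J Γ Γ')
    (hthin : X.IsCrossedModule ∨ IsLaminatedRankTwoHomotopy IM J Γ Γ') :
    twoHolonomy X w m Γ 0 1 = twoHolonomy X w m Γ' 0 1 := by
  have : CompleteSpace VE := FiniteDimensional.complete ℝ VE
  have : CompleteSpace VG := FiniteDimensional.complete ℝ VG
  have h0 : (0 : ℝ) ∈ Icc (0 : ℝ) 1 := by simp
  have h1 : (1 : ℝ) ∈ Icc (0 : ℝ) 1 := by simp
  have hK := hJ.isNPath.contMDiff_cubeExtend
  have hKJ := cubeExtend_of_mem J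
  set K := cubeExtend J with hKdef
  have hclamp (v : Fin 3 → ℝ) : (fun i => clamp (v i)) ∈ cube 3 :=
    mem_cube_iff.2 fun i => clamp_mem _
  have hflat : IsFlatFamily X (w.oneComp K) (m.twoComp K) := by
    refine isFlatFamily_pull hK hw hm hcurv (fun v v' hv hv' => ?_) (fun v v' hv hv' => ?_)
      (fun v hv => ?_)
    · exact hJ.isNPath.source _ (hclamp _) _ (hclamp _) (by simp [hv, clamp]) (by simp [hv', clamp])
    · exact hJ.isNPath.target _ (hclamp _) _ (hclamp _) (by simp [hv, clamp]) (by simp [hv', clamp])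
    · rw [← rankAt_eq hK hKJ hv]
      exact hJ.rank_le v hv
  rw [twoHolonomy_of_face hK ((eqOn_face hKJ 2 h0).trans hJ.source),
    twoHolonomy_of_face hK ((eqOn_face hKJ 2 h1).trans hJ.target)]
  have hside {c : ℝ} (hc : c ∈ Icc (0 : ℝ) 1) (hr : ∀ v ∈ cube 2, rankAt IM (face 1 c J) v ≤ 1)
      {t x : ℝ} (ht : t ∈ Icc (0 : ℝ) 1) (hx : x ∈ Icc (0 : ℝ) 1) :
      m.twoComp K 0 2 ![t, c, x] = 0 := by
    have h2 := hr _ (vec2_mem_cube ht hx)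
    rw [rankAt_eq (contMDiff_face hK 1 c) (eqOn_face hKJ 1 hc) (vec2_mem_cube ht hx)] at h2
    have h3 := twoComp_eq_zero_of_rank_le_one (m := m) h2 0 1
    rw [m.twoComp_face hK] at h3
    have h4 : (Fin.insertNth 1 c ![t, x] : Fin 3 → ℝ) = ![t, c, x] := by
      ext i; fin_cases i <;> rfl
    rw [h4] at h3
    exact h3
  refine hflat.lieODE_surfaceIntegral_eq
    (fun t ht x hx => ⟨hside h0 hJ.bottom.rank_le ht hx, hside h1 hJ.top.rank_le ht hx⟩)
    (hthin.imp_right fun hlam => ?_)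
  filter_upwards [hlam.laminated] with p hp hp1 hp2
  exact proportional_of_thin hK hKJ (Ioo_subset_Icc_self hp1) (Ioo_subset_Icc_self hp2)
    (hp hp1 hp2)

end Existence

end Comparison

end

end LieHolonomy

theorem mainTheorem4
    {VM : Type*} [NormedAddCommGroup VM] [NormedSpace ℝ VM] [FiniteDimensional ℝ VM]
    {HM : Type*} [TopologicalSpace HM] (IM : ModelWithCorners ℝ VM HM) [IM.Boundaryless]
    {M : Type*} [TopologicalSpace M] [T2Space M] [ChartedSpace HM M] [IsManifold IM ∞ M]
    {VE : Type*} [NormedAddCommGroup VE] [NormedSpace ℝ VE] [FiniteDimensional ℝ VE]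
    {HE : Type*} [TopologicalSpace HE] (IE : ModelWithCorners ℝ VE HE) [IE.Boundaryless]
    {E : Type*} [TopologicalSpace E] [T2Space E] [ChartedSpace HE E] [Group E] [LieGroup IE ∞ E]
    {VG : Type*} [NormedAddCommGroup VG] [NormedSpace ℝ VG] [FiniteDimensional ℝ VG]
    {HG : Type*} [TopologicalSpace HG] (IG : ModelWithCorners ℝ VG HG) [IG.Boundaryless]
    {G : Type*} [TopologicalSpace G] [T2Space G] [ChartedSpace HG G] [Group G] [LieGroup IG ∞ G]
    (X : LieHolonomy.LiePreCrossedModule IE E IG G)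
    (w : LieHolonomy.DiffForm IM M 1 VG) (hw : w.IsSmooth)
    (m : LieHolonomy.DiffForm IM M 2 VE) (hm : m.IsSmooth)
    (hcurv : ∀ (x : M) (u v : TangentSpace IM x),
      X.bdLie (m x ![u, v]) = LieHolonomy.curvature IG G w x u v) :
    (∀ Γ : (Fin 2 → ℝ) → M, LieHolonomy.IsNPath IM Γ →
      LieHolonomy.TwoHolonomyWellDefined X w m Γ) ∧
    (∀ Γ Γ' : (Fin 2 → ℝ) → M, LieHolonomy.IsNPath IM Γ → LieHolonomy.IsNPath IM Γ' →
      LieHolonomy.LaminatedRankTwoHomotopic IM Γ Γ' →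
      LieHolonomy.twoHolonomy X w m Γ 0 1 = LieHolonomy.twoHolonomy X w m Γ' 0 1) ∧
    (X.IsCrossedModule →
      ∀ Γ Γ' : (Fin 2 → ℝ) → M, LieHolonomy.IsNPath IM Γ → LieHolonomy.IsNPath IM Γ' →
        LieHolonomy.StrongRankTwoHomotopic IM Γ Γ' →
        LieHolonomy.twoHolonomy X w m Γ 0 1 = LieHolonomy.twoHolonomy X w m Γ' 0 1) := by
  refine ⟨fun Γ hΓ => hΓ.twoHolonomyWellDefined hw hm hcurv, ?_, ?_⟩
  · rintro Γ Γ' - - ⟨J, hJ⟩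
    exact hJ.isStrong.twoHolonomy_eq hw hm hcurv (.inr hJ)
  · rintro hX Γ Γ' - - ⟨J, hJ⟩
    exact hJ.twoHolonomy_eq hw hm hcurv (.inl hX)
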